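/- Let $\mathcal E=\{x\in\mathbb R : |x|>1\}$ and $g>0$; all function spaces are complex. Let $W^{1,2}(\mathcal E)=\{v\in L^2(\mathcal E) : v'\in L^2(\mathcal E)\}$ (weak derivative) with norm $\|v\|^2_{W^{1,2}}=\|v\|^2_{L^2}+\|v'\|^2_{L^2}$, and let $$W^{\frac12,2}(\mathcal E)=\Big\{v\in L^2(\mathcal E) : \|v\|^2_{W^{1/2,2}}:=\|v\|_{L^2(\mathcal E)}^2+\iint_{\mathcal E\times\mathcal E}\frac{|v(x)-v(y)|^2}{|x-y|^2}\,dx\,dy<\infty\Big\}.$$ For $v:\mathcal E\to\mathbb C$ let $\eta(v):\mathbb R\to\mathbb C$ be given by $\eta(v)(x)=v(x)$ for $|x|>1$, $\eta(v)(x)=v(1/x)$ for $0<|x|<1$, $\eta(v)(0)=0$. Let $\Lambda_{\mathbb H}:W^{1,2}(\mathbb R)\to L^2(\mathbb R)$ be the Dirichlet-to-Neumann map of the upper half-plane, $\widehat{\Lambda_{\mathbb H}\eta}(\xi)=|\xi|\hat\eta(\xi)$ (with $\hat\eta(\xi)=\int e^{-ix\xi}\eta(x)\,dx$). There is exactly one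 bounded linear operator $\Lambda_\Omega:W^{1,2}(\mathcal E)\to L^2(\mathcal E)$ with $\Lambda_\Omega v=(\Lambda_{\mathbb H}\,\eta(v))|_{\mathcal E}$ for every $v\in W^{1,2}(\mathcal E)$ that vanishes outside a bounded set; it is the Dirichlet-to-Neumann map of $\Omega=\{(x,y) : x^2+y^2>1,\ y>0\}$ with homogeneous Neumann condition on the half circle. Moreover $W^{1,2}(\mathcal E)$ is a dense subspace of $W^{\frac12,2}(\mathcal E)$, and on it the norm $v\mapsto\langle v+g\Lambda_\Omega v,v\rangle_{L^2(\mathcal E)}^{1/2}=\|(I+g\Lambda_\Omega)^{\frac12}v\|_{L^2(\mathcal E)}$ is equivalent to the norm of $W^{\frac12,2}(\mathcal E)$. Let $X=W^{\frac12,2}(\mathcal E)\times\mathbb C\times L^2(\mathcal E)\times\mathbb C$ (with any of the equivalent product norms), and let $A:\mathcal D(A)\to X$ be the operator $$\mathcal D(A)=W^{1,2}(\mathcal E)\times\mathbb C\times W^{\frac12,2}(\mathcal E)\times\mathbb C,\qquad A(v,h,u,\ell)=\Big(u,\ \ell,\ -g\Lambda_\Omega v,\ -\frac{2g}{\pi}h\Big).$$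 Then $A$ generates a $C^0$ group on $X$: there is a strongly continuous group $(\mathbb T_t)_{t\in\mathbb R}$ of bounded operators on $X$ such that $\mathcal D(A)$ is exactly the set of $z\in X$ for which $\lim_{t\to0}\frac1t(\mathbb T_tz-z)$ exists in $X$, and this limit equals $Az$ for $z\in\mathcal D(A)$. -/

import Mathlib

open MeasureTheory Filter Topology
open scoped ContDiff FourierTransform

noncomputable section

namespace FloatingCylinder

/-- The free surface `ℰ = {x ∈ ℝ : |x| > 1}`. -/
def freeSurface : Set ℝ := {x | 1 < |x|}

/-- Lebesgue measure on `ℰ`. -/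
abbrev surfaceMeasure : Measure ℝ := volume.restrict freeSurface

/-- The complex space `L²(ℰ)`. -/
abbrev L2E : Type := Lp ℂ 2 surfaceMeasure

/-- The complex space `L²(ℰ × ℰ)`. -/
abbrev L2EE : Type := Lp ℂ 2 (surfaceMeasure.prod surfaceMeasure)

lemma isOpen_freeSurface : IsOpen freeSurface :=
  isOpen_lt continuous_const continuous_abs

/-- `w` is the weak derivative of `v` on the open set `ℰ`:
`∫_ℰ φ' v = - ∫_ℰ φ w` for every test function `φ ∈ C_c^∞(ℰ)`. -/
def IsWeakDeriv (v w : L2E) : Prop :=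
  ∀ φ : ℝ → ℝ, ContDiff ℝ ∞ φ → HasCompactSupport φ → tsupport φ ⊆ freeSurface →
    ∫ x in freeSurface, deriv φ x • v x = -∫ x in freeSurface, φ x • w x

/-- `q` is the difference quotient `(x, y) ↦ (v x - v y) / (x - y)` of `v`
(almost everywhere on `ℰ × ℰ`). -/
def IsDiffQuotient (v : L2E) (q : L2EE) : Prop :=
  ∀ᵐ p ∂(surfaceMeasure.prod surfaceMeasure), q p = (v p.1 - v p.2) / ((p.1 - p.2 : ℝ) : ℂ)

lemma integrable_smul_of_test {φ : ℝ → ℝ} (hφ : Continuous φ) (hc : HasCompactSupport φ)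
    (v : L2E) : Integrable (fun x => φ x • v x) surfaceMeasure := by
  have h1 : MemLp φ 2 surfaceMeasure := hφ.memLp_of_hasCompactSupport hc
  exact (Lp.memLp v).integrable_mul (p := 2) (q := 2) (h1.ofReal (K := ℂ)) |>.congr
    (Eventually.of_forall fun x => by simp [mul_comm])

lemma integral_add_test {φ : ℝ → ℝ} (hφ : Continuous φ) (hc : HasCompactSupport φ)
    (v w : L2E) : ∫ x in freeSurface, φ x • (v + w : L2E) x
      = (∫ x in freeSurface, φ x • v x) + ∫ x in freeSurface, φ x • w x := by
  rw [← integral_add (integrable_smul_of_test hφ hc v) (integrable_smul_of_test hφ hc w)]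
  refine integral_congr_ae ?_
  filter_upwards [Lp.coeFn_add v w] with x hx
  rw [hx, Pi.add_apply, smul_add]

lemma integral_smul_test (φ : ℝ → ℝ) (c : ℂ) (v : L2E) :
    ∫ x in freeSurface, φ x • (c • v : L2E) x = c * ∫ x in freeSurface, φ x • v x := by
  rw [← integral_const_mul]
  refine integral_congr_ae ?_
  filter_upwards [Lp.coeFn_smul c v] with x hx
  simp [hx]
  ring

lemma integral_zero_test (φ : ℝ → ℝ) :
    ∫ x in freeSurface, φ x • (0 : L2E) x = 0 := by
  have := integral_smul_test φ 0 0
  simpa using this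

/-- The Sobolev space `W^{1,2}(ℰ)`. Its elements are the functions `v ∈ L²(ℰ)` having a weak
derivative in `L²(ℰ)`; such a `v` is stored together with its (unique) weak derivative, as the pair
`(v, v')`, so that the norm inherited from `L²(ℰ) × L²(ℰ)` is the usual one,
`‖v‖² = ‖v‖²_{L²} + ‖v'‖²_{L²}`. -/
def sobolevOne : Submodule ℂ (WithLp 2 (L2E × L2E)) where
  carrier := {p | IsWeakDeriv p.fst p.snd}
  zero_mem' := by
    intro φ _ _ _
    simp only [WithLp.zero_fst, WithLp.zero_snd, integral_zero_test, neg_zero]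
  add_mem' := by
    intro p q hp hq φ h1 h2 h3
    have hd : Continuous (deriv φ) := h1.continuous_deriv (by simp)
    simp only [WithLp.add_fst, WithLp.add_snd]
    rw [integral_add_test hd h2.deriv, integral_add_test h1.continuous h2,
      hp φ h1 h2 h3, hq φ h1 h2 h3, neg_add]
  smul_mem' := by
    intro c p hp φ h1 h2 h3
    simp only [WithLp.smul_fst, WithLp.smul_snd]
    rw [integral_smul_test, integral_smul_test, hp φ h1 h2 h3, mul_neg]

/-- The Sobolev space `W^{1/2,2}(ℰ)`. Its elements are the functions `v ∈ L²(ℰ)` whose difference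
quotient `q(x,y) = (v(x) - v(y)) / (x - y)` is in `L²(ℰ × ℰ)`; such a `v` is stored together with
`q`, as the pair `(v, q)`, so that the norm inherited from `L²(ℰ) × L²(ℰ × ℰ)` is
`‖v‖² = ‖v‖²_{L²} + ∬_{ℰ × ℰ} |v(x) - v(y)|² / |x - y|² dx dy`. -/
def sobolevHalf : Submodule ℂ (WithLp 2 (L2E × L2EE)) where
  carrier := {p | IsDiffQuotient p.fst p.snd}
  zero_mem' := by
    have h := Lp.coeFn_zero ℂ 2 surfaceMeasure
    filter_upwards [Lp.coeFn_zero ℂ 2 (surfaceMeasure.prod surfaceMeasure),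
      Measure.quasiMeasurePreserving_fst.ae h, Measure.quasiMeasurePreserving_snd.ae h]
      with p h0 h1 h2
    simp only [WithLp.zero_fst, WithLp.zero_snd]
    rw [h0, h1, h2]
    simp
  add_mem' := by
    intro p q hp hq
    have h := Lp.coeFn_add p.fst q.fst
    filter_upwards [hp, hq, Lp.coeFn_add p.snd q.snd,
      Measure.quasiMeasurePreserving_fst.ae h, Measure.quasiMeasurePreserving_snd.ae h]
      with z hp hq h0 h1 h2
    simp only [WithLp.add_fst, WithLp.add_snd]
    rw [h0, h1, h2, Pi.add_apply, Pi.add_apply, Pi.add_apply, hp, hq]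
    ring
  smul_mem' := by
    intro c p hp
    have h := Lp.coeFn_smul c p.fst
    filter_upwards [hp, Lp.coeFn_smul c p.snd,
      Measure.quasiMeasurePreserving_fst.ae h, Measure.quasiMeasurePreserving_snd.ae h]
      with z hp h0 h1 h2
    simp only [WithLp.smul_fst, WithLp.smul_snd]
    rw [h0, h1, h2, Pi.smul_apply, Pi.smul_apply, Pi.smul_apply, hp]
    simp only [smul_eq_mul]
    ring

/-- The inclusion `W^{1,2}(ℰ) → L²(ℰ)`. -/
def oneToL2 : sobolevOne →L[ℂ] L2E := (WithLp.fstL 2 ℂ L2E L2E).comp sobolevOne.subtypeL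

/-- The inclusion `W^{1/2,2}(ℰ) → L²(ℰ)`. -/
def halfToL2 : sobolevHalf →L[ℂ] L2E := (WithLp.fstL 2 ℂ L2E L2EE).comp sobolevHalf.subtypeL

lemma oneToL2_injective : Function.Injective oneToL2 := by
  rw [injective_iff_map_eq_zero]
  rintro ⟨p, hp⟩ h0
  have hfst : p.fst = 0 := h0
  have hp' : IsWeakDeriv p.fst p.snd := hp
  have hsnd : p.snd = 0 := by
    rw [Lp.eq_zero_iff_ae_eq_zero]
    have hloc : LocallyIntegrableOn (fun x => p.snd x) freeSurface volume :=
      locallyIntegrableOn_of_locallyIntegrable_restrict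
        ((Lp.memLp p.snd).locallyIntegrable (by norm_num))
    have key := isOpen_freeSurface.ae_eq_zero_of_integral_contDiff_smul_eq_zero hloc (by
      intro φ h1 h2 h3
      have h := hp' φ h1 h2 h3
      rw [hfst, integral_zero_test, zero_eq_neg] at h
      rw [← h, setIntegral_eq_integral_of_forall_compl_eq_zero]
      intro x hx
      rw [image_eq_zero_of_notMem_tsupport fun hx' => hx (h3 hx'), zero_smul])
    exact (ae_restrict_iff' isOpen_freeSurface.measurableSet).2 key
  apply Subtype.ext
  apply WithLp.ofLp_injective
  exact Prod.ext hfst hsnd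

lemma halfToL2_injective : Function.Injective halfToL2 := by
  rintro ⟨p, hp⟩ ⟨q, hq⟩ h
  have hfst : p.fst = q.fst := h
  have hp' : IsDiffQuotient p.fst p.snd := hp
  have hq' : IsDiffQuotient q.fst q.snd := hq
  have hsnd : p.snd = q.snd := by
    apply Lp.ext
    filter_upwards [hp', hq'] with z h1 h2
    rw [h1, h2, hfst]
  apply Subtype.ext
  apply WithLp.ofLp_injective
  exact Prod.ext hfst hsnd

/-- The extension by inversion `η(v)` of a function `v` given on `ℰ` to the real line:
`η(v)(x) = v(x)` on `ℰ`, `η(v)(x) = v(1/x)` for `0 < |x| < 1` (and `η(v)(0) = 0`). -/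
def inversionExtension (v : ℝ → ℂ) (x : ℝ) : ℂ :=
  if 1 < |x| then v x else if x = 0 then 0 else v x⁻¹

/-- `F = Λ_ℍ η`, for `η ∈ W^{1,2}(ℝ)`, where `Λ_ℍ` is the Dirichlet-to-Neumann map of the upper
half-plane, i.e. the Fourier multiplier `|D|`. The Fourier transform of Mathlib is
`η̂(ξ) = ∫ exp(-2πixξ) η(x) dx`, so that the symbol of `|D|` is `2π|ξ|`. -/
def IsHalfPlaneDtN (η : ℝ → ℂ) (F : Lp ℂ 2 (volume : Measure ℝ)) : Prop :=
  ∃ hη : MemLp η 2 volume,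
    (𝓕 F : Lp ℂ 2 (volume : Measure ℝ)) =ᵐ[volume]
      fun ξ => ((2 * Real.pi * |ξ| : ℝ) : ℂ) * (𝓕 (hη.toLp η) : Lp ℂ 2 (volume : Measure ℝ)) ξ

/-- `v ∈ W^{1,2}(ℰ)` has a support which is bounded, i.e. compact as a subset of `ℝ`
(it may contain the end points `±1`). -/
def HasBoundedSupport (v : sobolevOne) : Prop :=
  ∃ R : ℝ, ∀ᵐ x ∂surfaceMeasure, R ≤ |x| → oneToL2 v x = 0

/-- `Λ` is the Dirichlet-to-Neumann map `Λ_Ω` of `Ω = {x² + y² > 1, y > 0}`, with Neumann condition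
on the half circle: the bounded operator `W^{1,2}(ℰ) → L²(ℰ)` given by `Λ v = (Λ_ℍ η(v))|_ℰ` for the
`v` with bounded support. -/
def IsDirichletToNeumann (Λ : sobolevOne →L[ℂ] L2E) : Prop :=
  ∀ v : sobolevOne, HasBoundedSupport v →
    ∃ F : Lp ℂ 2 (volume : Measure ℝ),
      IsHalfPlaneDtN (inversionExtension (oneToL2 v)) F ∧ Λ v =ᵐ[surfaceMeasure] F

/-- The squared energy norm `‖(I + gΛ)^{1/2} v‖² = ⟨v + gΛv, v⟩` of `v ∈ W^{1,2}(ℰ)`. -/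
def energySq (g : ℝ) (Λ : sobolevOne →L[ℂ] L2E) (v : sobolevOne) : ℝ :=
  (inner ℂ (oneToL2 v) (oneToL2 v + (g : ℂ) • Λ v)).re

/-- The state space `X = W^{1/2,2}(ℰ) × ℂ × L²(ℰ) × ℂ`. (The norm of a product is the maximum of
the norms of the components, which is equivalent to the Hilbert norm.) -/
abbrev State : Type := sobolevHalf × ℂ × L2E × ℂ

/-- The set of all `(v, h, u, ℓ) ∈ X` with `v ∈ W^{1,2}(ℰ)` and `u ∈ W^{1/2,2}(ℰ)`. -/
def waveDomain : Submodule ℂ State where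
  carrier := {z | halfToL2 z.1 ∈ LinearMap.range oneToL2.toLinearMap ∧
    z.2.2.1 ∈ LinearMap.range halfToL2.toLinearMap}
  zero_mem' := ⟨by simp, by simp⟩
  add_mem' := fun {a b} ha hb => ⟨by simpa using add_mem ha.1 hb.1, add_mem ha.2 hb.2⟩
  smul_mem' := fun c {a} ha =>
    ⟨by simpa using Submodule.smul_mem _ c ha.1, Submodule.smul_mem _ c ha.2⟩

/-- The component `v` of an element of the domain, as an element of `W^{1,2}(ℰ)`. -/
def waveDomainPosition : waveDomain →ₗ[ℂ] sobolevOne :=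
  (LinearEquiv.ofInjective oneToL2.toLinearMap oneToL2_injective).symm.toLinearMap ∘ₗ
    LinearMap.codRestrict (LinearMap.range oneToL2.toLinearMap)
      (halfToL2.toLinearMap ∘ₗ LinearMap.fst ℂ _ _ ∘ₗ waveDomain.subtype) (fun z => z.2.1)

/-- The component `u` of an element of the domain, as an element of `W^{1/2,2}(ℰ)`. -/
def waveDomainVelocity : waveDomain →ₗ[ℂ] sobolevHalf :=
  (LinearEquiv.ofInjective halfToL2.toLinearMap halfToL2_injective).symm.toLinearMap ∘ₗ
    LinearMap.codRestrict (LinearMap.range halfToL2.toLinearMap)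
      (LinearMap.fst ℂ _ _ ∘ₗ LinearMap.snd ℂ _ _ ∘ₗ LinearMap.snd ℂ _ _ ∘ₗ waveDomain.subtype)
      (fun z => z.2.2)

lemma oneToL2_waveDomainPosition (z : waveDomain) :
    oneToL2 (waveDomainPosition z) = halfToL2 z.1.1 :=
  congrArg Subtype.val ((LinearEquiv.ofInjective oneToL2.toLinearMap
    oneToL2_injective).apply_symm_apply ⟨halfToL2 z.1.1, z.2.1⟩)

lemma halfToL2_waveDomainVelocity (z : waveDomain) :
    halfToL2 (waveDomainVelocity z) = z.1.2.2.1 :=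
  congrArg Subtype.val ((LinearEquiv.ofInjective halfToL2.toLinearMap
    halfToL2_injective).apply_symm_apply ⟨z.1.2.2.1, z.2.2⟩)

/-- The unbounded operator `A (v, h, u, ℓ) = (u, ℓ, -gΛv, -(2g/π)h)` on `X`, with domain
`W^{1,2}(ℰ) × ℂ × W^{1/2,2}(ℰ) × ℂ`. -/
def waveOperator (g : ℝ) (Λ : sobolevOne →L[ℂ] L2E) : State →ₗ.[ℂ] State where
  domain := waveDomain
  toFun :=
    { toFun := fun z =>
        (waveDomainVelocity z, z.1.2.2.2,
          -((g : ℂ) • Λ (waveDomainPosition z)), -(((2 * g / Real.pi : ℝ) : ℂ) * z.1.2.1))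
      map_add' := by
        intro a b
        simp only [map_add, smul_add, neg_add, Submodule.coe_add, Prod.fst_add, Prod.snd_add,
          mul_add, Prod.mk_add_mk]
      map_smul' := by
        intro c a
        simp only [map_smul, Submodule.coe_smul, Prod.smul_fst, Prod.smul_snd, smul_eq_mul,
          RingHom.id_apply, Prod.smul_mk, smul_neg, smul_comm c, Prod.mk.injEq, true_and, mul_neg,
          neg_inj]
        ring }

section Group

variable {Y : Type*} [NormedAddCommGroup Y] [NormedSpace ℂ Y]

/-- `T` is a `C⁰` group (a strongly continuous group of bounded operators) on `Y`. -/
structure IsC0Group (T : ℝ → Y →L[ℂ] Y) : Prop where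
  map_zero : T 0 = ContinuousLinearMap.id ℂ Y
  map_add : ∀ s t : ℝ, T (s + t) = (T s).comp (T t)
  tendsto_zero : ∀ z : Y, Tendsto (fun t => T t z) (𝓝 0) (𝓝 z)

/-- `A` generates a `C⁰` group `T` on `Y`: the domain of `A` consists exactly of the `z` for which
`(T_t z - z) / t` has a limit as `t → 0`, and this limit is `A z`. -/
def GeneratesC0Group (A : Y →ₗ.[ℂ] Y) : Prop :=
  ∃ T : ℝ → Y →L[ℂ] Y, IsC0Group T ∧
    ∀ z y : Y, (z, y) ∈ A.graph ↔
      Tendsto (fun t : ℝ => ((t⁻¹ : ℝ) : ℂ) • (T t z - z)) (𝓝[≠] 0) (𝓝 y)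

end Group

end FloatingCylinder

end

noncomputable section

namespace FloatingCylinder

section Generation

set_option linter.unusedSectionVars false

open scoped InnerProductSpace

variable {X H : Type*} [NormedAddCommGroup X] [NormedSpace ℂ X] [CompleteSpace X]
  [NormedAddCommGroup H] [InnerProductSpace ℂ H]

lemma hasDerivAt_exp_ofReal_smul (B : X →L[ℂ] X) (t : ℝ) :
    HasDerivAt (fun s : ℝ => NormedSpace.exp ((s : ℂ) • B))
      (NormedSpace.exp ((t : ℂ) • B) * B) t := by
  simpa [Function.comp_def] using HasDerivAt.scomp t
    (hasDerivAt_exp_smul_const (𝕂 := ℂ) B (t : ℂ)) Complex.ofRealCLM.hasDerivAt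

lemma hasDerivAt_exp_ofReal_smul' (B : X →L[ℂ] X) (t : ℝ) :
    HasDerivAt (fun s : ℝ => NormedSpace.exp ((s : ℂ) • B))
      (B * NormedSpace.exp ((t : ℂ) • B)) t := by
  simpa [Function.comp_def] using HasDerivAt.scomp t
    (hasDerivAt_exp_smul_const' (𝕂 := ℂ) B (t : ℂ)) Complex.ofRealCLM.hasDerivAt

/-- An exponential bound for the flow of a bounded operator that is quasi-skew for the
energy `‖J z‖²`. -/
lemma norm_exp_le_of_quasiSkew (J : X →L[ℂ] H) (B : X →L[ℂ] X) (γ : ℝ)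
    (hB : ∀ z, |(⟪J z, J (B z)⟫_ℂ).re| ≤ γ * ‖J z‖ ^ 2) (t : ℝ) (z : X) :
    ‖J (NormedSpace.exp ((t : ℂ) • B) z)‖ ≤ Real.exp (γ * |t|) * ‖J z‖ := by
  have key : ∀ C : X →L[ℂ] X, (∀ z, |(⟪J z, J (C z)⟫_ℂ).re| ≤ γ * ‖J z‖ ^ 2) →
      ∀ t : ℝ, 0 ≤ t → ‖J (NormedSpace.exp ((t : ℂ) • C) z)‖ ≤ Real.exp (γ * t) * ‖J z‖ := by
    intro C hC t ht
    let u : ℝ → H := fun s => J (NormedSpace.exp ((s : ℂ) • C) z)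
    have hu : ∀ s : ℝ, HasDerivAt u (J (C (NormedSpace.exp ((s : ℂ) • C) z))) s := by
      intro s
      have h4 := ((J ∘L ContinuousLinearMap.apply ℂ X z).restrictScalars ℝ).hasFDerivAt.comp_hasDerivAt
        s (hasDerivAt_exp_ofReal_smul' C s)
      simpa [u, Function.comp_def] using h4
    let f : ℝ → ℝ := fun s => Real.exp (-(2 * γ) * s) * ‖u s‖ ^ 2
    have hf : ∀ s, HasDerivAt f (Real.exp (-(2 * γ) * s) * (-(2 * γ)) * ‖u s‖ ^ 2
        + Real.exp (-(2 * γ) * s) *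
          (2 * (⟪J (NormedSpace.exp ((s : ℂ) • C) z),
            J (C (NormedSpace.exp ((s : ℂ) • C) z))⟫_ℂ).re)) s := by
      intro s
      let _ := InnerProductSpace.rclikeToReal ℂ H
      have h1 := (hu s).norm_sq
      have h2 : HasDerivAt (fun s : ℝ => Real.exp (-(2 * γ) * s))
          (Real.exp (-(2 * γ) * s) * (-(2 * γ))) s := by
        simpa using ((hasDerivAt_id s).const_mul (-(2 * γ))).exp
      exact h2.mul h1
    have hanti : Antitone f := by
      apply antitone_of_deriv_nonpos (fun s => (hf s).differentiableAt)
      intro s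
      rw [(hf s).deriv]
      have := (abs_le.1 (hC (NormedSpace.exp ((s : ℂ) • C) z))).2
      have hp := Real.exp_pos (-(2 * γ) * s)
      have hus : ‖u s‖ = ‖J (NormedSpace.exp ((s : ℂ) • C) z)‖ := rfl
      rw [hus]
      nlinarith
    have h0 := hanti ht
    have hu0 : u 0 = J z := by simp [u]
    simp only [f, mul_zero, Real.exp_zero, one_mul, hu0] at h0
    have h5 : ‖u t‖ ^ 2 ≤ (Real.exp (γ * t) * ‖J z‖) ^ 2 := by
      have e : (Real.exp (γ * t)) ^ 2 * Real.exp (-(2 * γ) * t) = 1 := by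
        rw [← Real.exp_nat_mul, ← Real.exp_add]; simp; ring
      calc ‖u t‖ ^ 2 = (Real.exp (γ * t)) ^ 2 * (Real.exp (-(2 * γ) * t) * ‖u t‖ ^ 2) := by
            rw [← mul_assoc, e, one_mul]
        _ ≤ (Real.exp (γ * t)) ^ 2 * ‖J z‖ ^ 2 := by gcongr
        _ = _ := by ring
    exact (pow_le_pow_iff_left₀ (norm_nonneg _) (by positivity) two_ne_zero).1 h5
  rcases le_total 0 t with ht | ht
  · rw [abs_of_nonneg ht]; exact key B hB t ht
  · rw [abs_of_nonpos ht]
    have := key (-B) (fun z => by simpa using hB z) (-t) (by linarith)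
    simpa using this

/-- First order estimates for the flow of a bounded operator. -/
lemma norm_exp_sub_le {M : ℝ} (B C : X →L[ℂ] X) (hBC : Commute B C)
    {t : ℝ} (hB : ∀ s : ℝ, |s| ≤ |t| → ∀ z, ‖NormedSpace.exp ((s : ℂ) • B) z‖ ≤ M * ‖z‖)
    (hC : ∀ s : ℝ, |s| ≤ |t| → ∀ z, ‖NormedSpace.exp ((s : ℂ) • C) z‖ ≤ M * ‖z‖) (z : X) :
    ‖NormedSpace.exp ((t : ℂ) • B) z - NormedSpace.exp ((t : ℂ) • C) z‖
      ≤ M * M * ‖B z - C z‖ * |t| := by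
  let u : ℝ → X := fun s => NormedSpace.exp ((s : ℂ) • B) (NormedSpace.exp (((t - s : ℝ) : ℂ) • C) z)
  have hu : ∀ s : ℝ, HasDerivAt u (NormedSpace.exp ((s : ℂ) • B)
      (NormedSpace.exp (((t - s : ℝ) : ℂ) • C) (B z - C z))) s := by
    intro s
    have h2 := hasDerivAt_exp_ofReal_smul B s
    have h2' : HasDerivAt (fun r : ℝ => NormedSpace.exp (((t - r : ℝ) : ℂ) • C))
        (-(NormedSpace.exp (((t - s : ℝ) : ℂ) • C) * C)) s := by
      have := HasDerivAt.scomp s (hasDerivAt_exp_ofReal_smul C (t - s))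
        ((hasDerivAt_id s).const_sub t)
      simpa only [Function.comp_def, neg_smul, one_smul, id] using this
    have h3 := ((ContinuousLinearMap.apply ℂ X z).restrictScalars ℝ).hasFDerivAt.comp_hasDerivAt
        s (h2.mul h2')
    refine h3.congr_deriv ?_
    have hc : B * NormedSpace.exp (((t - s : ℝ) : ℂ) • C)
        = NormedSpace.exp (((t - s : ℝ) : ℂ) • C) * B :=
      ((hBC.smul_right _).exp_right).eq
    rw [ContinuousLinearMap.coe_restrictScalars', ContinuousLinearMap.apply_apply, mul_neg,
      ← sub_eq_add_neg, mul_assoc, hc, ← mul_sub, ← mul_sub]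
    rfl
  have h0 : ∀ s ∈ Set.uIcc 0 t, ‖(NormedSpace.exp ((s : ℂ) • B)
      (NormedSpace.exp (((t - s : ℝ) : ℂ) • C) (B z - C z)))‖ ≤ M * M * ‖B z - C z‖ := by
    intro s hs
    have hs1 : |s| ≤ |t| := by
      rcases le_total 0 t with h | h
      · rw [Set.uIcc_of_le h] at hs; rw [abs_of_nonneg hs.1, abs_of_nonneg h]; exact hs.2
      · rw [Set.uIcc_of_ge h] at hs; rw [abs_of_nonpos hs.2, abs_of_nonpos h]; linarith [hs.1]
    have hs2 : |t - s| ≤ |t| := by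
      rcases le_total 0 t with h | h
      · rw [Set.uIcc_of_le h] at hs
        rw [abs_of_nonneg (by linarith [hs.2]), abs_of_nonneg h]; linarith [hs.1]
      · rw [Set.uIcc_of_ge h] at hs
        rw [abs_of_nonpos (by linarith [hs.1]), abs_of_nonpos h]; linarith [hs.2]
    rcases le_or_gt 0 M with hM | hM
    · calc _ ≤ M * ‖(NormedSpace.exp (((t - s : ℝ) : ℂ) • C) (B z - C z))‖ := hB s hs1 _
        _ ≤ M * (M * ‖B z - C z‖) := by gcongr; exact hC _ hs2 _
        _ = _ := by ring
    · have := hB s hs1 (NormedSpace.exp (((t - s : ℝ) : ℂ) • C) (B z - C z))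
      have h5 := norm_nonneg (NormedSpace.exp (((t - s : ℝ) : ℂ) • C) (B z - C z))
      have h6 : 0 ≤ M * M * ‖B z - C z‖ := mul_nonneg (mul_self_nonneg _) (norm_nonneg _)
      nlinarith [norm_nonneg (NormedSpace.exp ((s : ℂ) • B)
        (NormedSpace.exp (((t - s : ℝ) : ℂ) • C) (B z - C z)))]
  have := (convex_uIcc (0 : ℝ) t).norm_image_sub_le_of_norm_hasDerivWithin_le
    (f := u) (fun s _ => (hu s).hasDerivWithinAt) h0 Set.left_mem_uIcc Set.right_mem_uIcc
  simpa [u] using this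

/-- An energy operator `J` for which the densely defined operator `A` is quasi-skew, and whose real
resolvent set contains all large `λ`. -/
structure QuasiSkew (J : X →L[ℂ] H) (A : X →ₗ.[ℂ] X) (K γ : ℝ) : Prop where
  bound : ∀ z, ‖z‖ ≤ K * ‖J z‖
  nonneg : 0 ≤ γ
  dense : Dense (A.domain : Set X)
  skew : ∀ d : A.domain, |(⟪J d, J (A d)⟫_ℂ).re| ≤ γ * ‖J d‖ ^ 2
  surj : ∀ l : ℝ, γ < |l| → ∀ f, ∃ d : A.domain, (l : ℂ) • (d : X) - A d = f

namespace QuasiSkew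

variable {J : X →L[ℂ] H} {A : X →ₗ.[ℂ] X} {K γ : ℝ}

lemma norm_le (h : QuasiSkew J A K γ) (l : ℝ) (d : A.domain) :
    (|l| - γ) * ‖J d‖ ≤ ‖J ((l : ℂ) • (d : X) - A d)‖ := by
  rcases (norm_nonneg (J d)).eq_or_lt with h0 | h0
  · rw [← h0]; simp
  have h1 : |(⟪J d, J ((l : ℂ) • (d : X) - A d)⟫_ℂ).re| ≤ ‖J d‖ * ‖J ((l : ℂ) • (d : X) - A d)‖ :=
    (Complex.abs_re_le_norm _).trans (norm_inner_le_norm _ _)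
  have h2 : (⟪J d, J ((l : ℂ) • (d : X) - A d)⟫_ℂ).re
      = l * ‖J d‖ ^ 2 - (⟪J d, J (A d)⟫_ℂ).re := by
    rw [map_sub, map_smul, inner_sub_right, inner_smul_right, inner_self_eq_norm_sq_to_K]
    simp only [Complex.coe_algebraMap, Complex.sub_re, Complex.re_ofReal_mul]
    norm_cast
  have h3 := h.skew d
  rw [h2] at h1
  have h4 : |l| * ‖J d‖ ^ 2 - γ * ‖J d‖ ^ 2 ≤ ‖J d‖ * ‖J ((l : ℂ) • (d : X) - A d)‖ := by
    have := abs_sub_abs_le_abs_sub (l * ‖J d‖ ^ 2) (⟪J d, J (A d)⟫_ℂ).re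
    rw [abs_mul, abs_of_nonneg (sq_nonneg ‖J d‖)] at this
    linarith
  nlinarith

lemma eq_of_resolvent (h : QuasiSkew J A K γ) {l : ℝ} (hl : γ < |l|) {d e : A.domain}
    (hde : (l : ℂ) • (d : X) - A d = (l : ℂ) • (e : X) - A e) : d = e := by
  have h1 := h.norm_le l (d - e)
  have h2 : (l : ℂ) • ((d - e : A.domain) : X) - A (d - e) = 0 := by
    rw [LinearPMap.map_sub, Submodule.coe_sub, smul_sub, sub_sub_sub_comm, hde, sub_self]
  rw [h2, map_zero, norm_zero] at h1
  have h3 : ‖J ((d - e : A.domain) : X)‖ = 0 := by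
    nlinarith [norm_nonneg (J ((d - e : A.domain) : X))]
  have h4 := h.bound ((d - e : A.domain) : X)
  rw [h3, mul_zero, norm_le_zero_iff] at h4
  exact sub_eq_zero.1 (Subtype.ext h4)

lemma exists_resolvent (h : QuasiSkew J A K γ) :
    ∃ R : ℝ → X →L[ℂ] X, ∀ l : ℝ, γ < |l| → ∀ f, ∃ d : A.domain, R l f = d ∧
      (l : ℂ) • (d : X) - A d = f := by
  have key : ∀ l : ℝ, ∃ R : X →L[ℂ] X, γ < |l| → ∀ f, ∃ d : A.domain, R f = d ∧
      (l : ℂ) • (d : X) - A d = f := by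
    intro l
    by_cases hl : γ < |l|
    · choose r hr using h.surj l hl
      let R0 : X →ₗ[ℂ] X :=
        { toFun := fun f => r f
          map_add' := by
            intro f g
            have : r (f + g) = r f + r g := h.eq_of_resolvent hl (by
              rw [hr, LinearPMap.map_add, Submodule.coe_add, smul_add, add_sub_add_comm, hr, hr])
            rw [this, Submodule.coe_add]
          map_smul' := by
            intro c f
            have : r (c • f) = c • r f := h.eq_of_resolvent hl (by
              rw [hr, LinearPMap.map_smul, Submodule.coe_smul, smul_comm, ← smul_sub, hr])
            rw [this]; rfl }
      have hpos : 0 < |l| - γ := by linarith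
      refine ⟨R0.mkContinuous (|K| * ((|l| - γ)⁻¹ * ‖J‖)) fun f => ?_, fun _ f => ⟨r f, rfl, hr f⟩⟩
      have h1 := h.norm_le l (r f)
      rw [hr] at h1
      calc ‖R0 f‖ ≤ K * ‖J (r f)‖ := h.bound _
        _ ≤ |K| * ((|l| - γ)⁻¹ * (‖J‖ * ‖f‖)) := by
          refine mul_le_mul (le_abs_self K) ?_ (norm_nonneg _) (abs_nonneg _)
          rw [← div_eq_inv_mul, le_div_iff₀ hpos, mul_comm]
          exact h1.trans (J.le_opNorm f)
        _ = _ := by ring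
    · exact ⟨0, fun h => absurd h hl⟩
  choose R hR using key
  exact ⟨R, hR⟩

end QuasiSkew

end Generation

section Generation

set_option linter.unusedSectionVars false

open scoped InnerProductSpace

variable {X H : Type*} [NormedAddCommGroup X] [NormedSpace ℂ X] [CompleteSpace X]
  [NormedAddCommGroup H] [InnerProductSpace ℂ H]

lemma tendsto_of_dense {D : Set X} (hD : Dense D) {T : ℕ → X →L[ℂ] X} {S : X →L[ℂ] X} {M : ℝ}
    (hT : ∀ n z, ‖T n z‖ ≤ M * ‖z‖) (hTS : ∀ z ∈ D, Tendsto (fun n => T n z) atTop (𝓝 (S z)))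
    (z : X) : Tendsto (fun n => T n z) atTop (𝓝 (S z)) := by
  rw [Metric.tendsto_atTop]
  intro ε hε
  have hM : 0 < |M| + ‖S‖ + 1 := by positivity
  obtain ⟨y, hy, hzy⟩ := Metric.dense_iff.1 hD z (ε / 2 / (|M| + ‖S‖ + 1)) (by positivity)
  obtain ⟨N, hN⟩ := Metric.tendsto_atTop.1 (hTS y hzy) (ε / 2) (by positivity)
  refine ⟨N, fun n hn => ?_⟩
  have h1 := hN n hn
  rw [dist_eq_norm] at h1 ⊢
  have h2 : ‖z - y‖ < ε / 2 / (|M| + ‖S‖ + 1) := by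
    rwa [Metric.mem_ball, dist_comm, dist_eq_norm] at hy
  rw [lt_div_iff₀ hM] at h2
  have h3 : ‖T n (z - y)‖ ≤ |M| * ‖z - y‖ :=
    (hT n _).trans (mul_le_mul_of_nonneg_right (le_abs_self M) (norm_nonneg _))
  have h4 := S.le_opNorm (z - y)
  have h5 : T n z - S z = (T n (z - y) - S (z - y)) + (T n y - S y) := by simp; abel
  calc ‖T n z - S z‖ ≤ ‖T n (z - y)‖ + ‖S (z - y)‖ + ‖T n y - S y‖ := by
        rw [h5]; exact (norm_add_le _ _).trans (add_le_add_left (norm_sub_le _ _) _)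
    _ < ε := by nlinarith [norm_nonneg (z - y)]

lemma cauchySeq_of_dense {D : Set X} (hD : Dense D) {T : ℕ → X →L[ℂ] X} {M : ℝ}
    (hT : ∀ n z, ‖T n z‖ ≤ M * ‖z‖) (hTS : ∀ z ∈ D, CauchySeq (fun n => T n z))
    (z : X) : CauchySeq (fun n => T n z) := by
  rw [Metric.cauchySeq_iff]
  intro ε hε
  have hM : 0 < 2 * |M| + 1 := by positivity
  obtain ⟨y, hy, hzy⟩ := Metric.dense_iff.1 hD z (ε / 2 / (2 * |M| + 1)) (by positivity)
  obtain ⟨N, hN⟩ := Metric.cauchySeq_iff.1 (hTS y hzy) (ε / 2) (by positivity)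
  refine ⟨N, fun n hn m hm => ?_⟩
  have h1 := hN n hn m hm
  rw [dist_eq_norm] at h1 ⊢
  have h2 : ‖z - y‖ < ε / 2 / (2 * |M| + 1) := by
    rwa [Metric.mem_ball, dist_comm, dist_eq_norm] at hy
  rw [lt_div_iff₀ hM] at h2
  have h3 : ∀ n, ‖T n (z - y)‖ ≤ |M| * ‖z - y‖ := fun n =>
    (hT n _).trans (mul_le_mul_of_nonneg_right (le_abs_self M) (norm_nonneg _))
  have h5 : T n z - T m z = (T n (z - y) - T m (z - y)) + (T n y - T m y) := by simp; abel
  calc ‖T n z - T m z‖ ≤ ‖T n (z - y)‖ + ‖T m (z - y)‖ + ‖T n y - T m y‖ := by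
        rw [h5]; exact (norm_add_le _ _).trans (add_le_add_left (norm_sub_le _ _) _)
    _ < ε := by nlinarith [norm_nonneg (z - y), h3 n, h3 m]

/-- `R` is the family of the real resolvents of `A`. -/
def IsResolvent (A : X →ₗ.[ℂ] X) (γ : ℝ) (R : ℝ → X →L[ℂ] X) : Prop :=
  ∀ l : ℝ, γ < |l| → ∀ f, ∃ d : A.domain, R l f = d ∧ (l : ℂ) • (d : X) - A d = f

/-- The bounded approximation `l² A (l - A)⁻¹ (l + A)⁻¹` of `A`. -/
def approx (R : ℝ → X →L[ℂ] X) (l : ℝ) : X →L[ℂ] X := ((l : ℂ) ^ 2 / 2) • (R l + R (-l))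

namespace QuasiSkew

variable {J : X →L[ℂ] H} {A : X →ₗ.[ℂ] X} {K γ : ℝ} {R : ℝ → X →L[ℂ] X}

lemma resolvent_apply (h : QuasiSkew J A K γ) (hR : IsResolvent A γ R) {l : ℝ} (hl : γ < |l|)
    (d : A.domain) : R l ((l : ℂ) • (d : X) - A d) = d := by
  obtain ⟨e, he, he'⟩ := hR l hl ((l : ℂ) • (d : X) - A d)
  rw [he, h.eq_of_resolvent hl he']

lemma norm_resolvent_le (h : QuasiSkew J A K γ) (hR : IsResolvent A γ R) {l : ℝ} (hl : γ < |l|)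
    (f : X) : (|l| - γ) * ‖J (R l f)‖ ≤ ‖J f‖ := by
  obtain ⟨e, he, he'⟩ := hR l hl f
  rw [he, ← he']
  exact h.norm_le l e

lemma commute_resolvent (h : QuasiSkew J A K γ) (hR : IsResolvent A γ R) {l m : ℝ} (hl : γ < |l|)
    (hm : γ < |m|) : Commute (R l) (R m) := by
  rcases eq_or_ne l m with rfl | hlm
  · exact Commute.refl _
  have key : ∀ {l m : ℝ}, γ < |l| → γ < |m| → ∀ f,
      R m f - R l f = ((l : ℂ) - m) • R l (R m f) := by
    intro l m hl hm f
    obtain ⟨d, hd, hd'⟩ := hR m hm f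
    have h1 := h.resolvent_apply hR hl d
    have h2 : (l : ℂ) • (d : X) - A d = ((l : ℂ) - m) • (d : X) + f := by
      rw [← hd', sub_smul]; abel
    rw [h2, map_add, map_smul] at h1
    rw [hd]
    exact sub_eq_of_eq_add h1.symm
  have hne : (l : ℂ) - m ≠ 0 := sub_ne_zero.2 (by exact_mod_cast hlm)
  ext f
  have h1 := key hl hm f
  have h2 := key hm hl f
  have h3 : ((l : ℂ) - m) • R l (R m f) = ((l : ℂ) - m) • R m (R l f) := by
    rw [← h1, ← neg_sub (m : ℂ) l, neg_smul, ← h2, neg_sub]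
  exact smul_right_injective X hne h3

lemma commute_approx (h : QuasiSkew J A K γ) (hR : IsResolvent A γ R) {l m : ℝ} (hl : γ < |l|)
    (hm : γ < |m|) : Commute (approx R l) (approx R m) := by
  have hl' : γ < |-l| := by rwa [abs_neg]
  have hm' : γ < |-m| := by rwa [abs_neg]
  exact (((h.commute_resolvent hR hl hm).add_left (h.commute_resolvent hR hl' hm)).add_right
    ((h.commute_resolvent hR hl hm').add_left (h.commute_resolvent hR hl' hm'))).smul_left _
    |>.smul_right _

lemma approx_skew (h : QuasiSkew J A K γ) (hR : IsResolvent A γ R) {l : ℝ} (hl : 2 * γ + 1 ≤ l)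
    (z : X) : |(⟪J z, J (approx R l z)⟫_ℂ).re| ≤ 52 * γ * ‖J z‖ ^ 2 := by
  have hγ := h.nonneg
  have hl0 : 0 < l := by linarith
  have hl1 : γ < |l| := by rw [abs_of_pos hl0]; linarith
  have hl2 : γ < |-l| := by rwa [abs_neg]
  obtain ⟨e, he, he'⟩ := hR (-l) hl2 z
  let y : A.domain := -e
  obtain ⟨d, hd, hd'⟩ := hR l hl1 y
  let a : A.domain := (l : ℂ) • d - y
  have ha : (a : X) = A d := by
    simp only [a, Submodule.coe_sub, Submodule.coe_smul, ← hd']; abel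
  have hz : z = (l : ℂ) • (y : X) + A y := by
    rw [← he']; simp [y, LinearPMap.map_neg, sub_eq_add_neg]
  have hAa : A a = (l : ℂ) • A d - A y := by
    simp only [a]; rw [LinearPMap.map_sub, LinearPMap.map_smul]
  have hz2 : z = ((l : ℂ) ^ 2) • (d : X) - A a := by
    rw [hz, hAa, ← hd', smul_sub, smul_smul, pow_two]; abel
  have hRl : R l z = ((2 * l : ℂ)) • (d : X) - y := by
    have h1 := h.resolvent_apply hR hl1 ((2 * l : ℂ) • d - y)
    have h2 : (l : ℂ) • (((2 * l : ℂ) • d - y : A.domain) : X) - A ((2 * l : ℂ) • d - y) = z := by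
      rw [LinearPMap.map_sub, LinearPMap.map_smul, hz, Submodule.coe_sub, Submodule.coe_smul,
        ← hd']
      module
    rw [h2] at h1
    rw [h1, Submodule.coe_sub, Submodule.coe_smul]
  have happ : approx R l z = ((l : ℂ) ^ 2) • (a : X) := by
    have : R (-l) z = -(y : X) := by rw [he]; simp [y]
    simp only [approx, _root_.smul_apply, _root_.add_apply, hRl, this, a,
      Submodule.coe_sub, Submodule.coe_smul]
    module
  have hy : l * ‖J y‖ ≤ 2 * ‖J z‖ := by
    have h1 := h.norm_le (-l) e
    rw [he', abs_neg, abs_of_pos hl0] at h1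
    have : ‖J y‖ = ‖J e‖ := by simp [y]
    rw [this]; nlinarith [norm_nonneg (J e)]
  have hd2 : l * ‖J d‖ ≤ 2 * ‖J y‖ := by
    have h1 := h.norm_le l d
    rw [hd', abs_of_pos hl0] at h1
    nlinarith [norm_nonneg (J d)]
  have hd3 : l ^ 2 * ‖J d‖ ≤ 4 * ‖J z‖ := by nlinarith
  have ha2 : l * ‖J a‖ ≤ 6 * ‖J z‖ := by
    have : ‖J a‖ ≤ l * ‖J d‖ + ‖J y‖ := by
      simp only [a, Submodule.coe_sub, Submodule.coe_smul, map_sub, map_smul]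
      refine (norm_sub_le _ _).trans ?_
      rw [norm_smul, Complex.norm_real, Real.norm_eq_abs, abs_of_pos hl0]
    nlinarith
  have hin : (⟪J z, J (approx R l z)⟫_ℂ).re
      = l ^ 4 * (⟪J d, J (A d)⟫_ℂ).re - l ^ 2 * (⟪J a, J (A a)⟫_ℂ).re := by
    have e1 : (⟪J a, J (A a)⟫_ℂ).re = (⟪J (A a), J a⟫_ℂ).re := inner_re_symm (𝕜 := ℂ) _ _
    rw [happ, e1]
    nth_rewrite 1 [hz2]
    rw [map_sub, map_smul, map_smul, inner_sub_left, inner_smul_left, inner_smul_right,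
      inner_smul_right, ← ha]
    have e2 : (starRingEnd ℂ) ((l : ℂ) ^ 2) = ((l ^ 2 : ℝ) : ℂ) := by simp
    have e3 : ((l : ℂ) ^ 2) = ((l ^ 2 : ℝ) : ℂ) := by simp
    rw [e2, e3, Complex.sub_re, Complex.re_ofReal_mul, Complex.re_ofReal_mul,
      Complex.re_ofReal_mul]
    ring
  have hs1 := h.skew d
  have hs2 := h.skew a
  rw [hin]
  calc _ ≤ l ^ 4 * |(⟪J d, J (A d)⟫_ℂ).re| + l ^ 2 * |(⟪J a, J (A a)⟫_ℂ).re| := by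
        refine (abs_sub _ _).trans ?_
        rw [abs_mul (l ^ 4), abs_mul (l ^ 2), abs_of_pos (show 0 < l ^ 4 by positivity),
          abs_of_pos (show 0 < l ^ 2 by positivity)]
    _ ≤ l ^ 4 * (γ * ‖J d‖ ^ 2) + l ^ 2 * (γ * ‖J a‖ ^ 2) := by gcongr
    _ = γ * ((l ^ 2 * ‖J d‖) ^ 2 + (l * ‖J a‖) ^ 2) := by ring
    _ ≤ γ * ((4 * ‖J z‖) ^ 2 + (6 * ‖J z‖) ^ 2) := by gcongr
    _ = _ := by ring

lemma tendsto_resolvent (h : QuasiSkew J A K γ) (hR : IsResolvent A γ R) {l : ℕ → ℝ}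
    (hl : ∀ n, 2 * γ + 1 ≤ |l n|) (hl' : Tendsto (fun n => |l n|) atTop atTop) (z : X) :
    Tendsto (fun n => (l n : ℂ) • R (l n) z) atTop (𝓝 z) := by
  have hγ := h.nonneg
  have hlt : ∀ n, γ < |l n| := fun n => by linarith [hl n]
  have hb : ∀ n z, |l n| * ‖R (l n) z‖ ≤ |K| * (2 * (‖J‖ * ‖z‖)) := by
    intro n z
    have h1 := h.norm_resolvent_le hR (hlt n) z
    have h2 := h.bound (R (l n) z)
    have h3 := J.le_opNorm z
    have h4 : |l n| * ‖J (R (l n) z)‖ ≤ 2 * ‖J z‖ := by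
      nlinarith [norm_nonneg (J (R (l n) z)), hl n]
    have h5 : ‖R (l n) z‖ ≤ |K| * ‖J (R (l n) z)‖ :=
      h2.trans (mul_le_mul_of_nonneg_right (le_abs_self K) (norm_nonneg _))
    calc |l n| * ‖R (l n) z‖ ≤ |l n| * (|K| * ‖J (R (l n) z)‖) := by gcongr
      _ = |K| * (|l n| * ‖J (R (l n) z)‖) := by ring
      _ ≤ |K| * (2 * ‖J z‖) := by gcongr
      _ ≤ _ := by gcongr
  refine tendsto_of_dense (T := fun n => (l n : ℂ) • R (l n)) (S := ContinuousLinearMap.id ℂ X)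
    (M := |K| * (2 * ‖J‖)) h.dense ?_ ?_ z
  · intro n z
    rw [_root_.smul_apply, norm_smul, Complex.norm_real, Real.norm_eq_abs]
    exact (hb n z).trans_eq (by ring)
  · intro z hz
    have h1 : ∀ n, (l n : ℂ) • R (l n) z = z + R (l n) (A ⟨z, hz⟩) := by
      intro n
      have := h.resolvent_apply hR (hlt n) ⟨z, hz⟩
      rw [map_sub, map_smul] at this
      rw [← sub_eq_iff_eq_add]; exact this
    have h2 : Tendsto (fun n => R (l n) (A ⟨z, hz⟩)) atTop (𝓝 0) := by
      refine squeeze_zero_norm (a := fun n => |K| * (2 * (‖J‖ * ‖A ⟨z, hz⟩‖)) / |l n|) ?_ ?_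
      · intro n
        rw [le_div_iff₀ (by linarith [hl n]), mul_comm]
        exact hb n _
      · exact tendsto_const_nhds.div_atTop hl'
    have h3 := h2.const_add z
    simp only [add_zero] at h3
    exact h3.congr fun n => by simpa using (h1 n).symm

lemma tendsto_approx (h : QuasiSkew J A K γ) (hR : IsResolvent A γ R) {l : ℕ → ℝ}
    (hl : ∀ n, 2 * γ + 1 ≤ l n) (hl' : Tendsto l atTop atTop) (d : A.domain) :
    Tendsto (fun n => approx R (l n) d) atTop (𝓝 (A d)) := by
  have hγ := h.nonneg
  have hpos : ∀ n, 0 < l n := fun n => by linarith [hl n]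
  have habs : ∀ n, |l n| = l n := fun n => abs_of_pos (hpos n)
  have hlt : ∀ n, γ < |l n| := fun n => by rw [habs]; linarith [hl n]
  have h1 := h.tendsto_resolvent hR (l := l) (fun n => by rw [habs]; exact hl n)
    (by simpa only [habs] using hl') (A d)
  have h2 := h.tendsto_resolvent hR (l := fun n => -l n) (fun n => by rw [abs_neg, habs]; exact hl n)
    (by simpa only [abs_neg, habs] using hl') (A d)
  have h3 := (h1.add h2).const_smul (2⁻¹ : ℂ)
  have e : (2⁻¹ : ℂ) • (A d + A d) = A d := by module
  rw [e] at h3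
  refine h3.congr fun n => ?_
  have e1 := h.resolvent_apply hR (hlt n) d
  have e2 := h.resolvent_apply hR (l := -l n) (by rw [abs_neg]; exact hlt n) d
  rw [map_sub, map_smul] at e1 e2
  simp only [approx, _root_.smul_apply, _root_.add_apply]
  have e3 : R (l n) (A d) = (l n : ℂ) • R (l n) d - d := by
    rw [sub_eq_iff_eq_add.1 e1, add_sub_cancel_left]
  have e4 : R (-l n) (A d) = ((-l n : ℝ) : ℂ) • R (-l n) d - d := by
    rw [sub_eq_iff_eq_add.1 e2, add_sub_cancel_left]
  rw [e3, e4]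
  push_cast
  module

end QuasiSkew

end Generation

section Generation

set_option linter.unusedSectionVars false

open scoped InnerProductSpace

variable {X H : Type*} [NormedAddCommGroup X] [NormedSpace ℂ X] [CompleteSpace X]
  [NormedAddCommGroup H] [InnerProductSpace ℂ H]

namespace QuasiSkew

variable {J : X →L[ℂ] H} {A : X →ₗ.[ℂ] X} {K γ : ℝ} {R : ℝ → X →L[ℂ] X}

lemma exists_limit_group (h : QuasiSkew J A K γ) : ∃ (T : ℝ → X →L[ℂ] X) (B : ℕ → X →L[ℂ] X),
    (∀ (t : ℝ) z, Tendsto (fun n => NormedSpace.exp ((t : ℂ) • B n) z) atTop (𝓝 (T t z))) ∧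
    (∀ n (t : ℝ) z, ‖J (NormedSpace.exp ((t : ℂ) • B n) z)‖ ≤ Real.exp (52 * γ * |t|) * ‖J z‖) ∧
    (∀ d : A.domain, Tendsto (fun n => B n d) atTop (𝓝 (A d))) := by
  have hγ := h.nonneg
  obtain ⟨R, hR'⟩ := h.exists_resolvent
  have hR : IsResolvent A γ R := hR'
  let l : ℕ → ℝ := fun n => n + (2 * γ + 1)
  have hl : ∀ n, 2 * γ + 1 ≤ l n := fun n => by simp [l]
  have hlt : ∀ n, γ < |l n| := fun n => by
    rw [abs_of_pos (by linarith [hl n])]; linarith [hl n]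
  have hl' : Tendsto l atTop atTop := tendsto_atTop_add_const_right _ _ tendsto_natCast_atTop_atTop
  let B : ℕ → X →L[ℂ] X := fun n => approx R (l n)
  have hBJ : ∀ n (t : ℝ) z, ‖J (NormedSpace.exp ((t : ℂ) • B n) z)‖
      ≤ Real.exp (52 * γ * |t|) * ‖J z‖ := fun n t z =>
    norm_exp_le_of_quasiSkew J (B n) (52 * γ) (fun z => h.approx_skew hR (hl n) z) t z
  have hB : ∀ d : A.domain, Tendsto (fun n => B n d) atTop (𝓝 (A d)) := fun d =>
    h.tendsto_approx hR hl hl' d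
  have hbound : ∀ (t : ℝ) (n : ℕ) (s : ℝ), |s| ≤ |t| → ∀ z,
      ‖NormedSpace.exp ((s : ℂ) • B n) z‖ ≤ |K| * (Real.exp (52 * γ * |t|) * ‖J‖) * ‖z‖ := by
    intro t n s hs z
    calc _ ≤ |K| * ‖J (NormedSpace.exp ((s : ℂ) • B n) z)‖ :=
          (h.bound _).trans (mul_le_mul_of_nonneg_right (le_abs_self K) (norm_nonneg _))
      _ ≤ |K| * (Real.exp (52 * γ * |t|) * (‖J‖ * ‖z‖)) := by
          gcongr
          refine (hBJ n s z).trans ?_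
          gcongr
          exact J.le_opNorm z
      _ = _ := by ring
  have hlim : ∀ t : ℝ, ∃ T : X →L[ℂ] X, ∀ z,
      Tendsto (fun n => NormedSpace.exp ((t : ℂ) • B n) z) atTop (𝓝 (T z)) := by
    intro t
    have hc : ∀ z, CauchySeq (fun n => NormedSpace.exp ((t : ℂ) • B n) z) := by
      refine cauchySeq_of_dense h.dense (fun n z => hbound t n t le_rfl z) ?_
      intro z hz
      have hAz := (hB ⟨z, hz⟩).cauchySeq
      rw [Metric.cauchySeq_iff] at hAz ⊢
      intro ε hε
      set M := |K| * (Real.exp (52 * γ * |t|) * ‖J‖) with hM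
      have hMM : 0 < M * M * |t| + 1 := by positivity
      obtain ⟨N, hN⟩ := hAz (ε / (M * M * |t| + 1)) (by positivity)
      refine ⟨N, fun n hn m hm => ?_⟩
      have h1 := hN n hn m hm
      rw [dist_eq_norm] at h1 ⊢
      have h2 := norm_exp_sub_le (M := M) (B n) (B m) (h.commute_approx hR (hlt n) (hlt m))
        (t := t) (hbound t n) (hbound t m) z
      rw [lt_div_iff₀ hMM] at h1
      refine h2.trans_lt ?_
      nlinarith [norm_nonneg (B n z - B m z)]
    choose f hf using fun z => cauchySeq_tendsto_of_complete (hc z)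
    refine ⟨continuousLinearMapOfTendsto (l := atTop)
      (fun n => NormedSpace.exp ((t : ℂ) • B n)) (tendsto_pi_nhds.2 hf), fun z => hf z⟩
  choose T hT using hlim
  exact ⟨T, B, hT, hBJ, hB⟩

/-- The generation theorem for operators which are quasi-skew with respect to an equivalent Hilbert
norm and all of whose large real numbers belong to the resolvent set. -/
theorem generatesC0Group (h : QuasiSkew J A K γ) : GeneratesC0Group A := by
  have hγ := h.nonneg
  obtain ⟨T, B, hT, hBJ, hB⟩ := h.exists_limit_group
  set C : ℝ := |K| * (Real.exp (52 * γ) * ‖J‖) with hC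
  have hC0 : 0 ≤ C := by positivity
  have hbB : ∀ (n : ℕ) (s : ℝ), |s| ≤ 1 → ∀ z, ‖NormedSpace.exp ((s : ℂ) • B n) z‖ ≤ C * ‖z‖ := by
    intro n s hs z
    calc _ ≤ |K| * ‖J (NormedSpace.exp ((s : ℂ) • B n) z)‖ :=
          (h.bound _).trans (mul_le_mul_of_nonneg_right (le_abs_self K) (norm_nonneg _))
      _ ≤ |K| * (Real.exp (52 * γ) * (‖J‖ * ‖z‖)) := by
          gcongr
          refine (hBJ n s z).trans ?_
          refine mul_le_mul (Real.exp_le_exp.2 ?_) (J.le_opNorm z) (norm_nonneg _)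
            (Real.exp_pos _).le
          nlinarith
      _ = _ := by ring
  have hTJ : ∀ t z, ‖J (T t z)‖ ≤ Real.exp (52 * γ * |t|) * ‖J z‖ := fun t z =>
    le_of_tendsto ((J.continuous.tendsto _).comp (hT t z)).norm
      (Eventually.of_forall fun n => hBJ n t z)
  have hbT : ∀ s : ℝ, |s| ≤ 1 → ∀ z, ‖T s z‖ ≤ C * ‖z‖ := fun s hs z =>
    le_of_tendsto (hT s z).norm (Eventually.of_forall fun n => hbB n s hs z)
  have hT0 : T 0 = ContinuousLinearMap.id ℂ X := by
    ext z
    exact tendsto_nhds_unique (hT 0 z) (by simp)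
  have hTadd : ∀ s t : ℝ, T (s + t) = (T s).comp (T t) := by
    intro s t
    ext z
    refine tendsto_nhds_unique (hT (s + t) z) ?_
    have h1 := (hT s (T t z))
    have h2 : Tendsto (fun n => NormedSpace.exp ((s : ℂ) • B n)
        (NormedSpace.exp ((t : ℂ) • B n) z - T t z)) atTop (𝓝 0) := by
      have h3 : Tendsto (fun n => NormedSpace.exp ((t : ℂ) • B n) z - T t z) atTop (𝓝 0) := by
        simpa using (hT t z).sub_const (T t z)
      have h4 : Tendsto (fun n => |K| * (Real.exp (52 * γ * |s|) *
          (‖J‖ * ‖NormedSpace.exp ((t : ℂ) • B n) z - T t z‖))) atTop (𝓝 0) := by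
        simpa using (((h3.norm.const_mul ‖J‖).const_mul (Real.exp (52 * γ * |s|))).const_mul |K|)
      refine squeeze_zero_norm (fun n => ?_) h4
      calc _ ≤ |K| * ‖J (NormedSpace.exp ((s : ℂ) • B n)
              (NormedSpace.exp ((t : ℂ) • B n) z - T t z))‖ :=
            (h.bound _).trans (mul_le_mul_of_nonneg_right (le_abs_self K) (norm_nonneg _))
        _ ≤ _ := by
            gcongr
            refine (hBJ n s _).trans ?_
            gcongr
            exact J.le_opNorm _
    have h3 := h2.add h1
    rw [zero_add] at h3
    refine h3.congr fun n => ?_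
    rw [← map_add, sub_add_cancel]
    have : NormedSpace.exp (((s + t : ℝ) : ℂ) • B n)
        = NormedSpace.exp ((s : ℂ) • B n) * NormedSpace.exp ((t : ℂ) • B n) := by
      have hmem : ∀ x : X →L[ℂ] X, x ∈ Metric.eball (0 : X →L[ℂ] X)
          (NormedSpace.expSeries ℂ (X →L[ℂ] X)).radius := fun x => by
        rw [NormedSpace.expSeries_radius_eq_top]; simp
      rw [← NormedSpace.exp_add_of_commute_of_mem_ball (𝕂 := ℂ)
        (((Commute.refl (B n)).smul_left _).smul_right _) (hmem _) (hmem _), ← add_smul]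
      push_cast; rfl
    rw [this]; rfl
  -- first order estimate
  have hfirst : ∀ (d : A.domain) (t : ℝ), |t| ≤ 1 → ‖T t d - d‖ ≤ C * |t| * ‖A d‖ := by
    intro d t ht
    have key : ∀ n, ‖NormedSpace.exp ((t : ℂ) • B n) (d : X) - d‖ ≤ C * |t| * ‖B n d‖ := by
      intro n
      have h0 : ∀ s ∈ Set.uIcc 0 t, ‖NormedSpace.exp ((s : ℂ) • B n) (B n d)‖ ≤ C * ‖B n d‖ :=
        fun s hs => hbB n s (((by simpa using Set.abs_sub_left_of_mem_uIcc hs : |s| ≤ |t|)).trans ht) _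
      have := (convex_uIcc (0 : ℝ) t).norm_image_sub_le_of_norm_hasDerivWithin_le
        (f := fun s : ℝ => NormedSpace.exp ((s : ℂ) • B n) (d : X))
        (fun s _ => (((ContinuousLinearMap.apply ℂ X (d : X)).restrictScalars
          ℝ).hasFDerivAt.comp_hasDerivAt s (hasDerivAt_exp_ofReal_smul (B n) s)).hasDerivWithinAt)
        h0 Set.left_mem_uIcc Set.right_mem_uIcc
      simp only [Complex.ofReal_zero, zero_smul, NormedSpace.exp_zero, sub_zero,
        Real.norm_eq_abs] at this
      refine this.trans_eq (by ring)
    exact le_of_tendsto_of_tendsto ((hT t d).sub_const _).norm ((hB d).norm.const_mul _)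
      (Eventually.of_forall key)
  have hcont : ∀ z, Tendsto (fun t => T t z) (𝓝 0) (𝓝 z) := by
    intro z
    rw [Metric.tendsto_nhds]
    intro ε hε
    obtain ⟨y, hy, hzy⟩ := Metric.dense_iff.1 h.dense z (ε / 2 / (C + 2)) (by positivity)
    have h2 : ‖z - y‖ < ε / 2 / (C + 2) := by
      rwa [Metric.mem_ball, dist_comm, dist_eq_norm] at hy
    rw [lt_div_iff₀ (by positivity)] at h2
    have h3 : ∀ᶠ t : ℝ in 𝓝 0, C * |t| * ‖A ⟨y, hzy⟩‖ < ε / 2 := by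
      have : Tendsto (fun t : ℝ => C * |t| * ‖A ⟨y, hzy⟩‖) (𝓝 0) (𝓝 (C * |(0:ℝ)| * ‖A ⟨y, hzy⟩‖)) :=
        ((continuous_abs.tendsto 0).const_mul C).mul_const _
      rw [abs_zero, mul_zero, zero_mul] at this
      exact this.eventually (gt_mem_nhds (by positivity))
    have h4 : ∀ᶠ t : ℝ in 𝓝 0, |t| ≤ 1 := by
      have := (continuous_abs (G := ℝ)).tendsto 0
      rw [abs_zero] at this
      exact (this.eventually (gt_mem_nhds one_pos)).mono fun _ h => h.le
    filter_upwards [h3, h4] with t ht1 ht2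
    have h5 := hfirst ⟨y, hzy⟩ t ht2
    have h6 := hbT t ht2 (z - y)
    rw [dist_eq_norm]
    have e : T t z - z = T t (z - y) - (z - y) + (T t y - y) := by rw [map_sub]; abel
    calc ‖T t z - z‖ ≤ ‖T t (z - y)‖ + ‖z - y‖ + ‖T t y - y‖ := by
          rw [e]; exact (norm_add_le _ _).trans (add_le_add_left (norm_sub_le _ _) _)
      _ < ε := by nlinarith [norm_nonneg (z - y)]
  have hderiv : ∀ d : A.domain,
      Tendsto (fun t : ℝ => ((t⁻¹ : ℝ) : ℂ) • (T t d - d)) (𝓝[≠] 0) (𝓝 (A d)) := by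
    intro d
    have key : ∀ (x : A.domain) (t : ℝ), |t| ≤ 1 → ‖T t d - d - (t : ℂ) • A d‖
        ≤ |t| * (C * |t| * ‖A x‖ + (C + 1) * ‖A d - x‖) := by
      intro x t ht
      have kn : ∀ n, ‖NormedSpace.exp ((t : ℂ) • B n) (d : X) - d - (t : ℂ) • B n d‖
          ≤ |t| * (C * |t| * ‖B n x‖ + (C + 1) * ‖B n d - x‖) := by
        intro n
        have hx : ∀ s : ℝ, |s| ≤ 1 → ‖NormedSpace.exp ((s : ℂ) • B n) (x : X) - x‖
            ≤ C * |s| * ‖B n x‖ := by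
          intro s hs
          have h0 : ∀ r ∈ Set.uIcc 0 s, ‖NormedSpace.exp ((r : ℂ) • B n) (B n x)‖ ≤ C * ‖B n x‖ :=
            fun r hr => hbB n r (((by simpa using Set.abs_sub_left_of_mem_uIcc hr :
              |r| ≤ |s|)).trans hs) _
          have := (convex_uIcc (0 : ℝ) s).norm_image_sub_le_of_norm_hasDerivWithin_le
            (f := fun s : ℝ => NormedSpace.exp ((s : ℂ) • B n) (x : X))
            (fun s _ => (((ContinuousLinearMap.apply ℂ X (x : X)).restrictScalars
              ℝ).hasFDerivAt.comp_hasDerivAt s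
                (hasDerivAt_exp_ofReal_smul (B n) s)).hasDerivWithinAt)
            h0 Set.left_mem_uIcc Set.right_mem_uIcc
          simp only [Complex.ofReal_zero, zero_smul, NormedSpace.exp_zero, sub_zero,
            Real.norm_eq_abs] at this
          refine this.trans_eq (by ring)
        have h0 : ∀ s ∈ Set.uIcc 0 t, ‖NormedSpace.exp ((s : ℂ) • B n) (B n d) - B n d‖
            ≤ C * |t| * ‖B n x‖ + (C + 1) * ‖B n d - x‖ := by
          intro s hs
          have hst : |s| ≤ |t| := by simpa using Set.abs_sub_left_of_mem_uIcc hs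
          have e : NormedSpace.exp ((s : ℂ) • B n) (B n d) - B n d
              = (NormedSpace.exp ((s : ℂ) • B n) (B n d - x) - (B n d - x))
                + (NormedSpace.exp ((s : ℂ) • B n) (x : X) - x) := by rw [map_sub]; abel
          have h6 := hbB n s (hst.trans ht) (B n d - x)
          have h7 := hx s (hst.trans ht)
          have h8 : C * |s| * ‖B n x‖ ≤ C * |t| * ‖B n x‖ := by gcongr
          calc _ ≤ ‖NormedSpace.exp ((s : ℂ) • B n) (B n d - x)‖ + ‖B n d - x‖
                + ‖NormedSpace.exp ((s : ℂ) • B n) (x : X) - x‖ := by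
                rw [e]; exact (norm_add_le _ _).trans (add_le_add_left (norm_sub_le _ _) _)
            _ ≤ _ := by linarith
        have := (convex_uIcc (0 : ℝ) t).norm_image_sub_le_of_norm_hasDerivWithin_le
          (f := fun s : ℝ => NormedSpace.exp ((s : ℂ) • B n) (d : X) - (s : ℂ) • B n d)
          (f' := fun s : ℝ => NormedSpace.exp ((s : ℂ) • B n) (B n d) - B n d)
          (fun s _ => by
            have h1 := ((ContinuousLinearMap.apply ℂ X (d : X)).restrictScalars
              ℝ).hasFDerivAt.comp_hasDerivAt s (hasDerivAt_exp_ofReal_smul (B n) s)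
            have h2 : HasDerivAt (fun s : ℝ => (s : ℂ) • B n (d : X)) (B n d) s := by
              simpa using (Complex.ofRealCLM.hasDerivAt (x := s)).smul_const (B n (d : X))
            exact (h1.sub h2).hasDerivWithinAt)
          h0 Set.left_mem_uIcc Set.right_mem_uIcc
        simp only [Complex.ofReal_zero, zero_smul, NormedSpace.exp_zero, sub_zero,
          Real.norm_eq_abs] at this
        rw [sub_right_comm]
        exact this.trans_eq (by ring)
      refine le_of_tendsto_of_tendsto
        (((hT t d).sub_const _).sub ((hB d).const_smul _)).norm
        ((((hB x).norm.const_mul (C * |t|)).add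
          (((hB d).sub_const (x : X)).norm.const_mul (C + 1))).const_mul |t|)
        (Eventually.of_forall kn)
    rw [Metric.tendsto_nhds]
    intro ε hε
    obtain ⟨y, hy, hzy⟩ := Metric.dense_iff.1 h.dense (A d) (ε / 2 / (C + 1)) (by positivity)
    have h2 : ‖A d - y‖ < ε / 2 / (C + 1) := by
      rwa [Metric.mem_ball, dist_comm, dist_eq_norm] at hy
    rw [lt_div_iff₀ (by positivity)] at h2
    have h3 : ∀ᶠ t : ℝ in 𝓝[≠] 0, C * |t| * ‖A ⟨y, hzy⟩‖ < ε / 2 := by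
      have : Tendsto (fun t : ℝ => C * |t| * ‖A ⟨y, hzy⟩‖) (𝓝 0) (𝓝 (C * |(0:ℝ)| * ‖A ⟨y, hzy⟩‖)) :=
        ((continuous_abs.tendsto 0).const_mul C).mul_const _
      rw [abs_zero, mul_zero, zero_mul] at this
      exact (this.eventually (gt_mem_nhds (by positivity))).filter_mono nhdsWithin_le_nhds
    have h4 : ∀ᶠ t : ℝ in 𝓝[≠] 0, |t| ≤ 1 := by
      have := (continuous_abs (G := ℝ)).tendsto 0
      rw [abs_zero] at this
      exact ((this.eventually (gt_mem_nhds one_pos)).mono fun _ h => h.le).filter_mono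
        nhdsWithin_le_nhds
    filter_upwards [h3, h4, self_mem_nhdsWithin] with t ht1 ht2 ht3
    have ht0 : 0 < |t| := abs_pos.2 ht3
    have htc : (t : ℂ) ≠ 0 := by exact_mod_cast ht3
    have h5 := key ⟨y, hzy⟩ t ht2
    rw [dist_eq_norm]
    have e : ((t⁻¹ : ℝ) : ℂ) • (T t d - d) - A d
        = ((t⁻¹ : ℝ) : ℂ) • (T t d - d - (t : ℂ) • A d) := by
      rw [smul_sub _ (T t d - d), smul_smul]
      push_cast
      rw [inv_mul_cancel₀ htc, one_smul]
    rw [e, norm_smul, Complex.norm_real, Real.norm_eq_abs, abs_inv, inv_mul_lt_iff₀ ht0]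
    refine h5.trans_lt (mul_lt_mul_of_pos_left ?_ ht0)
    linarith
  refine ⟨T, ⟨hT0, hTadd, hcont⟩, fun z y => ⟨?_, fun hzy => ?_⟩⟩
  · rw [LinearPMap.mem_graph_iff]
    rintro ⟨d, rfl, rfl⟩
    exact hderiv d
  · -- the difference with the solution of the resolvent equation is an eigenvector
    let l : ℝ := 52 * γ + 1
    have hl : γ < |l| := by rw [abs_of_pos (by positivity)]; linarith
    obtain ⟨d, hd⟩ := h.surj l hl ((l : ℂ) • z - y)
    let u := z - d
    have hu : Tendsto (fun t : ℝ => ((t⁻¹ : ℝ) : ℂ) • (T t u - u)) (𝓝[≠] 0) (𝓝 ((l : ℂ) • u)) := by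
      have h1 := hzy.sub (hderiv d)
      have e : y - A d = (l : ℂ) • u := by
        simp only [u, smul_sub]
        have : y = (l : ℂ) • z - ((l : ℂ) • (d : X) - A d) := by rw [hd]; abel
        rw [this]; abel
      rw [e] at h1
      refine h1.congr fun t => ?_
      simp only [u, map_sub, smul_sub]
      abel
    have hflow : ∀ t : ℝ, HasDerivAt (fun t => T t u) ((l : ℂ) • T t u) t := by
      intro t
      rw [hasDerivAt_iff_tendsto_slope_zero]
      have h1 := ((T t).continuous.tendsto _).comp hu
      rw [map_smul] at h1
      refine h1.congr fun s => ?_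
      simp only [Function.comp_apply, map_smul, map_sub]
      rw [hTadd t s]
      simp only [ContinuousLinearMap.comp_apply]
      rw [← Complex.coe_smul]
    have hconst : ∀ t : ℝ, (Real.exp (-l * t) : ℝ) • T t u = u := by
      have hd' : ∀ t : ℝ, HasDerivAt (fun t : ℝ => (Real.exp (-l * t) : ℝ) • T t u) 0 t := by
        intro t
        have h2 : HasDerivAt (fun s : ℝ => Real.exp (-l * s)) (Real.exp (-l * t) * (-l)) t := by
          simpa using ((hasDerivAt_id t).const_mul (-l)).exp
        refine (h2.smul (hflow t)).congr_deriv ?_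
        rw [Complex.coe_smul, mul_smul, neg_smul, smul_neg, add_neg_cancel]
      intro t
      have := is_const_of_deriv_eq_zero (fun t => (hd' t).differentiableAt)
        (fun t => (hd' t).deriv) t 0
      simpa [hT0] using this
    have hu0 : u = 0 := by
      have h1 : ‖J u‖ ≤ Real.exp (-1) * ‖J u‖ := by
        have h2 := hTJ 1 u
        have h3 : Real.exp (-l) * ‖J (T 1 u)‖ = ‖J u‖ := by
          have := congrArg (fun x => ‖J x‖) (hconst 1)
          rw [← this]
          simp only [mul_one]
          rw [← Complex.coe_smul, map_smul, norm_smul, Complex.norm_real, Real.norm_eq_abs,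
            Real.abs_exp]
        have h4 : Real.exp (-1) = Real.exp (-l) * Real.exp (52 * γ * |1|) := by
          rw [← Real.exp_add]; simp [l]
        rw [h4, mul_assoc]
        nth_rewrite 1 [← h3]
        gcongr
      have h5 : Real.exp (-1) < 1 := Real.exp_lt_one_iff.2 (by norm_num)
      have h6 : ‖J u‖ = 0 := by nlinarith [norm_nonneg (J u)]
      have h7 := h.bound u
      rwa [h6, mul_zero, norm_le_zero_iff] at h7
    have hz : z = d := sub_eq_zero.1 hu0
    rw [LinearPMap.mem_graph_iff]
    refine ⟨d, hz.symm, ?_⟩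
    rw [hz] at hd
    exact sub_right_injective hd

end QuasiSkew

end Generation

open scoped ENNReal InnerProductSpace ComplexConjugate

/-- The complex space `L²(ℝ)`. -/
abbrev L2R : Type := Lp ℂ 2 (volume : Measure ℝ)

section L2

variable {α : Type*} [MeasurableSpace α] {μ : Measure α}

lemma memLp_two_iff_lintegral {f : α → ℂ} :
    MemLp f 2 μ ↔ AEStronglyMeasurable f μ ∧ ∫⁻ x, ‖f x‖ₑ ^ 2 ∂μ < ⊤ := by
  refine and_congr_right fun _ => ?_
  rw [eLpNorm_lt_top_iff_lintegral_rpow_enorm_lt_top two_ne_zero ENNReal.ofNat_ne_top]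
  simp

lemma ofReal_norm_sq_eq_lintegral (f : Lp ℂ 2 μ) :
    ENNReal.ofReal (‖f‖ ^ 2) = ∫⁻ x, ‖f x‖ₑ ^ 2 ∂μ := by
  rw [Lp.norm_def, ← ENNReal.toReal_pow, ENNReal.ofReal_toReal
    (ENNReal.pow_ne_top (Lp.eLpNorm_ne_top f))]
  have := eLpNorm_nnreal_pow_eq_lintegral (f := f) (μ := μ) (p := 2) two_ne_zero
  simpa using this

lemma norm_le_of_lintegral_le {β : Type*} [MeasurableSpace β] {ν : Measure β} {f : Lp ℂ 2 μ}
    {g : Lp ℂ 2 ν} {C : ℝ} (hC : 0 ≤ C)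
    (h : ∫⁻ x, ‖f x‖ₑ ^ 2 ∂μ ≤ ENNReal.ofReal (C ^ 2) * ∫⁻ x, ‖g x‖ₑ ^ 2 ∂ν) :
    ‖f‖ ≤ C * ‖g‖ := by
  rw [← ofReal_norm_sq_eq_lintegral, ← ofReal_norm_sq_eq_lintegral,
    ← ENNReal.ofReal_mul (by positivity), ENNReal.ofReal_le_ofReal_iff (by positivity),
    ← mul_pow] at h
  exact (pow_le_pow_iff_left₀ (norm_nonneg _) (by positivity) two_ne_zero).1 h

lemma inner_eq_integral (f g : Lp ℂ 2 μ) : ⟪f, g⟫_ℂ = ∫ x, conj (f x) * g x ∂μ := by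
  rw [L2.inner_def]
  refine integral_congr_ae (Eventually.of_forall fun x => ?_)
  simp [mul_comm]

lemma integrable_conj_mul (f g : Lp ℂ 2 μ) : Integrable (fun x => conj (f x) * g x) μ := by
  refine (L2.integrable_inner (𝕜 := ℂ) f g).congr (Eventually.of_forall fun x => ?_)
  simp [mul_comm]

/-- Bounded measurable functions. -/
def IsBddMeas (b : α → ℂ) : Prop := Measurable b ∧ ∃ C : ℝ, ∀ x, ‖b x‖ ≤ C

lemma IsBddMeas.memLp_mul {b : α → ℂ} (hb : IsBddMeas b) (f : Lp ℂ 2 μ) :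
    MemLp (fun x => b x * f x) 2 μ := by
  obtain ⟨hm, C, hC⟩ := hb
  refine MemLp.of_le_mul (c := C) (Lp.memLp f) (hm.aestronglyMeasurable.mul
    (Lp.aestronglyMeasurable f)) (Eventually.of_forall fun x => ?_)
  rw [norm_mul]
  gcongr
  exact hC x

lemma IsBddMeas.conj {b : α → ℂ} (hb : IsBddMeas b) : IsBddMeas fun x => conj (b x) :=
  ⟨Complex.continuous_conj.measurable.comp hb.1, hb.2.imp fun C hC x => by simpa using hC x⟩

/-- The multiplication by a bounded measurable function on `L²`. -/
def mulOp (b : α → ℂ) (hb : IsBddMeas b) : Lp ℂ 2 μ →L[ℂ] Lp ℂ 2 μ :=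
  LinearMap.mkContinuousOfExistsBound
    { toFun := fun f => (hb.memLp_mul f).toLp _
      map_add' := by
        intro f g
        apply Lp.ext
        filter_upwards [(hb.memLp_mul (f + g)).coeFn_toLp, (hb.memLp_mul f).coeFn_toLp,
          (hb.memLp_mul g).coeFn_toLp, Lp.coeFn_add f g,
          Lp.coeFn_add ((hb.memLp_mul f).toLp _) ((hb.memLp_mul g).toLp _)] with x h1 h2 h3 h4 h5
        rw [h1, h5, Pi.add_apply, h2, h3, h4, Pi.add_apply, mul_add]
      map_smul' := by
        intro c f
        apply Lp.ext
        filter_upwards [(hb.memLp_mul (c • f)).coeFn_toLp, (hb.memLp_mul f).coeFn_toLp,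
          Lp.coeFn_smul c f, Lp.coeFn_smul c ((hb.memLp_mul f).toLp _)] with x h1 h2 h4 h5
        rw [h1, RingHom.id_apply, h5, Pi.smul_apply, h2, h4, Pi.smul_apply]
        simp only [smul_eq_mul]
        ring }
    (by
      obtain ⟨C, hC⟩ := hb.2
      refine ⟨C, fun f => ?_⟩
      refine Lp.norm_le_mul_norm_of_ae_le_mul ?_
      filter_upwards [(hb.memLp_mul f).coeFn_toLp] with x hx
      change ‖(hb.memLp_mul f).toLp _ x‖ ≤ _
      rw [hx, norm_mul]
      gcongr
      exact hC x)

lemma coeFn_mulOp {b : α → ℂ} (hb : IsBddMeas b) (f : Lp ℂ 2 μ) :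
    mulOp b hb f =ᵐ[μ] fun x => b x * f x := (hb.memLp_mul f).coeFn_toLp

lemma inner_mulOp_left {b : α → ℂ} (hb : IsBddMeas b) (f g : Lp ℂ 2 μ) :
    ⟪mulOp b hb f, g⟫_ℂ = ⟪f, mulOp _ hb.conj g⟫_ℂ := by
  rw [inner_eq_integral, inner_eq_integral]
  refine integral_congr_ae ?_
  filter_upwards [coeFn_mulOp hb f, coeFn_mulOp hb.conj g] with x h1 h2
  rw [h1, h2, map_mul]
  ring

end L2

section Inversion

lemma measurableSet_freeSurface : MeasurableSet freeSurface := isOpen_freeSurface.measurableSet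

lemma ne_zero_of_mem_freeSurface {z : ℝ} (hz : z ∈ freeSurface) : z ≠ 0 := by
  rintro rfl
  simp [freeSurface] at hz
  linarith

lemma abs_inv_lt_one {z : ℝ} (hz : z ∈ freeSurface) : |z⁻¹| < 1 := by
  rw [abs_inv]; exact inv_lt_one_of_one_lt₀ hz

lemma ae_mem_freeSurface : ∀ᵐ z ∂surfaceMeasure, z ∈ freeSurface :=
  ae_restrict_mem measurableSet_freeSurface

lemma inv_image_freeSurface : (fun x : ℝ => x⁻¹) '' freeSurface = {x | x ≠ 0 ∧ |x| < 1} := by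
  ext x
  constructor
  · rintro ⟨z, hz, rfl⟩
    exact ⟨inv_ne_zero (ne_zero_of_mem_freeSurface hz), abs_inv_lt_one hz⟩
  · rintro ⟨h0, h1⟩
    refine ⟨x⁻¹, ?_, inv_inv x⟩
    change 1 < |x⁻¹|
    rw [abs_inv]
    exact (one_lt_inv₀ (abs_pos.2 h0)).2 h1

lemma hasDerivWithinAt_inv_freeSurface (x : ℝ) (hx : x ∈ freeSurface) :
    HasDerivWithinAt (fun x : ℝ => x⁻¹) (-(x ^ 2)⁻¹) freeSurface x :=
  (hasDerivAt_inv (ne_zero_of_mem_freeSurface hx)).hasDerivWithinAt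

lemma volume_eq_add_restrict : (volume : Measure ℝ)
    = surfaceMeasure + volume.restrict ((fun x : ℝ => x⁻¹) '' freeSurface) := by
  have hm : MeasurableSet ((fun x : ℝ => x⁻¹) '' freeSurface) := by
    rw [inv_image_freeSurface]
    exact (isOpen_ne.inter (isOpen_lt continuous_abs continuous_const)).measurableSet
  rw [← Measure.restrict_union _ hm, eq_comm]
  · have : (freeSurface ∪ (fun x : ℝ => x⁻¹) '' freeSurface : Set ℝ) ∈ ae volume := by
      rw [mem_ae_iff]
      refine measure_mono_null (t := {0, 1, -1}) ?_ (Set.Finite.measure_zero (by simp) _)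
      intro x hx
      rw [inv_image_freeSurface] at hx
      simp only [freeSurface, Set.mem_compl_iff, Set.mem_union, Set.mem_ofPred_eq, not_or, not_lt,
        not_and] at hx
      by_cases h0 : x = 0
      · simp [h0]
      · have := eq_or_eq_neg_of_abs_eq (le_antisymm hx.1 (hx.2 h0))
        rcases this with h | h <;> simp [h]
    rw [Measure.restrict_congr_set (eventuallyEq_univ.2 this), Measure.restrict_univ]
  · rw [Set.disjoint_left, inv_image_freeSurface]
    rintro x hx ⟨_, h2⟩
    have : 1 < |x| := hx
    linarith

lemma lintegral_eq_add_inv (F : ℝ → ℝ≥0∞) : ∫⁻ x, F x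
    = (∫⁻ z in freeSurface, F z) + ∫⁻ z in freeSurface, ENNReal.ofReal ((z ^ 2)⁻¹) * F z⁻¹ := by
  conv_lhs => rw [volume_eq_add_restrict]
  rw [lintegral_add_measure, lintegral_image_eq_lintegral_abs_deriv_mul measurableSet_freeSurface
    hasDerivWithinAt_inv_freeSurface inv_injective.injOn]
  simp only [abs_neg, abs_inv, abs_pow, sq_abs]

lemma integral_eq_add_inv {F : ℝ → ℂ} (hF : Integrable F) : ∫ x, F x
    = (∫ z in freeSurface, F z) + ∫ z in freeSurface, (((z ^ 2)⁻¹ : ℝ) : ℂ) * F z⁻¹ := by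
  conv_lhs => rw [volume_eq_add_restrict]
  rw [integral_add_measure hF.restrict hF.restrict,
    integral_image_eq_integral_abs_deriv_smul measurableSet_freeSurface
    hasDerivWithinAt_inv_freeSurface inv_injective.injOn]
  simp only [abs_neg, abs_inv, abs_pow, sq_abs, Complex.real_smul]

lemma quasiMeasurePreserving_inv :
    Measure.QuasiMeasurePreserving (fun x : ℝ => x⁻¹) volume volume := by
  refine ⟨measurable_inv, Measure.AbsolutelyContinuous.mk fun s hs h0 => ?_⟩
  rw [Measure.map_apply measurable_inv hs]
  have h1 : (fun x : ℝ => x⁻¹) ⁻¹' s ⊆ {0} ∪ (fun x : ℝ => x⁻¹) '' (s \ {0}) := by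
    intro x hx
    by_cases h : x = 0
    · left; exact h
    · right
      exact ⟨x⁻¹, ⟨hx, by simpa using h⟩, inv_inv x⟩
  refine measure_mono_null h1 (measure_union_null (by simp) ?_)
  refine addHaar_image_eq_zero_of_differentiableOn_of_addHaar_eq_zero volume ?_
    (measure_mono_null Set.sdiff_subset h0)
  intro x hx
  exact (differentiableAt_inv (by simpa using hx.2)).differentiableWithinAt

lemma ae_inv_of_ae {P : ℝ → Prop} (h : ∀ᵐ x, P x) : ∀ᵐ x : ℝ, P x⁻¹ :=
  quasiMeasurePreserving_inv.ae h

lemma ae_of_ae_surface {P : ℝ → Prop} (h1 : ∀ᵐ z ∂surfaceMeasure, P z)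
    (h2 : ∀ᵐ z ∂surfaceMeasure, P z⁻¹) : ∀ᵐ x, P x := by
  have key : ∀ Q : ℝ → Prop, (∀ᵐ z ∂surfaceMeasure, Q z) →
      ∀ᵐ x : ℝ, x ∈ freeSurface → Q x := fun Q hQ =>
    (ae_restrict_iff' measurableSet_freeSurface).1 hQ
  have h0 : ∀ᵐ x : ℝ, x ≠ 0 := by simp [ae_iff]
  have h3 : ∀ᵐ x : ℝ, |x| ≠ 1 := by
    rw [ae_iff]
    refine measure_mono_null (t := {1, -1}) ?_ (Set.Finite.measure_zero (by simp) _)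
    intro x hx
    simp only [ne_eq, not_not, Set.mem_ofPred_eq] at hx
    rcases eq_or_eq_neg_of_abs_eq hx with h | h <;> simp [h]
  filter_upwards [key _ h1, ae_inv_of_ae (key _ h2), h0, h3] with x hx1 hx2 hx0 hx3
  rcases lt_trichotomy |x| 1 with h | h | h
  · have : x⁻¹ ∈ freeSurface := by
      change 1 < |x⁻¹|
      rw [abs_inv]; exact (one_lt_inv₀ (abs_pos.2 hx0)).2 h
    simpa using hx2 this
  · exact absurd h hx3
  · exact hx1 h

lemma ae_surface_of_ae {P : ℝ → Prop} (h : ∀ᵐ x, P x) : ∀ᵐ z ∂surfaceMeasure, P z :=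
  ae_restrict_of_ae h

lemma inversionExtension_of_mem {v : ℝ → ℂ} {z : ℝ} (hz : z ∈ freeSurface) :
    inversionExtension v z = v z := if_pos hz

lemma inversionExtension_inv {v : ℝ → ℂ} {z : ℝ} (hz : z ∈ freeSurface) :
    inversionExtension v z⁻¹ = v z := by
  rw [inversionExtension, if_neg (abs_inv_lt_one hz).le.not_gt,
    if_neg (inv_ne_zero (ne_zero_of_mem_freeSurface hz)), inv_inv]

lemma measurable_inversionExtension {v : ℝ → ℂ} (hv : Measurable v) :
    Measurable (inversionExtension v) := by
  unfold inversionExtension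
  exact Measurable.ite measurableSet_freeSurface hv
    (Measurable.ite (measurableSet_singleton 0) measurable_const (hv.comp measurable_inv))

/-- Coefficients `c` for which `v ↦ c η(v)` is bounded from `L²(ℰ)` to `L²(ℝ)`. -/
def IsCoeff (c : ℝ → ℂ) : Prop :=
  Measurable c ∧ ∃ C : ℝ, ∀ z ∈ freeSurface, ‖c z‖ ≤ C ∧ ‖c z⁻¹‖ ≤ C * |z|

lemma lintegral_coeff_le {c : ℝ → ℂ} {C : ℝ}
    (hC : ∀ z ∈ freeSurface, ‖c z‖ ≤ C ∧ ‖c z⁻¹‖ ≤ C * |z|) (v : ℝ → ℂ) (hv : Measurable v) :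
    ∫⁻ x, ‖c x * inversionExtension v x‖ₑ ^ 2
      ≤ ENNReal.ofReal ((2 * |C|) ^ 2) * ∫⁻ z in freeSurface, ‖v z‖ₑ ^ 2 := by
  have e1 : ∀ w : ℂ, ∀ r : ℝ, ‖w‖ ≤ r → ‖w‖ₑ ^ 2 ≤ ENNReal.ofReal (r ^ 2) := by
    intro w r hr
    rw [← ofReal_norm, ← ENNReal.ofReal_pow (norm_nonneg _)]
    gcongr
  rw [lintegral_eq_add_inv]
  have h1 : ∫⁻ z in freeSurface, ‖c z * inversionExtension v z‖ₑ ^ 2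
      ≤ ENNReal.ofReal (C ^ 2) * ∫⁻ z in freeSurface, ‖v z‖ₑ ^ 2 := by
    rw [← lintegral_const_mul _ (by fun_prop)]
    refine setLIntegral_mono' measurableSet_freeSurface fun z hz => ?_
    rw [inversionExtension_of_mem hz, enorm_mul, mul_pow]
    gcongr
    exact e1 _ _ (hC z hz).1
  have h2 : ∫⁻ z in freeSurface, ENNReal.ofReal ((z ^ 2)⁻¹) *
        ‖c z⁻¹ * inversionExtension v z⁻¹‖ₑ ^ 2
      ≤ ENNReal.ofReal (C ^ 2) * ∫⁻ z in freeSurface, ‖v z‖ₑ ^ 2 := by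
    rw [← lintegral_const_mul _ (by fun_prop)]
    refine setLIntegral_mono' measurableSet_freeSurface fun z hz => ?_
    rw [inversionExtension_inv hz, enorm_mul, mul_pow, ← mul_assoc]
    gcongr
    have hz0 := ne_zero_of_mem_freeSurface hz
    calc _ ≤ ENNReal.ofReal ((z ^ 2)⁻¹) * ENNReal.ofReal ((C * |z|) ^ 2) := by
          gcongr; exact e1 _ _ (hC z hz).2
      _ = ENNReal.ofReal (C ^ 2) := by
          rw [← ENNReal.ofReal_mul (by positivity), mul_pow, sq_abs]
          congr 1; field_simp
  refine (add_le_add h1 h2).trans ?_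
  rw [← add_mul, ← ENNReal.ofReal_add (by positivity) (by positivity)]
  gcongr
  rw [mul_pow, sq_abs]
  nlinarith [sq_nonneg C]

lemma IsCoeff.memLp {c : ℝ → ℂ} (hc : IsCoeff c) (v : L2E) :
    MemLp (fun x => c x * inversionExtension v x) 2 volume := by
  obtain ⟨hm, C, hC⟩ := hc
  have hv := (Lp.stronglyMeasurable v).measurable
  refine memLp_two_iff_lintegral.2 ⟨(hm.mul
    (measurable_inversionExtension hv)).aestronglyMeasurable, ?_⟩
  refine (lintegral_coeff_le hC v hv).trans_lt (ENNReal.mul_lt_top ENNReal.ofReal_lt_top ?_)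
  rw [← ofReal_norm_sq_eq_lintegral]
  exact ENNReal.ofReal_lt_top

lemma inversionExtension_congr {v w : ℝ → ℂ} (h : v =ᵐ[surfaceMeasure] w) :
    inversionExtension v =ᵐ[volume] inversionExtension w := by
  refine ae_of_ae_surface ?_ ?_
  · filter_upwards [h, ae_mem_freeSurface] with z h1 h2
    rw [inversionExtension_of_mem h2, inversionExtension_of_mem h2, h1]
  · filter_upwards [h, ae_mem_freeSurface] with z h1 h2
    rw [inversionExtension_inv h2, inversionExtension_inv h2, h1]

/-- The operator `v ↦ c η(v)` from `L²(ℰ)` to `L²(ℝ)`. -/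
def extOp (c : ℝ → ℂ) (hc : IsCoeff c) : L2E →L[ℂ] L2R :=
  LinearMap.mkContinuousOfExistsBound
    { toFun := fun v => (hc.memLp v).toLp _
      map_add' := by
        intro f g
        apply Lp.ext
        filter_upwards [(hc.memLp (f + g)).coeFn_toLp, (hc.memLp f).coeFn_toLp,
          (hc.memLp g).coeFn_toLp, inversionExtension_congr (Lp.coeFn_add f g),
          Lp.coeFn_add ((hc.memLp f).toLp _) ((hc.memLp g).toLp _)] with x h1 h2 h3 h4 h5
        rw [h1, h5, Pi.add_apply, h2, h3, h4, ← mul_add]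
        congr 1
        simp only [inversionExtension, Pi.add_apply]
        split_ifs <;> simp
      map_smul' := by
        intro a f
        apply Lp.ext
        filter_upwards [(hc.memLp (a • f)).coeFn_toLp, (hc.memLp f).coeFn_toLp,
          inversionExtension_congr (Lp.coeFn_smul a f),
          Lp.coeFn_smul a ((hc.memLp f).toLp _)] with x h1 h2 h4 h5
        rw [h1, RingHom.id_apply, h5, Pi.smul_apply, h2, h4, smul_eq_mul, mul_left_comm]
        congr 1
        simp only [inversionExtension, Pi.smul_apply, smul_eq_mul]
        split_ifs <;> simp }
    (by
      obtain ⟨C, hC⟩ := hc.2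
      refine ⟨2 * |C|, fun v => norm_le_of_lintegral_le (by positivity) ?_⟩
      refine le_of_eq_of_le (lintegral_congr_ae ?_) (lintegral_coeff_le hC v
        (Lp.stronglyMeasurable v).measurable)
      filter_upwards [(hc.memLp v).coeFn_toLp] with x hx
      change ‖(hc.memLp v).toLp _ x‖ₑ ^ 2 = _
      rw [hx])

lemma coeFn_extOp {c : ℝ → ℂ} (hc : IsCoeff c) (v : L2E) :
    extOp c hc v =ᵐ[volume] fun x => c x * inversionExtension v x := (hc.memLp v).coeFn_toLp

lemma coeFn_extOp_surface {c : ℝ → ℂ} (hc : IsCoeff c) (v : L2E) :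
    extOp c hc v =ᵐ[surfaceMeasure] fun x => c x * v x := by
  filter_upwards [ae_surface_of_ae (coeFn_extOp hc v), ae_mem_freeSurface] with z h1 h2
  rw [h1, inversionExtension_of_mem h2]

lemma ae_surface_inv_of_ae {P : ℝ → Prop} (h : ∀ᵐ x, P x) : ∀ᵐ z ∂surfaceMeasure, P z⁻¹ :=
  ae_surface_of_ae (ae_inv_of_ae h)

lemma coeFn_extOp_inv {c : ℝ → ℂ} (hc : IsCoeff c) (v : L2E) :
    ∀ᵐ z ∂surfaceMeasure, extOp c hc v z⁻¹ = c z⁻¹ * v z := by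
  filter_upwards [ae_surface_inv_of_ae (coeFn_extOp hc v), ae_mem_freeSurface] with z h1 h2
  rw [h1, inversionExtension_inv h2]

lemma isCoeff_one : IsCoeff fun _ => 1 :=
  ⟨measurable_const, 1, fun z hz => ⟨by simp, by simpa using (le_of_lt hz : 1 ≤ |z|)⟩⟩

/-- The extension by inversion as an operator. -/
def etaOp : L2E →L[ℂ] L2R := extOp _ isCoeff_one

lemma coeFn_etaOp (v : L2E) : etaOp v =ᵐ[volume] inversionExtension v := by
  filter_upwards [coeFn_extOp isCoeff_one v] with x hx
  exact hx.trans (one_mul _)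

/-- The restriction to `ℰ`. -/
def restrOp : L2R →L[ℂ] L2E :=
  LinearMap.mkContinuous
    { toFun := fun v => ((Lp.memLp v).restrict freeSurface).toLp _
      map_add' := by
        intro f g
        rw [← MemLp.toLp_add]
        apply MemLp.toLp_congr
        exact ae_surface_of_ae (Lp.coeFn_add f g)
      map_smul' := by
        intro c f
        rw [RingHom.id_apply, ← MemLp.toLp_const_smul]
        apply MemLp.toLp_congr
        exact ae_surface_of_ae (Lp.coeFn_smul c f) } 1
    (fun f => by
      refine norm_le_of_lintegral_le zero_le_one ?_
      rw [one_pow, ENNReal.ofReal_one, one_mul]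
      refine le_of_eq_of_le (lintegral_congr_ae ?_) (setLIntegral_le_lintegral freeSurface _)
      filter_upwards [((Lp.memLp f).restrict freeSurface).coeFn_toLp] with x hx
      change ‖((Lp.memLp f).restrict freeSurface).toLp _ x‖ₑ ^ 2 = _
      rw [hx])

lemma coeFn_restrOp (f : L2R) : restrOp f =ᵐ[surfaceMeasure] f :=
  ((Lp.memLp f).restrict freeSurface).coeFn_toLp

end Inversion

open scoped ENNReal InnerProductSpace ComplexConjugate SchwartzMap

section Fourier

/-- The symbol of `|D|`. -/
def dtnSymbol (ξ : ℝ) : ℝ := 2 * Real.pi * |ξ|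

lemma dtnSymbol_nonneg (ξ : ℝ) : 0 ≤ dtnSymbol ξ := by unfold dtnSymbol; positivity

lemma measurable_dtnSymbol : Measurable dtnSymbol := by unfold dtnSymbol; fun_prop

/-- `F = |D| f` for functions in `L²(ℝ)`. -/
def IsDtN (f F : L2R) : Prop :=
  (𝓕 F : L2R) =ᵐ[volume] fun ξ => (dtnSymbol ξ : ℂ) * (𝓕 f : L2R) ξ

lemma fourier_add_coeFn (f g : L2R) :
    (𝓕 (f + g) : L2R) =ᵐ[volume] fun ξ => (𝓕 f : L2R) ξ + (𝓕 g : L2R) ξ := by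
  rw [FourierTransform.fourier_add]; exact Lp.coeFn_add _ _

lemma fourier_smul_coeFn (c : ℂ) (f : L2R) :
    (𝓕 (c • f) : L2R) =ᵐ[volume] fun ξ => c * (𝓕 f : L2R) ξ := by
  rw [FourierTransform.fourier_smul]; exact Lp.coeFn_smul _ _

lemma IsDtN.add {f F g G : L2R} (h1 : IsDtN f F) (h2 : IsDtN g G) : IsDtN (f + g) (F + G) := by
  filter_upwards [h1, h2, fourier_add_coeFn f g, fourier_add_coeFn F G] with ξ h1 h2 h3 h4
  rw [h3, h4, h1, h2, mul_add]

lemma IsDtN.smul {f F : L2R} (c : ℂ) (h1 : IsDtN f F) : IsDtN (c • f) (c • F) := by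
  filter_upwards [h1, fourier_smul_coeFn c f, fourier_smul_coeFn c F] with ξ h1 h3 h4
  rw [h3, h4, h1]; ring

lemma IsDtN.sub {f F g G : L2R} (h1 : IsDtN f F) (h2 : IsDtN g G) : IsDtN (f - g) (F - G) := by
  simpa [sub_eq_add_neg] using h1.add (h2.smul (-1))

lemma fourier_injective_L2R {F G : L2R} (h : (𝓕 F : L2R) = 𝓕 G) : F = G :=
  (Lp.fourierTransformₗᵢ ℝ ℂ).injective h

lemma IsDtN.unique {f F G : L2R} (h1 : IsDtN f F) (h2 : IsDtN f G) : F = G := by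
  apply fourier_injective_L2R
  apply Lp.ext
  filter_upwards [h1, h2] with ξ h1 h2
  rw [h1, h2]

lemma IsDtN.inner_comm {f F g G : L2R} (h1 : IsDtN f F) (h2 : IsDtN g G) :
    ⟪F, g⟫_ℂ = ⟪f, G⟫_ℂ := by
  rw [← Lp.inner_fourier_eq F g, ← Lp.inner_fourier_eq f G, inner_eq_integral, inner_eq_integral]
  refine integral_congr_ae ?_
  filter_upwards [h1, h2] with ξ h1 h2
  rw [h1, h2, map_mul, Complex.conj_ofReal]
  ring

/-- A smooth compactly supported real function as a complex Schwartz function. -/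
def testSchwartz (φ : ℝ → ℝ) (h1 : ContDiff ℝ ∞ φ) (h2 : HasCompactSupport φ) : 𝓢(ℝ, ℂ) :=
  HasCompactSupport.toSchwartzMap (f := fun x => (φ x : ℂ))
    (h2.comp_left (g := Complex.ofReal) Complex.ofReal_zero) (Complex.ofRealCLM.contDiff.comp h1)

@[simp] lemma testSchwartz_apply (φ : ℝ → ℝ) (h1 : ContDiff ℝ ∞ φ) (h2 : HasCompactSupport φ)
    (x : ℝ) : testSchwartz φ h1 h2 x = φ x := rfl

lemma hasTemperateGrowth_ofReal_id : Function.HasTemperateGrowth (fun x : ℝ => (x : ℂ)) :=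
  Complex.ofRealCLM.hasTemperateGrowth

/-- The multiplication of a Schwartz function by the variable. -/
def mulX (φ : 𝓢(ℝ, ℂ)) : 𝓢(ℝ, ℂ) := SchwartzMap.smulLeftCLM ℂ (fun x : ℝ => (x : ℂ)) φ

@[simp] lemma mulX_apply (φ : 𝓢(ℝ, ℂ)) (x : ℝ) : mulX φ x = x * φ x := by
  simp [mulX, SchwartzMap.smulLeftCLM_apply_apply hasTemperateGrowth_ofReal_id]

lemma exists_isDtN_fourierInv_schwartz (ψ : 𝓢(ℝ, ℂ)) : ∃ Φ : L2R,
    IsDtN ((𝓕⁻ ψ : 𝓢(ℝ, ℂ)).toLp 2) Φ ∧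
      (𝓕 Φ : L2R) =ᵐ[volume] fun ξ => (dtnSymbol ξ : ℂ) * ψ ξ := by
  have h1 : MemLp (fun ξ => (dtnSymbol ξ : ℂ) * ψ ξ) 2 (volume : Measure ℝ) := by
    refine MemLp.of_le_mul (c := 2 * Real.pi) ((mulX ψ).memLp 2) ?_ ?_
    · exact ((Complex.measurable_ofReal.comp measurable_dtnSymbol).mul
        ψ.continuous.measurable).aestronglyMeasurable
    · refine Eventually.of_forall fun ξ => le_of_eq ?_
      rw [mulX_apply, norm_mul, norm_mul, Complex.norm_real, Complex.norm_real, dtnSymbol,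
        Real.norm_eq_abs, Real.norm_eq_abs, abs_mul, abs_abs, abs_of_pos (by positivity)]
      ring
  refine ⟨𝓕⁻ (h1.toLp _), ?_, ?_⟩
  · unfold IsDtN
    rw [FourierTransform.fourier_fourierInv_eq, SchwartzMap.toLp_fourier_eq,
      FourierTransform.fourier_fourierInv_eq]
    filter_upwards [h1.coeFn_toLp, ψ.coeFn_toLp 2 volume] with ξ h2 h3
    rw [h2, h3]
  · rw [FourierTransform.fourier_fourierInv_eq]
    exact h1.coeFn_toLp

lemma exists_isDtN_schwartz (φ : 𝓢(ℝ, ℂ)) : ∃ Φ : L2R, IsDtN (φ.toLp 2) Φ := by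
  obtain ⟨Φ, hΦ, -⟩ := exists_isDtN_fourierInv_schwartz (𝓕 φ)
  rw [FourierTransform.fourierInv_fourier_eq] at hΦ
  exact ⟨Φ, hΦ⟩

lemma locallyIntegrable_L2R (f : L2R) : LocallyIntegrable f volume :=
  (Lp.memLp f).locallyIntegrable (by norm_num)

lemma integrable_schwartz_mul (φ : 𝓢(ℝ, ℂ)) (f : L2R) : Integrable (fun x => φ x * f x) :=
  (φ.memLp 2).integrable_mul (p := 2) (q := 2) (Lp.memLp f)

lemma inner_toLp_right (f : L2R) (φ : 𝓢(ℝ, ℂ)) :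
    ⟪f, φ.toLp 2⟫_ℂ = ∫ x, conj (f x) * φ x := by
  rw [inner_eq_integral]
  refine integral_congr_ae ?_
  filter_upwards [φ.coeFn_toLp 2 volume] with x hx
  rw [hx]

/-- The weak characterisation of `|D|`. -/
lemma isDtN_of_inner_schwartz {f F : L2R}
    (h : ∀ (φ : 𝓢(ℝ, ℂ)) (Φ : L2R), IsDtN (φ.toLp 2) Φ → ⟪F, φ.toLp 2⟫_ℂ = ⟪f, Φ⟫_ℂ) :
    IsDtN f F := by
  have hloc : LocallyIntegrable (fun ξ => (dtnSymbol ξ : ℂ) * (𝓕 f : L2R) ξ) volume := by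
    refine (locallyIntegrable_L2R (𝓕 f)).continuous_mul ?_
    unfold dtnSymbol
    fun_prop
  refine ae_eq_of_integral_contDiff_smul_eq (locallyIntegrable_L2R _) hloc ?_
  intro g hg1 hg2
  let ψ := testSchwartz g hg1 hg2
  obtain ⟨Φ, hΦ, hΦ2⟩ := exists_isDtN_fourierInv_schwartz ψ
  have h1 := h _ Φ hΦ
  rw [← Lp.inner_fourier_eq F, ← Lp.inner_fourier_eq f, SchwartzMap.toLp_fourier_eq,
    FourierTransform.fourier_fourierInv_eq, inner_toLp_right, inner_eq_integral] at h1
  have h2 := congrArg conj h1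
  rw [← integral_conj, ← integral_conj] at h2
  calc _ = ∫ x, conj (conj ((𝓕 F : L2R) x) * ψ x) := by
        refine integral_congr_ae (Eventually.of_forall fun x => ?_)
        simp [ψ, mul_comm]
    _ = _ := h2
    _ = _ := by
        refine integral_congr_ae ?_
        filter_upwards [hΦ2] with x hx
        rw [hx]
        simp [ψ]
        ring

/-- The symbol of the Hilbert transform. -/
def signSymbol (ξ : ℝ) : ℂ := if 0 ≤ ξ then 1 else -1

lemma isBddMeas_signSymbol : IsBddMeas signSymbol := by
  refine ⟨Measurable.ite measurableSet_Ici measurable_const measurable_const, 1, fun x => ?_⟩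
  unfold signSymbol
  split_ifs <;> simp

lemma signSymbol_mul_self (ξ : ℝ) : signSymbol ξ * signSymbol ξ = 1 := by
  unfold signSymbol; split_ifs <;> simp

lemma conj_signSymbol (ξ : ℝ) : conj (signSymbol ξ) = signSymbol ξ := by
  unfold signSymbol; split_ifs <;> simp

lemma signSymbol_mul_ofReal (ξ : ℝ) : signSymbol ξ * ξ = (|ξ| : ℝ) := by
  unfold signSymbol
  split_ifs with h
  · rw [abs_of_nonneg h, one_mul]
  · rw [abs_of_neg (not_le.1 h)]; simp

/-- The Fourier multiplier `sgn(D)`. -/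
def signOp : L2R →L[ℂ] L2R :=
  (Lp.fourierTransformₗᵢ ℝ ℂ).symm.toContinuousLinearEquiv.toContinuousLinearMap ∘L
    mulOp signSymbol isBddMeas_signSymbol ∘L
      (Lp.fourierTransformₗᵢ ℝ ℂ).toContinuousLinearEquiv.toContinuousLinearMap

lemma fourier_signOp (f : L2R) :
    (𝓕 (signOp f) : L2R) = mulOp signSymbol isBddMeas_signSymbol (𝓕 f : L2R) :=
  (Lp.fourierTransformₗᵢ ℝ ℂ).apply_symm_apply _

lemma fourier_signOp_coeFn (f : L2R) :
    (𝓕 (signOp f) : L2R) =ᵐ[volume] fun ξ => signSymbol ξ * (𝓕 f : L2R) ξ := by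
  rw [fourier_signOp]; exact coeFn_mulOp _ _

lemma inner_signOp (f g : L2R) : ⟪signOp f, g⟫_ℂ = ⟪f, signOp g⟫_ℂ := by
  rw [← Lp.inner_fourier_eq, ← Lp.inner_fourier_eq f, fourier_signOp, inner_mulOp_left,
    fourier_signOp]
  congr 1
  apply Lp.ext
  filter_upwards [coeFn_mulOp isBddMeas_signSymbol.conj (𝓕 g : L2R),
    coeFn_mulOp isBddMeas_signSymbol (𝓕 g : L2R)] with ξ h1 h2
  rw [h1, h2, conj_signSymbol]

/-- `f'` is the weak derivative of `f` on the real line. -/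
def HasWeakDerivR (f f' : L2R) : Prop :=
  ∀ φ : 𝓢(ℝ, ℂ), ∫ x, deriv φ x * f x = -∫ x, φ x * f' x

lemma integral_fourier_schwartz_mul (φ : 𝓢(ℝ, ℂ)) (f : L2R) :
    ∫ x, (𝓕 φ : 𝓢(ℝ, ℂ)) x * f x = ∫ x, φ x * (𝓕 f : L2R) x := by
  have h := DFunLike.congr_fun (Lp.fourier_toTemperedDistribution_eq f) φ
  simpa [TemperedDistribution.fourier_apply, Lp.toTemperedDistribution_apply] using h

lemma integral_fourierInv_schwartz_mul (φ : 𝓢(ℝ, ℂ)) (f : L2R) :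
    ∫ x, (𝓕⁻ φ : 𝓢(ℝ, ℂ)) x * (𝓕 f : L2R) x = ∫ x, φ x * f x := by
  rw [← integral_fourier_schwartz_mul, FourierTransform.fourier_fourierInv_eq]

lemma deriv_fourier_schwartz (φ : 𝓢(ℝ, ℂ)) (x : ℝ) :
    deriv (𝓕 φ : 𝓢(ℝ, ℂ)) x = -(2 * Real.pi * Complex.I) * (𝓕 (mulX φ) : 𝓢(ℝ, ℂ)) x := by
  have h : Integrable (fun x : ℝ => x • φ x) :=
    (mulX φ).integrable.congr (Eventually.of_forall fun x => by simp)
  have h1 := congrFun (Real.deriv_fourier φ.integrable h) x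
  rw [SchwartzMap.fourier_coe, h1, SchwartzMap.fourier_coe, Real.fourier_eq, Real.fourier_eq,
    ← integral_const_mul]
  refine integral_congr_ae (Eventually.of_forall fun y => ?_)
  simp only [smul_eq_mul, mulX_apply, Circle.smul_def]
  ring

lemma deriv_fourierInv_schwartz (φ : 𝓢(ℝ, ℂ)) (x : ℝ) :
    deriv (𝓕⁻ φ : 𝓢(ℝ, ℂ)) x = (2 * Real.pi * Complex.I) * (𝓕⁻ (mulX φ) : 𝓢(ℝ, ℂ)) x := by
  have e : ∀ ψ : 𝓢(ℝ, ℂ), ∀ y : ℝ, (𝓕⁻ ψ : 𝓢(ℝ, ℂ)) y = (𝓕 ψ : 𝓢(ℝ, ℂ)) (-y) := fun ψ y => by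
    rw [SchwartzMap.fourierInv_coe, SchwartzMap.fourier_coe, Real.fourierInv_eq_fourier_neg]
  have h1 : deriv (𝓕⁻ φ : 𝓢(ℝ, ℂ)) x = deriv (fun y => (𝓕 φ : 𝓢(ℝ, ℂ)) (-y)) x := by
    congr 1
  rw [h1, deriv_comp_neg, deriv_fourier_schwartz, e]
  ring

lemma hasWeakDerivR_iff {f f' : L2R} : HasWeakDerivR f f' ↔
    (𝓕 f' : L2R) =ᵐ[volume] fun ξ => (2 * Real.pi * Complex.I * ξ) * (𝓕 f : L2R) ξ := by
  have key : ∀ χ : 𝓢(ℝ, ℂ), ∫ x, deriv (𝓕 χ : 𝓢(ℝ, ℂ)) x * f x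
      = -∫ x, χ x * ((2 * Real.pi * Complex.I * x) * (𝓕 f : L2R) x) := by
    intro χ
    simp only [deriv_fourier_schwartz, mul_assoc]
    rw [integral_const_mul, integral_fourier_schwartz_mul, neg_mul, ← integral_const_mul]
    congr 1
    refine integral_congr_ae (Eventually.of_forall fun x => ?_)
    simp only [mulX_apply]
    ring
  constructor
  · intro h
    have hloc : LocallyIntegrable
        (fun ξ : ℝ => (2 * Real.pi * Complex.I * ξ) * (𝓕 f : L2R) ξ) volume := by
      refine (locallyIntegrable_L2R (𝓕 f)).continuous_mul ?_
      fun_prop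
    refine ae_eq_of_integral_contDiff_smul_eq (locallyIntegrable_L2R _) hloc ?_
    intro g hg1 hg2
    have h1 := h (𝓕 (testSchwartz g hg1 hg2))
    rw [key, integral_fourier_schwartz_mul, neg_inj] at h1
    simpa using h1.symm
  · intro h φ
    have h1 := key (𝓕⁻ φ)
    rw [FourierTransform.fourier_fourierInv_eq] at h1
    rw [h1, ← integral_fourierInv_schwartz_mul φ f']
    congr 1
    refine integral_congr_ae ?_
    filter_upwards [h] with x hx
    rw [hx]

lemma HasWeakDerivR.isDtN {f f' : L2R} (h : HasWeakDerivR f f') :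
    IsDtN f ((-Complex.I) • signOp f') := by
  filter_upwards [hasWeakDerivR_iff.1 h, fourier_signOp_coeFn f',
    fourier_smul_coeFn (-Complex.I) (signOp f')] with ξ h1 h2 h3
  rw [h3, h2, h1, dtnSymbol]
  have := signSymbol_mul_ofReal ξ
  push_cast
  rw [← this]
  linear_combination (-(2 * Real.pi * ξ * signSymbol ξ * (𝓕 f : L2R) ξ)) * Complex.I_mul_I

lemma IsDtN.hasWeakDerivR {f F : L2R} (h : IsDtN f F) :
    HasWeakDerivR f (Complex.I • signOp F) := by
  rw [hasWeakDerivR_iff]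
  filter_upwards [h, fourier_signOp_coeFn F, fourier_smul_coeFn Complex.I (signOp F)]
    with ξ h1 h2 h3
  rw [h3, h2, h1, dtnSymbol]
  have := signSymbol_mul_ofReal ξ
  push_cast
  rw [← this]
  linear_combination (2 * Real.pi * ξ * Complex.I * (𝓕 f : L2R) ξ) * signSymbol_mul_self ξ

end Fourier

section Commutator

lemma tendsto_cocompact_schwartz (r : 𝓢(ℝ, ℂ)) : Tendsto r (cocompact ℝ) (𝓝 0) :=
  r.toZeroAtInfty.zero_at_infty'

/-- `|ξ|' = sgn ξ` in the sense of distributions. -/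
lemma integral_abs_mul_deriv_schwartz (r : 𝓢(ℝ, ℂ)) :
    ∫ ξ : ℝ, ((|ξ| : ℝ) : ℂ) * deriv r ξ = -∫ ξ : ℝ, signSymbol ξ * r ξ := by
  let s := mulX r
  have hs : ∀ ξ, HasDerivAt s (r ξ + ξ * deriv r ξ) ξ := by
    intro ξ
    have h1 : HasDerivAt (fun x : ℝ => (x : ℂ)) 1 ξ := Complex.ofRealCLM.hasDerivAt
    have h2 := h1.mul (r.hasDerivAt ξ)
    rw [one_mul] at h2
    refine h2.congr_of_eventuallyEq (Eventually.of_forall fun x => ?_)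
    simp [s]
  have hint : Integrable (fun ξ : ℝ => r ξ + ξ * deriv r ξ) := by
    refine r.integrable.add ((mulX (SchwartzMap.derivCLM ℂ ℂ r)).integrable.congr
      (Eventually.of_forall fun x => by simp))
  have hs0 : s 0 = 0 := by simp [s]
  have h1 : ∫ ξ in Set.Ioi (0 : ℝ), (r ξ + ξ * deriv r ξ) = 0 := by
    have := integral_Ioi_of_hasDerivAt_of_tendsto (a := 0) s.continuous.continuousWithinAt
      (fun x _ => hs x) hint.integrableOn
      ((tendsto_cocompact_schwartz s).mono_left atTop_le_cocompact)
    simpa [hs0] using this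
  have h2 : ∫ ξ in Set.Iic (0 : ℝ), (r ξ + ξ * deriv r ξ) = 0 := by
    have := integral_Iic_of_hasDerivAt_of_tendsto (a := 0) s.continuous.continuousWithinAt
      (fun x _ => hs x) hint.integrableOn
      ((tendsto_cocompact_schwartz s).mono_left atBot_le_cocompact)
    simpa [hs0] using this
  have hI : Integrable (fun ξ : ℝ => signSymbol ξ * (r ξ + ξ * deriv r ξ)) := by
    refine hint.mono (isBddMeas_signSymbol.1.aestronglyMeasurable.mul
      hint.aestronglyMeasurable) (Eventually.of_forall fun x => ?_)
    rw [norm_mul]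
    have : ‖signSymbol x‖ = 1 := by unfold signSymbol; split_ifs <;> simp
    rw [this, one_mul]
  have h3 : ∫ ξ : ℝ, signSymbol ξ * (r ξ + ξ * deriv r ξ) = 0 := by
    rw [← integral_add_compl (measurableSet_Iic (a := (0:ℝ))) hI, Set.compl_Iic]
    have e1 : ∫ ξ in Set.Iic (0 : ℝ), signSymbol ξ * (r ξ + ξ * deriv r ξ)
        = -∫ ξ in Set.Iic (0 : ℝ), (r ξ + ξ * deriv r ξ) := by
      rw [← integral_neg]
      refine setIntegral_congr_ae measurableSet_Iic ?_
      have h0 : ∀ᵐ x : ℝ, x ≠ 0 := by simp [ae_iff]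
      filter_upwards [h0] with x hx hx'
      rw [signSymbol, if_neg (not_le.2 (lt_of_le_of_ne hx' hx)), neg_one_mul]
    have e2 : ∫ ξ in Set.Ioi (0 : ℝ), signSymbol ξ * (r ξ + ξ * deriv r ξ)
        = ∫ ξ in Set.Ioi (0 : ℝ), (r ξ + ξ * deriv r ξ) := by
      refine setIntegral_congr_fun measurableSet_Ioi fun x hx => ?_
      simp only [signSymbol, if_pos (show (0 : ℝ) < x from hx).le, one_mul]
    rw [e1, e2, h1, h2]; simp
  have hr : Integrable (fun ξ : ℝ => signSymbol ξ * r ξ) := by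
    refine r.integrable.mono (isBddMeas_signSymbol.1.aestronglyMeasurable.mul
      r.integrable.aestronglyMeasurable) (Eventually.of_forall fun x => ?_)
    rw [norm_mul]
    have : ‖signSymbol x‖ = 1 := by unfold signSymbol; split_ifs <;> simp
    rw [this, one_mul]
  have h4 : ∫ ξ : ℝ, ((|ξ| : ℝ) : ℂ) * deriv r ξ
      = (∫ ξ : ℝ, signSymbol ξ * (r ξ + ξ * deriv r ξ)) - ∫ ξ : ℝ, signSymbol ξ * r ξ := by
    rw [← integral_sub hI hr]
    refine integral_congr_ae (Eventually.of_forall fun ξ => ?_)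
    simp only [← signSymbol_mul_ofReal]
    ring
  rw [h4, h3, zero_sub]

lemma integral_deriv_mul_symbol (p q : 𝓢(ℝ, ℂ)) :
    ∫ ξ : ℝ, deriv p ξ * ((dtnSymbol ξ : ℂ) * q ξ)
      = -(∫ ξ : ℝ, p ξ * ((dtnSymbol ξ : ℂ) * deriv q ξ))
        - 2 * Real.pi * ∫ ξ : ℝ, p ξ * (signSymbol ξ * q ξ) := by
  let r : 𝓢(ℝ, ℂ) := SchwartzMap.smulLeftCLM ℂ p q
  have hr : ∀ x, r x = p x * q x := fun x => by
    simp [r, SchwartzMap.smulLeftCLM_apply_apply p.hasTemperateGrowth]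
  have hr' : ∀ x, deriv r x = deriv p x * q x + p x * deriv q x := fun x => by
    have : (r : ℝ → ℂ) = fun x => p x * q x := funext hr
    rw [this]
    exact ((p.hasDerivAt x).mul (q.hasDerivAt x)).deriv
  have hbase : ∀ a b : 𝓢(ℝ, ℂ), Integrable (fun ξ : ℝ => a ξ * ((dtnSymbol ξ : ℂ) * b ξ)) := by
    intro a b
    let c : 𝓢(ℝ, ℂ) := SchwartzMap.smulLeftCLM ℂ a (mulX b)
    refine (c.integrable.norm.const_mul (2 * Real.pi)).mono' ?_ (Eventually.of_forall fun ξ => ?_)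
    · exact (a.continuous.measurable.mul ((Complex.measurable_ofReal.comp
        measurable_dtnSymbol).mul b.continuous.measurable)).aestronglyMeasurable
    · have : c ξ = a ξ * (ξ * b ξ) := by
        simp [c, SchwartzMap.smulLeftCLM_apply_apply a.hasTemperateGrowth]
      rw [this, norm_mul, norm_mul, norm_mul, norm_mul, Complex.norm_real, Complex.norm_real,
        dtnSymbol, Real.norm_eq_abs, Real.norm_eq_abs, abs_mul, abs_abs,
        abs_of_pos (show 0 < 2 * Real.pi by positivity)]
      exact le_of_eq (by ring)
  have h1 : Integrable (fun ξ : ℝ => deriv p ξ * ((dtnSymbol ξ : ℂ) * q ξ)) :=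
    hbase (SchwartzMap.derivCLM ℂ ℂ p) q
  have h2 : Integrable (fun ξ : ℝ => p ξ * ((dtnSymbol ξ : ℂ) * deriv q ξ)) :=
    hbase p (SchwartzMap.derivCLM ℂ ℂ q)
  have h3 := congrArg (fun z : ℂ => 2 * Real.pi * z) (integral_abs_mul_deriv_schwartz r)
  simp only [mul_neg] at h3
  rw [← integral_const_mul] at h3
  have e1 : ∫ ξ : ℝ, (2 * Real.pi : ℂ) * (((|ξ| : ℝ) : ℂ) * deriv r ξ)
      = (∫ ξ : ℝ, deriv p ξ * ((dtnSymbol ξ : ℂ) * q ξ))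
        + ∫ ξ : ℝ, p ξ * ((dtnSymbol ξ : ℂ) * deriv q ξ) := by
    rw [← integral_add h1 h2]
    refine integral_congr_ae (Eventually.of_forall fun ξ => ?_)
    simp only [hr', dtnSymbol]
    push_cast
    ring
  have e2 : ∫ ξ : ℝ, signSymbol ξ * r ξ = ∫ ξ : ℝ, p ξ * (signSymbol ξ * q ξ) := by
    refine integral_congr_ae (Eventually.of_forall fun ξ => ?_)
    simp only [hr]
    ring
  rw [e1, e2] at h3
  linear_combination h3

/-- The commutator of `|D|` with the variable is `i sgn(D)`, up to sign. -/
lemma mul_isDtN_schwartz {φ : 𝓢(ℝ, ℂ)} {Φ Ψ : L2R} (h1 : IsDtN (φ.toLp 2) Φ)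
    (h2 : IsDtN ((mulX φ).toLp 2) Ψ) : ∀ᵐ x : ℝ,
      (x : ℂ) * Φ x = Ψ x + Complex.I * signOp (φ.toLp 2) x := by
  have hl1 : LocallyIntegrable (fun x : ℝ => (x : ℂ) * Φ x) volume :=
    (locallyIntegrable_L2R Φ).continuous_mul (by fun_prop)
  have hl2 : LocallyIntegrable (fun x : ℝ => Ψ x + Complex.I * signOp (φ.toLp 2) x) volume :=
    (locallyIntegrable_L2R Ψ).add ((locallyIntegrable_L2R _).continuous_mul (by fun_prop))
  refine ae_eq_of_integral_contDiff_smul_eq hl1 hl2 fun g hg1 hg2 => ?_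
  set γ := testSchwartz g hg1 hg2 with hγ
  set p : 𝓢(ℝ, ℂ) := 𝓕⁻ γ
  set q : 𝓢(ℝ, ℂ) := 𝓕 φ
  have hq : (𝓕 (φ.toLp 2) : L2R) =ᵐ[volume] q := by
    rw [SchwartzMap.toLp_fourier_eq]; exact q.coeFn_toLp 2 volume
  have hpi : (2 * Real.pi * Complex.I : ℂ) ≠ 0 := by simp [Real.pi_ne_zero]
  have e1 : ∫ x, g x • ((x : ℂ) * Φ x) = (2 * Real.pi * Complex.I : ℂ)⁻¹ *
      ∫ ξ : ℝ, deriv p ξ * ((dtnSymbol ξ : ℂ) * q ξ) := by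
    calc _ = ∫ x, mulX γ x * Φ x := by
          refine integral_congr_ae (Eventually.of_forall fun x => ?_)
          simp [hγ]; ring
      _ = ∫ x, (𝓕⁻ (mulX γ) : 𝓢(ℝ, ℂ)) x * (𝓕 Φ : L2R) x :=
          (integral_fourierInv_schwartz_mul _ _).symm
      _ = _ := by
          rw [← integral_const_mul]
          refine integral_congr_ae ?_
          filter_upwards [h1, hq] with ξ hξ hξ2
          rw [hξ, hξ2, deriv_fourierInv_schwartz]
          field_simp
  have e2 : ∫ x, γ x * Ψ x = -(2 * Real.pi * Complex.I : ℂ)⁻¹ *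
      ∫ ξ : ℝ, p ξ * ((dtnSymbol ξ : ℂ) * deriv q ξ) := by
    rw [← integral_fourierInv_schwartz_mul, ← integral_const_mul]
    refine integral_congr_ae ?_
    have h3 : (𝓕 ((mulX φ).toLp 2) : L2R) =ᵐ[volume] (𝓕 (mulX φ) : 𝓢(ℝ, ℂ)) := by
      rw [SchwartzMap.toLp_fourier_eq]; exact SchwartzMap.coeFn_toLp _ 2 volume
    filter_upwards [h2, h3] with ξ hξ hξ2
    rw [hξ, hξ2, deriv_fourier_schwartz]
    field_simp
    simp only [p]
    ring
  have e3 : ∫ x, γ x * signOp (φ.toLp 2) x = ∫ ξ : ℝ, p ξ * (signSymbol ξ * q ξ) := by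
    rw [← integral_fourierInv_schwartz_mul]
    refine integral_congr_ae ?_
    filter_upwards [fourier_signOp_coeFn (φ.toLp 2), hq] with ξ hξ hξ2
    rw [hξ, hξ2]
  have e4 : ∫ x, g x • (Ψ x + Complex.I * signOp (φ.toLp 2) x)
      = (∫ x, γ x * Ψ x) + Complex.I * ∫ x, γ x * signOp (φ.toLp 2) x := by
    rw [← integral_const_mul, ← integral_add (integrable_schwartz_mul γ Ψ)
      ((integrable_schwartz_mul γ _).const_mul _)]
    refine integral_congr_ae (Eventually.of_forall fun x => ?_)
    simp [hγ]; ring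
  have hi : (2 * Real.pi * Complex.I : ℂ)⁻¹ * (2 * Real.pi) = -Complex.I := by
    rw [inv_mul_eq_iff_eq_mul₀ hpi]
    linear_combination (2 * Real.pi : ℂ) * Complex.I_mul_I
  rw [e1, e4, e2, e3, integral_deriv_mul_symbol]
  linear_combination (-∫ ξ : ℝ, p ξ * (signSymbol ξ * q ξ)) * hi

/-- The coefficient `1 / (x + i)`. -/
def resCoeff (x : ℝ) : ℂ := ((x : ℂ) + Complex.I)⁻¹

/-- The cut-off `x / (x + i)`. -/
def cutCoeff (x : ℝ) : ℂ := x * resCoeff x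

lemma add_I_ne_zero (x : ℝ) : (x : ℂ) + Complex.I ≠ 0 := by
  intro h
  simpa using congrArg Complex.im h

lemma sub_I_ne_zero (x : ℝ) : (x : ℂ) - Complex.I ≠ 0 := by
  intro h
  simpa using congrArg Complex.im h

lemma norm_add_I (x : ℝ) : ‖(x : ℂ) + Complex.I‖ = Real.sqrt (x ^ 2 + 1) := by
  have := Complex.norm_add_mul_I x 1
  simpa using this

lemma abs_le_norm_add_I (x : ℝ) : |x| ≤ ‖(x : ℂ) + Complex.I‖ := by
  rw [norm_add_I]; exact Real.abs_le_sqrt (by linarith)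

lemma one_le_norm_add_I (x : ℝ) : 1 ≤ ‖(x : ℂ) + Complex.I‖ := by
  rw [norm_add_I]; exact Real.one_le_sqrt.2 (by nlinarith [sq_nonneg x])

lemma continuous_resCoeff : Continuous resCoeff :=
  Continuous.inv₀ (by fun_prop) add_I_ne_zero

lemma norm_resCoeff_le (x : ℝ) : ‖resCoeff x‖ ≤ 1 := by
  rw [resCoeff, norm_inv]; exact inv_le_one_of_one_le₀ (one_le_norm_add_I x)

lemma norm_cutCoeff (x : ℝ) : ‖cutCoeff x‖ = |x| / ‖(x : ℂ) + Complex.I‖ := by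
  rw [cutCoeff, resCoeff, norm_mul, norm_inv, Complex.norm_real, Real.norm_eq_abs, div_eq_mul_inv]

lemma norm_cutCoeff_le (x : ℝ) : ‖cutCoeff x‖ ≤ 1 := by
  rw [norm_cutCoeff]
  exact div_le_one_of_le₀ (abs_le_norm_add_I x) (norm_nonneg _)

lemma norm_cutCoeff_le_abs (x : ℝ) : ‖cutCoeff x‖ ≤ |x| := by
  rw [norm_cutCoeff]
  exact div_le_self (abs_nonneg _) (one_le_norm_add_I x)

lemma isBddMeas_resCoeff : IsBddMeas resCoeff :=
  ⟨continuous_resCoeff.measurable, 1, norm_resCoeff_le⟩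

lemma continuous_cutCoeff : Continuous cutCoeff :=
  Complex.continuous_ofReal.mul continuous_resCoeff

lemma isBddMeas_cutCoeff : IsBddMeas cutCoeff :=
  ⟨continuous_cutCoeff.measurable, 1, norm_cutCoeff_le⟩

lemma conj_resCoeff (x : ℝ) : conj (resCoeff x) = ((x : ℂ) - Complex.I)⁻¹ := by
  simp [resCoeff, sub_eq_add_neg]

lemma conj_cutCoeff (x : ℝ) : conj (cutCoeff x) = x * ((x : ℂ) - Complex.I)⁻¹ := by
  simp [cutCoeff, conj_resCoeff]

lemma hasTemperateGrowth_conj_resCoeff :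
    Function.HasTemperateGrowth (fun x : ℝ => conj (resCoeff x)) := by
  have h1 := Function.hasTemperateGrowth_one_add_norm_sq_rpow ℝ (-1)
  have h2 : Function.HasTemperateGrowth (fun x : ℝ => ((1 + ‖x‖ ^ 2) ^ (-1 : ℝ) : ℝ)) := h1
  have h3 : Function.HasTemperateGrowth (fun x : ℝ =>
      (((1 + ‖x‖ ^ 2) ^ (-1 : ℝ) : ℝ) : ℂ) * (x + Complex.I)) :=
    (Complex.ofRealCLM.hasTemperateGrowth.comp h2).mul
      (hasTemperateGrowth_ofReal_id.add (Function.HasTemperateGrowth.const Complex.I))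
  suffices e : (fun x : ℝ => conj (resCoeff x)) = fun x : ℝ =>
      (((1 + ‖x‖ ^ 2) ^ (-1 : ℝ) : ℝ) : ℂ) * (x + Complex.I) by
    rw [e]; exact h3
  ext x
  rw [conj_resCoeff]
  have : (x : ℂ) ^ 2 + 1 = (x + Complex.I) * (x - Complex.I) := by
    linear_combination Complex.I_sq
  have h0 : (1 + (x : ℂ) ^ 2) ≠ 0 := by
    rw [add_comm, this]; exact mul_ne_zero (add_I_ne_zero x) (sub_I_ne_zero x)
  simp only [Real.norm_eq_abs, sq_abs, Real.rpow_neg_one]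
  push_cast
  rw [inv_mul_eq_div, eq_div_iff h0, add_comm (1 : ℂ), this, mul_comm (x + Complex.I : ℂ),
    inv_mul_cancel_left₀ (sub_I_ne_zero x)]

/-- The product of a Schwartz function with `1 / (x - i)`. -/
def mulRes (φ : 𝓢(ℝ, ℂ)) : 𝓢(ℝ, ℂ) := SchwartzMap.smulLeftCLM ℂ (fun x : ℝ => conj (resCoeff x)) φ

@[simp] lemma mulRes_apply (φ : 𝓢(ℝ, ℂ)) (x : ℝ) : mulRes φ x = conj (resCoeff x) * φ x := by
  simp [mulRes, SchwartzMap.smulLeftCLM_apply_apply hasTemperateGrowth_conj_resCoeff]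

/-- The commutator of `|D|` with `x / (x + i)`. -/
def commOp : L2R →L[ℂ] L2R :=
  mulOp resCoeff isBddMeas_resCoeff ∘L signOp ∘L mulOp resCoeff isBddMeas_resCoeff

/-- The commutator of `|D|` with `x / (x - i)` on Schwartz functions. -/
lemma commutator_schwartz {φ : 𝓢(ℝ, ℂ)} {Φ Ψ : L2R} (h1 : IsDtN (φ.toLp 2) Φ)
    (h2 : IsDtN ((mulX (mulRes φ)).toLp 2) Ψ) :
    mulOp _ isBddMeas_cutCoeff.conj Φ = Ψ + mulOp _ isBddMeas_resCoeff.conj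
      (signOp (mulOp _ isBddMeas_resCoeff.conj (φ.toLp 2))) := by
  obtain ⟨Φ₁, hΦ₁⟩ := exists_isDtN_schwartz (mulRes φ)
  have e1 : φ.toLp 2 volume
      = (mulX (mulRes φ)).toLp 2 volume - Complex.I • (mulRes φ).toLp 2 volume := by
    apply Lp.ext
    filter_upwards [φ.coeFn_toLp 2 volume, (mulX (mulRes φ)).coeFn_toLp 2 volume,
      (mulRes φ).coeFn_toLp 2 volume,
      Lp.coeFn_sub ((mulX (mulRes φ)).toLp 2) (Complex.I • (mulRes φ).toLp 2),
      Lp.coeFn_smul Complex.I ((mulRes φ).toLp 2)] with x a1 a2 a3 a4 a5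
    rw [a1, a4, Pi.sub_apply, a5, Pi.smul_apply, a2, a3, mulX_apply, mulRes_apply, conj_resCoeff,
      smul_eq_mul]
    have := sub_I_ne_zero x
    field_simp
  have e2 : Φ = Ψ - Complex.I • Φ₁ := by
    refine h1.unique ?_
    rw [e1]
    exact h2.sub (hΦ₁.smul _)
  have e3 : mulOp _ isBddMeas_resCoeff.conj (φ.toLp 2) = (mulRes φ).toLp 2 := by
    apply Lp.ext
    filter_upwards [coeFn_mulOp isBddMeas_resCoeff.conj (φ.toLp 2), φ.coeFn_toLp 2 volume,
      (mulRes φ).coeFn_toLp 2 volume] with x a1 a2 a3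
    rw [a1, a2, a3, mulRes_apply]
  rw [e3]
  apply Lp.ext
  set S := signOp ((mulRes φ).toLp 2)
  filter_upwards [coeFn_mulOp isBddMeas_cutCoeff.conj Φ, coeFn_mulOp isBddMeas_resCoeff.conj S,
    Lp.coeFn_add Ψ (mulOp _ isBddMeas_resCoeff.conj S), mul_isDtN_schwartz hΦ₁ h2,
    Lp.coeFn_sub Ψ (Complex.I • Φ₁), Lp.coeFn_smul Complex.I Φ₁] with x a1 a2 a3 a4 a5 a6
  rw [a1, a3, Pi.add_apply, a2, conj_cutCoeff, conj_resCoeff, e2, a5, Pi.sub_apply, a6,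
    Pi.smul_apply, smul_eq_mul]
  have := sub_I_ne_zero x
  field_simp
  linear_combination (-Complex.I) * a4 - S x * Complex.I_sq

lemma isDtN_cutCoeff_of_inner {η G : L2R}
    (h : ∀ (φ : 𝓢(ℝ, ℂ)) (Ψ : L2R), IsDtN ((mulX (mulRes φ)).toLp 2) Ψ →
      ⟪G, φ.toLp 2⟫_ℂ = ⟪η, Ψ⟫_ℂ) :
    IsDtN (mulOp _ isBddMeas_cutCoeff η) (G + commOp η) := by
  refine isDtN_of_inner_schwartz fun φ Φ hΦ => ?_
  obtain ⟨Ψ, hΨ⟩ := exists_isDtN_schwartz (mulX (mulRes φ))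
  rw [inner_mulOp_left, commutator_schwartz hΦ hΨ, inner_add_left, inner_add_right, h φ Ψ hΨ]
  congr 1
  simp only [commOp, ContinuousLinearMap.comp_apply]
  rw [inner_mulOp_left, inner_signOp, inner_mulOp_left]

lemma IsDtN.cutCoeff {η F : L2R} (h : IsDtN η F) :
    IsDtN (mulOp _ isBddMeas_cutCoeff η) (mulOp _ isBddMeas_cutCoeff F + commOp η) := by
  refine isDtN_cutCoeff_of_inner fun φ Ψ hΨ => ?_
  rw [inner_mulOp_left, ← h.inner_comm hΨ]
  congr 1
  apply Lp.ext
  filter_upwards [coeFn_mulOp isBddMeas_cutCoeff.conj (φ.toLp 2), φ.coeFn_toLp 2 volume,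
    (mulX (mulRes φ)).coeFn_toLp 2 volume] with x a1 a2 a3
  rw [a1, a2, a3, mulX_apply, mulRes_apply, conj_cutCoeff, conj_resCoeff, mul_assoc]

end Commutator

section Gagliardo

/-- The translation by `h` on `L²(ℝ)`. -/
def translate (h : ℝ) (f : L2R) : L2R :=
  Lp.compMeasurePreserving (fun x => x + h) (measurePreserving_add_right volume h) f

lemma coeFn_translate (h : ℝ) (f : L2R) : translate h f =ᵐ[volume] fun x => f (x + h) :=
  Lp.coeFn_compMeasurePreserving f (measurePreserving_add_right volume h)

lemma fourier_translate (h : ℝ) (f : L2R) : (𝓕 (translate h f) : L2R) =ᵐ[volume]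
    fun ξ => (Real.fourierChar (h * ξ) : ℂ) * (𝓕 f : L2R) ξ := by
  have hcont : Continuous fun ξ : ℝ => (Real.fourierChar (h * ξ) : ℂ) := by
    simp only [Real.fourierChar_apply]; fun_prop
  have hsm : ContDiff ℝ ∞ fun ξ : ℝ => (Real.fourierChar (h * ξ) : ℂ) := by
    simp only [Real.fourierChar_apply]
    exact (Complex.contDiff_exp (𝕜 := ℝ)).comp ((Complex.ofRealCLM.contDiff.comp
      (by fun_prop : ContDiff ℝ ∞ fun ξ : ℝ => 2 * Real.pi * (h * ξ))).mul contDiff_const)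
  refine ae_eq_of_integral_contDiff_smul_eq (locallyIntegrable_L2R _)
    ((locallyIntegrable_L2R _).continuous_mul hcont) fun g hg1 hg2 => ?_
  let φ := testSchwartz g hg1 hg2
  let φh : 𝓢(ℝ, ℂ) := HasCompactSupport.toSchwartzMap
    (f := fun ξ : ℝ => (Real.fourierChar (h * ξ) : ℂ) * (g ξ : ℂ))
    (hg2.comp_left (g := Complex.ofReal) Complex.ofReal_zero).mul_left
    (hsm.mul (Complex.ofRealCLM.contDiff.comp hg1))
  have hφh : ∀ ξ, φh ξ = (Real.fourierChar (h * ξ) : ℂ) * (g ξ : ℂ) := fun ξ => rfl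
  have hF : ∀ x, (𝓕 φh : 𝓢(ℝ, ℂ)) (x + h) = (𝓕 φ : 𝓢(ℝ, ℂ)) x := by
    intro x
    rw [SchwartzMap.fourier_coe, SchwartzMap.fourier_coe, Real.fourier_eq, Real.fourier_eq]
    refine integral_congr_ae (Eventually.of_forall fun y => ?_)
    simp only [hφh, Circle.smul_def, smul_eq_mul, φ, testSchwartz_apply, ← mul_assoc]
    congr 1
    rw [← Circle.coe_mul, ← AddChar.map_add_eq_mul]
    congr 2
    simp only [RCLike.inner_apply, conj_trivial]
    ring
  calc ∫ x, g x • (𝓕 (translate h f) : L2R) x = ∫ x, φ x * (𝓕 (translate h f) : L2R) x := by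
        simp [φ]
    _ = ∫ x, (𝓕 φ : 𝓢(ℝ, ℂ)) x * translate h f x := (integral_fourier_schwartz_mul _ _).symm
    _ = ∫ x, (𝓕 φh : 𝓢(ℝ, ℂ)) (x + h) * f (x + h) := by
        refine integral_congr_ae ?_
        filter_upwards [coeFn_translate h f] with x hx
        rw [hx, hF]
    _ = ∫ x, (𝓕 φh : 𝓢(ℝ, ℂ)) x * f x :=
        integral_add_right_eq_self (fun x => (𝓕 φh : 𝓢(ℝ, ℂ)) x * f x) h
    _ = ∫ x, φh x * (𝓕 f : L2R) x := integral_fourier_schwartz_mul _ _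
    _ = _ := by
        refine integral_congr_ae (Eventually.of_forall fun x => ?_)
        simp only [hφh, Complex.real_smul]
        ring

/-- The Gagliardo energy `∬ |f(x) - f(y)|² / |x - y|²` on the line. -/
def gagliardo (f : ℝ → ℂ) : ℝ≥0∞ := ∫⁻ x, ∫⁻ y, ‖(f x - f y) / ((x - y : ℝ) : ℂ)‖ₑ ^ 2

lemma gagliardo_congr {f g : ℝ → ℂ} (h : f =ᵐ[volume] g) : gagliardo f = gagliardo g := by
  refine lintegral_congr_ae ?_
  filter_upwards [h] with x hx
  refine lintegral_congr_ae ?_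
  filter_upwards [h] with y hy
  rw [hx, hy]

lemma enorm_ofReal_complex (r : ℝ) : ‖(r : ℂ)‖ₑ = ‖r‖ₑ := by
  rw [← ofReal_norm, ← ofReal_norm, Complex.norm_real]

/-- The profile `|e^{2πiu} - 1|² / u²`. -/
def gagProfile (u : ℝ) : ℝ≥0∞ := ‖((Real.fourierChar u : ℂ) - 1) / (u : ℂ)‖ₑ ^ 2

lemma measurable_fourierChar : Measurable fun u : ℝ => (Real.fourierChar u : ℂ) := by
  simp only [Real.fourierChar_apply]; fun_prop

lemma measurable_gagProfile : Measurable gagProfile := by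
  unfold gagProfile
  have := measurable_fourierChar
  fun_prop

lemma gagProfile_le (u : ℝ) : gagProfile u ≤ ENNReal.ofReal (8 * Real.pi ^ 2 * (1 + u ^ 2)⁻¹) := by
  unfold gagProfile
  rw [← ofReal_norm, ← ENNReal.ofReal_pow (norm_nonneg _)]
  apply ENNReal.ofReal_le_ofReal
  rw [norm_div, Complex.norm_real, Real.norm_eq_abs, div_pow, sq_abs]
  have hpi : 3 < Real.pi := Real.pi_gt_three
  have h1 : ‖(Real.fourierChar u : ℂ) - 1‖ ≤ 2 := by
    refine (norm_sub_le _ _).trans ?_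
    rw [Circle.norm_coe, norm_one]; norm_num
  have h2 : ‖(Real.fourierChar u : ℂ) - 1‖ ≤ 2 * Real.pi * |u| := by
    rw [Real.fourierChar_apply, mul_comm]
    refine (Real.norm_exp_I_mul_ofReal_sub_one_le (x := 2 * Real.pi * u)).trans ?_
    rw [Real.norm_eq_abs, abs_mul, abs_of_pos (by positivity)]
  rw [← div_eq_mul_inv, le_div_iff₀ (by positivity)]
  rcases eq_or_ne u 0 with rfl | hu
  · simp; positivity
  rw [div_mul_eq_mul_div, div_le_iff₀ (by positivity)]
  have h3 : ‖(Real.fourierChar u : ℂ) - 1‖ ^ 2 ≤ 4 * Real.pi ^ 2 * u ^ 2 := by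
    calc _ ≤ (2 * Real.pi * |u|) ^ 2 := by gcongr
      _ = _ := by rw [mul_pow, sq_abs]; ring
  have h4 : ‖(Real.fourierChar u : ℂ) - 1‖ ^ 2 ≤ 4 := by nlinarith [norm_nonneg ((Real.fourierChar u : ℂ) - 1)]
  nlinarith [sq_nonneg u, mul_nonneg (sq_nonneg u) (show 0 ≤ 4 * Real.pi ^ 2 - 4 by nlinarith)]

lemma lintegral_gagProfile_lt_top : ∫⁻ u, gagProfile u < ⊤ := by
  refine (lintegral_mono gagProfile_le).trans_lt ?_
  have := (integrable_inv_one_add_sq.const_mul (8 * Real.pi ^ 2)).lintegral_lt_top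
  exact this

lemma lintegral_gagProfile_ne_zero : ∫⁻ u, gagProfile u ≠ 0 := by
  intro h
  rw [lintegral_eq_zero_iff measurable_gagProfile] at h
  have h1 : ∀ u ∈ Set.Ioo (0 : ℝ) 1, gagProfile u ≠ 0 := by
    intro u hu h0
    unfold gagProfile at h0
    rw [pow_eq_zero_iff two_ne_zero, enorm_eq_zero, div_eq_zero_iff] at h0
    rcases h0 with h0 | h0
    · rw [sub_eq_zero, Real.fourierChar_apply, Complex.exp_eq_one_iff] at h0
      obtain ⟨n, hn⟩ := h0
      have h2 : (u : ℂ) = n := by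
        have h3 : (2 * Real.pi * Complex.I : ℂ) ≠ 0 := by simp [Real.pi_ne_zero]
        apply mul_right_cancel₀ h3
        rw [← hn]; push_cast; ring
      have h4 : u = (n : ℝ) := by exact_mod_cast h2
      rw [h4] at hu
      have h5 : (0 : ℤ) < n := by exact_mod_cast hu.1
      have h6 : n < (1 : ℤ) := by exact_mod_cast hu.2
      omega
    · have : u = 0 := by exact_mod_cast h0
      exact hu.1.ne' this
  have h2 : volume (Set.Ioo (0 : ℝ) 1) = 0 := by
    refine measure_mono_null (fun u hu => ?_) (mem_ae_iff.1 h)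
    simpa using h1 u hu
  simp at h2

lemma lintegral_profile_scale (ξ : ℝ) :
    ∫⁻ h : ℝ, ‖((Real.fourierChar (h * ξ) : ℂ) - 1) / (h : ℂ)‖ₑ ^ 2
      = ENNReal.ofReal |ξ| * ∫⁻ u, gagProfile u := by
  rcases eq_or_ne ξ 0 with rfl | hξ
  · simp
  have h1 := lintegral_image_eq_lintegral_abs_deriv_mul (f := fun h : ℝ => h * ξ)
    (f' := fun _ => ξ) (s := Set.univ) MeasurableSet.univ
    (fun x _ => (hasDerivAt_mul_const ξ).hasDerivWithinAt)
    (fun a _ b _ hab => mul_right_cancel₀ hξ hab) gagProfile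
  have h2 : (fun h : ℝ => h * ξ) '' Set.univ = Set.univ := by
    rw [Set.image_univ]
    exact Set.range_eq_univ.2 fun y => ⟨y / ξ, by field_simp⟩
  rw [h2, Measure.restrict_univ] at h1
  rw [h1, ← lintegral_const_mul _ (by
    exact measurable_const.mul (measurable_gagProfile.comp (by fun_prop)))]
  refine lintegral_congr fun h => ?_
  unfold gagProfile
  rw [← mul_assoc, ← ENNReal.ofReal_mul (abs_nonneg _), ← pow_two, ENNReal.ofReal_pow (abs_nonneg _),
    ← Real.enorm_eq_ofReal_abs, ← mul_pow]
  congr 1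
  rw [← enorm_ofReal_complex, ← enorm_mul]
  congr 1
  have : (ξ : ℂ) ≠ 0 := by exact_mod_cast hξ
  push_cast
  rcases eq_or_ne (h : ℂ) 0 with h0 | h0
  · simp [h0]
  · field_simp

/-- The constant in the formula for the Gagliardo energy. -/
def gagConst : ℝ := (∫⁻ u, gagProfile u).toReal / (2 * Real.pi)

lemma gagConst_pos : 0 < gagConst :=
  div_pos (ENNReal.toReal_pos lintegral_gagProfile_ne_zero lintegral_gagProfile_lt_top.ne)
    (by positivity)

lemma lintegral_norm_translate_sub (h : ℝ) (f : L2R) : ∫⁻ x, ‖f (x + h) - f x‖ₑ ^ 2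
    = ∫⁻ ξ, ‖((Real.fourierChar (h * ξ) : ℂ) - 1) * (𝓕 f : L2R) ξ‖ₑ ^ 2 := by
  have h1 := ofReal_norm_sq_eq_lintegral (translate h f - f)
  have h2 := ofReal_norm_sq_eq_lintegral (𝓕 (translate h f - f) : L2R)
  rw [Lp.norm_fourier_eq, h1] at h2
  have e1 : ∫⁻ x, ‖f (x + h) - f x‖ₑ ^ 2 = ∫⁻ x, ‖(translate h f - f : L2R) x‖ₑ ^ 2 := by
    refine lintegral_congr_ae ?_
    filter_upwards [coeFn_translate h f, Lp.coeFn_sub (translate h f) f] with x h3 h4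
    rw [h4, Pi.sub_apply, h3]
  rw [e1, h2]
  refine lintegral_congr_ae ?_
  have e2 : translate h f - f = translate h f + (-1 : ℂ) • f := by simp [sub_eq_add_neg]
  rw [e2]
  filter_upwards [fourier_add_coeFn (translate h f) ((-1 : ℂ) • f),
    fourier_smul_coeFn (-1) f, fourier_translate h f] with ξ a1 a2 a3
  rw [a1, a2, a3]
  congr 2
  ring

/-- The Gagliardo energy is the quadratic form of `|D|`, up to a constant. -/
lemma gagliardo_eq (f : L2R) : gagliardo f = ENNReal.ofReal gagConst *
    ∫⁻ ξ, ENNReal.ofReal (dtnSymbol ξ) * ‖(𝓕 f : L2R) ξ‖ₑ ^ 2 := by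
  have hf : Measurable f := (Lp.stronglyMeasurable f).measurable
  have hF : Measurable (𝓕 f : L2R) := (Lp.stronglyMeasurable (𝓕 f : L2R)).measurable
  have hch := measurable_fourierChar
  have s1 : gagliardo f = ∫⁻ x, ∫⁻ h : ℝ, ‖(h : ℂ)⁻¹‖ₑ ^ 2 * ‖f (x + h) - f x‖ₑ ^ 2 := by
    refine lintegral_congr fun x => ?_
    rw [← lintegral_add_left_eq_self _ x]
    refine lintegral_congr fun h => ?_
    rw [← mul_pow, ← enorm_mul]
    congr 2
    rw [inv_mul_eq_div, ← neg_div_neg_eq]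
    push_cast
    congr 1 <;> ring
  have s2 : gagliardo f = ∫⁻ h : ℝ, ‖(h : ℂ)⁻¹‖ₑ ^ 2 * ∫⁻ x, ‖f (x + h) - f x‖ₑ ^ 2 := by
    rw [s1, lintegral_lintegral_swap]
    · refine lintegral_congr fun h => ?_
      rw [lintegral_const_mul _ (by fun_prop)]
    · apply Measurable.aemeasurable
      unfold Function.uncurry
      fun_prop
  rw [s2]
  simp only [lintegral_norm_translate_sub]
  have s3 : ∀ h : ℝ, ‖(h : ℂ)⁻¹‖ₑ ^ 2 *
      ∫⁻ ξ, ‖((Real.fourierChar (h * ξ) : ℂ) - 1) * (𝓕 f : L2R) ξ‖ₑ ^ 2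
      = ∫⁻ ξ, ‖((Real.fourierChar (h * ξ) : ℂ) - 1) / (h : ℂ)‖ₑ ^ 2 * ‖(𝓕 f : L2R) ξ‖ₑ ^ 2 := by
    intro h
    have hc : Measurable fun ξ : ℝ => (Real.fourierChar (h * ξ) : ℂ) := hch.comp (by fun_prop)
    rw [← lintegral_const_mul _ (by fun_prop)]
    refine lintegral_congr fun ξ => ?_
    rw [← mul_pow, ← mul_pow, ← enorm_mul, ← enorm_mul]
    congr 2
    ring
  simp only [s3]
  rw [lintegral_lintegral_swap]
  · have hc2 : Measurable fun ξ : ℝ => ENNReal.ofReal (dtnSymbol ξ) :=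
      measurable_dtnSymbol.ennreal_ofReal
    rw [← lintegral_const_mul _ (by fun_prop)]
    refine lintegral_congr fun ξ => ?_
    have hc : Measurable fun h : ℝ => (Real.fourierChar (h * ξ) : ℂ) := hch.comp (by fun_prop)
    rw [lintegral_mul_const _ (by fun_prop), lintegral_profile_scale, ← mul_assoc]
    congr 1
    rw [gagConst, ← ENNReal.ofReal_mul (by positivity), dtnSymbol,
      ← ENNReal.ofReal_toReal lintegral_gagProfile_lt_top.ne,
      ← ENNReal.ofReal_mul (abs_nonneg _), ENNReal.toReal_ofReal ENNReal.toReal_nonneg]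
    congr 1
    field_simp
  · apply Measurable.aemeasurable
    unfold Function.uncurry
    have hc : Measurable fun p : ℝ × ℝ => (Real.fourierChar (p.1 * p.2) : ℂ) :=
      hch.comp (by fun_prop)
    fun_prop

/-- `G` is the Fourier transform of `|D|^{1/2} f`. -/
def IsSqrtDtN (f G : L2R) : Prop :=
  G =ᵐ[volume] fun ξ => (Real.sqrt (dtnSymbol ξ) : ℂ) * (𝓕 f : L2R) ξ

lemma enorm_sqrt_symbol_sq (ξ : ℝ) (w : ℂ) : ‖(Real.sqrt (dtnSymbol ξ) : ℂ) * w‖ₑ ^ 2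
    = ENNReal.ofReal (dtnSymbol ξ) * ‖w‖ₑ ^ 2 := by
  rw [enorm_mul, mul_pow, enorm_ofReal_complex, Real.enorm_eq_ofReal (Real.sqrt_nonneg _),
    ← ENNReal.ofReal_pow (Real.sqrt_nonneg _), Real.sq_sqrt (dtnSymbol_nonneg ξ)]

lemma IsSqrtDtN.gagliardo_eq {f G : L2R} (h : IsSqrtDtN f G) :
    gagliardo f = ENNReal.ofReal (gagConst * ‖G‖ ^ 2) := by
  rw [FloatingCylinder.gagliardo_eq, ENNReal.ofReal_mul gagConst_pos.le,
    ofReal_norm_sq_eq_lintegral]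
  congr 1
  refine lintegral_congr_ae ?_
  filter_upwards [h] with ξ hξ
  rw [hξ, enorm_sqrt_symbol_sq]

lemma memLp_sqrt_of_gagliardo {f : L2R} (h : gagliardo f < ⊤) :
    MemLp (fun ξ => (Real.sqrt (dtnSymbol ξ) : ℂ) * (𝓕 f : L2R) ξ) 2 volume := by
  refine memLp_two_iff_lintegral.2 ⟨?_, ?_⟩
  · exact ((Complex.measurable_ofReal.comp (measurable_dtnSymbol.sqrt)).aestronglyMeasurable).mul
      (Lp.aestronglyMeasurable _)
  · simp only [enorm_sqrt_symbol_sq]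
    rw [gagliardo_eq] at h
    by_contra hc
    rw [not_lt, top_le_iff] at hc
    rw [hc, ENNReal.mul_top (by simpa using gagConst_pos)] at h
    exact lt_irrefl _ h

lemma IsDtN.exists_isSqrtDtN {f F : L2R} (h : IsDtN f F) : ∃ G, IsSqrtDtN f G := by
  have h1 : MemLp (fun ξ => (Real.sqrt (dtnSymbol ξ) : ℂ) * (𝓕 f : L2R) ξ) 2 volume := by
    refine MemLp.of_le (g := fun ξ => ‖(𝓕 f : L2R) ξ‖ + ‖(𝓕 F : L2R) ξ‖)
      ((Lp.memLp (𝓕 f : L2R)).norm.add (Lp.memLp (𝓕 F : L2R)).norm) ?_ ?_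
    · exact ((Complex.measurable_ofReal.comp (measurable_dtnSymbol.sqrt)).aestronglyMeasurable).mul
        (Lp.aestronglyMeasurable _)
    · filter_upwards [h] with ξ hξ
      have h0 := dtnSymbol_nonneg ξ
      rw [hξ, norm_mul, norm_mul, Complex.norm_real, Complex.norm_real, Real.norm_eq_abs,
        Real.norm_eq_abs, Real.norm_eq_abs, abs_of_nonneg (Real.sqrt_nonneg _), abs_of_nonneg h0,
        abs_of_nonneg (by positivity)]
      have h2 : Real.sqrt (dtnSymbol ξ) ≤ 1 + dtnSymbol ξ := by
        rw [Real.sqrt_le_left (by linarith)]; nlinarith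
      nlinarith [norm_nonneg ((𝓕 f : L2R) ξ)]
  exact ⟨h1.toLp _, h1.coeFn_toLp⟩

lemma IsSqrtDtN.add {f F g G : L2R} (h1 : IsSqrtDtN f F) (h2 : IsSqrtDtN g G) :
    IsSqrtDtN (f + g) (F + G) := by
  filter_upwards [h1, h2, fourier_add_coeFn f g, Lp.coeFn_add F G] with ξ h1 h2 h3 h4
  rw [h3, h4, Pi.add_apply, h1, h2, mul_add]

lemma IsSqrtDtN.smul {f F : L2R} (c : ℂ) (h1 : IsSqrtDtN f F) : IsSqrtDtN (c • f) (c • F) := by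
  filter_upwards [h1, fourier_smul_coeFn c f, Lp.coeFn_smul c F] with ξ h1 h3 h4
  rw [h3, h4, Pi.smul_apply, h1, smul_eq_mul]; ring

lemma IsSqrtDtN.inner_eq {f G g H F : L2R} (h1 : IsSqrtDtN f G) (h2 : IsSqrtDtN g H)
    (h3 : IsDtN g F) : ⟪f, F⟫_ℂ = ⟪G, H⟫_ℂ := by
  rw [← Lp.inner_fourier_eq f F, inner_eq_integral, inner_eq_integral]
  refine integral_congr_ae ?_
  filter_upwards [h1, h2, h3] with ξ h1 h2 h3
  rw [h1, h2, h3, map_mul, Complex.conj_ofReal]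
  have : ((Real.sqrt (dtnSymbol ξ) : ℂ)) * (Real.sqrt (dtnSymbol ξ) : ℂ) = (dtnSymbol ξ : ℂ) := by
    exact_mod_cast Real.mul_self_sqrt (dtnSymbol_nonneg ξ)
  rw [← this]
  ring

end Gagliardo

section GagliardoInversion

lemma lintegral_inv_subst (F : ℝ → ℝ≥0∞) :
    ∫⁻ x, F x = ∫⁻ x : ℝ, ENNReal.ofReal ((x ^ 2)⁻¹) * F x⁻¹ := by
  have h0 : ({x | x ≠ 0} : Set ℝ) ∈ ae volume := by simp [mem_ae_iff]
  have h1 := lintegral_image_eq_lintegral_abs_deriv_mul (s := {x : ℝ | x ≠ 0})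
    (f := fun x => x⁻¹) isOpen_ne.measurableSet
    (fun x hx => (hasDerivAt_inv hx).hasDerivWithinAt) inv_injective.injOn F
  have h2 : (fun x : ℝ => x⁻¹) '' {x | x ≠ 0} = {x | x ≠ 0} := by
    ext x
    exact ⟨fun ⟨y, hy, h⟩ => h ▸ inv_ne_zero hy, fun hx => ⟨x⁻¹, inv_ne_zero hx, inv_inv x⟩⟩
  rw [h2, Measure.restrict_congr_set (eventuallyEq_univ.2 h0), Measure.restrict_univ] at h1
  rw [h1]
  simp only [abs_neg, abs_inv, abs_pow, sq_abs]

/-- The kernel of the Gagliardo energy. -/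
def gagKernel (f : ℝ → ℂ) (x y : ℝ) : ℝ≥0∞ := ‖(f x - f y) / ((x - y : ℝ) : ℂ)‖ₑ ^ 2

lemma gagKernel_comm (f : ℝ → ℂ) (x y : ℝ) : gagKernel f x y = gagKernel f y x := by
  unfold gagKernel
  rw [← neg_div_neg_eq]
  congr 3
  · ring
  · push_cast; ring

lemma measurable_gagKernel {f : ℝ → ℂ} (hf : Measurable f) :
    Measurable (Function.uncurry (gagKernel f)) := by
  unfold gagKernel Function.uncurry
  fun_prop

lemma ofReal_mul_enorm_sq (r : ℝ) (w : ℂ) :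
    ENNReal.ofReal ((r ^ 2)⁻¹) * ‖w‖ₑ ^ 2 = ‖w / (r : ℂ)‖ₑ ^ 2 := by
  rw [div_eq_mul_inv, enorm_mul, mul_pow, mul_comm, ← Complex.ofReal_inv, enorm_ofReal_complex,
    Real.enorm_eq_ofReal_abs, ← ENNReal.ofReal_pow (abs_nonneg _), sq_abs, inv_pow]

lemma gagKernel_inv_inv {f : ℝ → ℂ} {x y : ℝ} (hx : x ≠ 0) (hy : y ≠ 0) :
    ENNReal.ofReal ((x ^ 2)⁻¹) * (ENNReal.ofReal ((y ^ 2)⁻¹) * gagKernel f x⁻¹ y⁻¹)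
      = gagKernel (fun x => f x⁻¹) x y := by
  unfold gagKernel
  rw [ofReal_mul_enorm_sq, ofReal_mul_enorm_sq, ← enorm_neg]
  congr 2
  have hx' : (x : ℂ) ≠ 0 := by exact_mod_cast hx
  have hy' : (y : ℂ) ≠ 0 := by exact_mod_cast hy
  have e : ((x⁻¹ - y⁻¹ : ℝ) : ℂ) = -((x - y : ℝ) : ℂ) / (x * y) := by
    push_cast; field_simp; ring
  rw [e]
  rcases eq_or_ne ((x - y : ℝ) : ℂ) 0 with h | h
  · simp [h]
  · field_simp

lemma gagliardo_inv (f : ℝ → ℂ) : gagliardo (fun x => f x⁻¹) = gagliardo f := by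
  have h0 : ∀ᵐ x : ℝ, x ≠ 0 := by simp [ae_iff]
  unfold gagliardo
  conv_rhs => rw [lintegral_inv_subst]
  refine lintegral_congr_ae ?_
  filter_upwards [h0] with x hx
  rw [lintegral_inv_subst (fun y => ‖(f x⁻¹ - f y) / ((x⁻¹ - y : ℝ) : ℂ)‖ₑ ^ 2),
    ← lintegral_const_mul' _ _ ENNReal.ofReal_ne_top]
  refine lintegral_congr_ae ?_
  filter_upwards [h0] with y hy
  exact (gagKernel_inv_inv hx hy).symm

/-- The Gagliardo energy on `ℰ`. -/
def surfaceGagliardo (v : ℝ → ℂ) : ℝ≥0∞ :=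
  ∫⁻ a in freeSurface, ∫⁻ b in freeSurface, gagKernel v a b

lemma gagKernel_surface {v : ℝ → ℂ} {a b : ℝ} (ha : a ∈ freeSurface) (hb : b ∈ freeSurface) :
    gagKernel (inversionExtension v) a b = gagKernel v a b := by
  unfold gagKernel
  rw [inversionExtension_of_mem ha, inversionExtension_of_mem hb]

lemma surfaceGagliardo_le (v : ℝ → ℂ) :
    surfaceGagliardo v ≤ gagliardo (inversionExtension v) := by
  unfold surfaceGagliardo gagliardo
  refine le_trans (setLIntegral_mono' measurableSet_freeSurface fun a ha => ?_)
    (setLIntegral_le_lintegral freeSurface _)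
  refine le_trans (setLIntegral_mono' measurableSet_freeSurface fun b hb => ?_)
    (setLIntegral_le_lintegral freeSurface _)
  rw [← gagKernel_surface ha hb, gagKernel]

lemma abs_sub_le_abs_mul_sub_one {a b : ℝ} (ha : a ∈ freeSurface) (hb : b ∈ freeSurface) :
    |a - b| ≤ |a * b - 1| := by
  have ha' : 1 < a ^ 2 := (one_lt_sq_iff_one_lt_abs a).2 ha
  have hb' : 1 < b ^ 2 := (one_lt_sq_iff_one_lt_abs b).2 hb
  apply sq_le_sq.1
  nlinarith [mul_pos (sub_pos.2 ha') (sub_pos.2 hb')]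

lemma gagKernel_inv_right_le {v : ℝ → ℂ} {a b : ℝ} (ha : a ∈ freeSurface) (hb : b ∈ freeSurface) :
    ENNReal.ofReal ((b ^ 2)⁻¹) * gagKernel (inversionExtension v) a b⁻¹ ≤ gagKernel v a b := by
  unfold gagKernel
  rw [inversionExtension_of_mem ha, inversionExtension_inv hb, ofReal_mul_enorm_sq]
  gcongr ?_ ^ 2
  rw [← ofReal_norm, ← ofReal_norm]
  apply ENNReal.ofReal_le_ofReal
  rw [div_div, norm_div, norm_div]
  have hb0 := ne_zero_of_mem_freeSurface hb
  have e : ((a - b⁻¹ : ℝ) : ℂ) * (b : ℂ) = ((a * b - 1 : ℝ) : ℂ) := by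
    have : (b : ℂ) ≠ 0 := by exact_mod_cast hb0
    push_cast; field_simp
  rw [e, Complex.norm_real, Complex.norm_real, Real.norm_eq_abs, Real.norm_eq_abs]
  rcases eq_or_ne a b with rfl | hab
  · simp
  · have : 0 < |a - b| := abs_pos.2 (sub_ne_zero.2 hab)
    exact div_le_div_of_nonneg_left (norm_nonneg _) this (abs_sub_le_abs_mul_sub_one ha hb)

lemma gagKernel_inv_left_le {v : ℝ → ℂ} {a b : ℝ} (ha : a ∈ freeSurface) (hb : b ∈ freeSurface) :
    ENNReal.ofReal ((a ^ 2)⁻¹) * gagKernel (inversionExtension v) a⁻¹ b ≤ gagKernel v a b := by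
  rw [gagKernel_comm, gagKernel_comm v]; exact gagKernel_inv_right_le hb ha

lemma gagKernel_inv_inv_surface {v : ℝ → ℂ} {a b : ℝ} (ha : a ∈ freeSurface)
    (hb : b ∈ freeSurface) :
    ENNReal.ofReal ((a ^ 2)⁻¹) * (ENNReal.ofReal ((b ^ 2)⁻¹) *
      gagKernel (inversionExtension v) a⁻¹ b⁻¹) = gagKernel v a b := by
  rw [gagKernel_inv_inv (ne_zero_of_mem_freeSurface ha) (ne_zero_of_mem_freeSurface hb)]
  simp only [gagKernel, inversionExtension_inv ha, inversionExtension_inv hb]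

lemma lintegral_gagKernel_le {v : ℝ → ℂ} {a : ℝ} (ha : a ∈ freeSurface) :
    ∫⁻ y, gagKernel (inversionExtension v) a y
      ≤ 2 * ∫⁻ b in freeSurface, gagKernel v a b := by
  rw [lintegral_eq_add_inv (gagKernel (inversionExtension v) a), two_mul]
  refine add_le_add (setLIntegral_mono' measurableSet_freeSurface fun b hb => ?_)
    (setLIntegral_mono' measurableSet_freeSurface fun b hb => gagKernel_inv_right_le ha hb)
  exact (gagKernel_surface ha hb).le

lemma lintegral_gagKernel_inv_le {v : ℝ → ℂ} {a : ℝ} (ha : a ∈ freeSurface) :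
    ENNReal.ofReal ((a ^ 2)⁻¹) * ∫⁻ y, gagKernel (inversionExtension v) a⁻¹ y
      ≤ 2 * ∫⁻ b in freeSurface, gagKernel v a b := by
  rw [lintegral_eq_add_inv (gagKernel (inversionExtension v) a⁻¹), mul_add, two_mul,
    ← lintegral_const_mul' _ _ ENNReal.ofReal_ne_top,
    ← lintegral_const_mul' _ _ ENNReal.ofReal_ne_top]
  refine add_le_add (setLIntegral_mono' measurableSet_freeSurface fun b hb => ?_)
    (setLIntegral_mono' measurableSet_freeSurface fun b hb => ?_)
  · exact gagKernel_inv_left_le ha hb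
  · exact (gagKernel_inv_inv_surface ha hb).le

lemma gagliardo_le_surfaceGagliardo {v : ℝ → ℂ} (hv : Measurable v) :
    gagliardo (inversionExtension v) ≤ 4 * surfaceGagliardo v := by
  have hk := measurable_gagKernel hv
  have hk2 : Measurable fun a => ∫⁻ b in freeSurface, gagKernel v a b := hk.lintegral_prod_right'
  change ∫⁻ x, ∫⁻ y, gagKernel (inversionExtension v) x y ≤ _
  rw [lintegral_eq_add_inv (fun x => ∫⁻ y, gagKernel (inversionExtension v) x y)]
  have e1 : ∫⁻ a in freeSurface, ∫⁻ y, gagKernel (inversionExtension v) a y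
      ≤ 2 * surfaceGagliardo v := by
    rw [surfaceGagliardo, ← lintegral_const_mul _ hk2]
    exact setLIntegral_mono' measurableSet_freeSurface fun a ha => lintegral_gagKernel_le ha
  have e2 : ∫⁻ a in freeSurface, ENNReal.ofReal ((a ^ 2)⁻¹) *
      ∫⁻ y, gagKernel (inversionExtension v) a⁻¹ y ≤ 2 * surfaceGagliardo v := by
    rw [surfaceGagliardo, ← lintegral_const_mul _ hk2]
    exact setLIntegral_mono' measurableSet_freeSurface fun a ha => lintegral_gagKernel_inv_le ha
  refine (add_le_add e1 e2).trans_eq ?_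
  rw [← add_mul, two_add_two_eq_four]

lemma halfNorm_snd (p : sobolevHalf) :
    ENNReal.ofReal (‖p.1.snd‖ ^ 2) = surfaceGagliardo (halfToL2 p) := by
  have hv := (Lp.stronglyMeasurable (halfToL2 p)).measurable
  have hk := measurable_gagKernel hv
  rw [ofReal_norm_sq_eq_lintegral, surfaceGagliardo, ← lintegral_prod
    (fun z : ℝ × ℝ => gagKernel (halfToL2 p) z.1 z.2) hk.aemeasurable]
  refine lintegral_congr_ae ?_
  have hp : IsDiffQuotient p.1.fst p.1.snd := p.2
  filter_upwards [hp] with z hz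
  rw [hz]
  rfl

lemma exists_half_of_surfaceGagliardo {v : L2E} (h : surfaceGagliardo v < ⊤) :
    ∃ p : sobolevHalf, halfToL2 p = v := by
  have hv := (Lp.stronglyMeasurable v).measurable
  have hk := measurable_gagKernel hv
  have h1 : MemLp (fun z : ℝ × ℝ => (v z.1 - v z.2) / ((z.1 - z.2 : ℝ) : ℂ)) 2
      (surfaceMeasure.prod surfaceMeasure) := by
    refine memLp_two_iff_lintegral.2 ⟨Measurable.aestronglyMeasurable (by fun_prop), ?_⟩
    rw [surfaceGagliardo, ← lintegral_prod
      (fun z : ℝ × ℝ => gagKernel v z.1 z.2) hk.aemeasurable] at h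
    exact h
  exact ⟨⟨WithLp.toLp 2 (v, h1.toLp _), h1.coeFn_toLp⟩, rfl⟩

lemma half_norm_sq (p : sobolevHalf) : ‖p‖ ^ 2 = ‖halfToL2 p‖ ^ 2 + ‖p.1.snd‖ ^ 2 :=
  WithLp.prod_norm_sq_eq_of_L2 p.1

end GagliardoInversion

section Covariance

lemma IsSqrtDtN.norm_eq_of_inv {f f' G G' : L2R} (h : IsSqrtDtN f G) (h' : IsSqrtDtN f' G')
    (hinv : f' =ᵐ[volume] fun x => f x⁻¹) : ‖G'‖ = ‖G‖ := by
  have h1 : gagliardo f' = gagliardo f := by rw [gagliardo_congr hinv, gagliardo_inv]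
  rw [h.gagliardo_eq, h'.gagliardo_eq,
    ENNReal.ofReal_eq_ofReal_iff (by have := gagConst_pos; positivity)
      (by have := gagConst_pos; positivity)] at h1
  have h2 := mul_left_cancel₀ gagConst_pos.ne' h1
  exact (sq_eq_sq₀ (norm_nonneg _) (norm_nonneg _)).1 h2

lemma IsSqrtDtN.inner_eq_of_inv {f f' τ τ' G G' T T' : L2R} (hf : IsSqrtDtN f G)
    (hf' : IsSqrtDtN f' G') (hfinv : f' =ᵐ[volume] fun x => f x⁻¹) (hτ : IsSqrtDtN τ T)
    (hτ' : IsSqrtDtN τ' T') (hinv : τ' =ᵐ[volume] fun x => τ x⁻¹) : ⟪G', T'⟫_ℂ = ⟪G, T⟫_ℂ := by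
  have key : ∀ c : ℂ, ‖G' + c • T'‖ = ‖G + c • T‖ := by
    intro c
    refine (hf.add (hτ.smul c)).norm_eq_of_inv (hf'.add (hτ'.smul c)) ?_
    filter_upwards [hfinv, hinv, Lp.coeFn_add f' (c • τ'), Lp.coeFn_smul c τ',
      ae_inv_of_ae (Lp.coeFn_add f (c • τ)), ae_inv_of_ae (Lp.coeFn_smul c τ)]
      with x h1 h2 h3 h4 h5 h6
    rw [h3, h5, Pi.add_apply, Pi.add_apply, h4, h6, Pi.smul_apply, Pi.smul_apply, h2, h1]
  have k1 := key 1
  have k2 := key (-1)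
  have k3 := key Complex.I
  have k4 := key (-Complex.I)
  simp only [one_smul, neg_smul, ← sub_eq_add_neg] at k1 k2 k3 k4
  rw [inner_eq_sum_norm_sq_div_four, inner_eq_sum_norm_sq_div_four G T]
  simp only [RCLike.I_to_complex, k1, k2, k3, k4]

/-- The inversion `x ↦ g(1/x)` of a test function on `ℰ`. -/
lemma contDiff_inv_test {g : ℝ → ℝ} (h1 : ContDiff ℝ ∞ g) (h2 : HasCompactSupport g)
    (h3 : tsupport g ⊆ freeSurface) :
    ContDiff ℝ ∞ (fun x => g x⁻¹) ∧ HasCompactSupport fun x => g x⁻¹ := by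
  constructor
  · rw [contDiff_iff_contDiffAt]
    intro x
    rcases eq_or_ne x 0 with rfl | hx
    · obtain ⟨R, hR⟩ := h2.isBounded.subset_closedBall 0
      have hev : (fun x => g x⁻¹) =ᶠ[𝓝 0] fun _ => 0 := by
        have : Set.Ioo (-(|R| + 1)⁻¹) ((|R| + 1)⁻¹) ∈ 𝓝 (0 : ℝ) :=
          Ioo_mem_nhds (by simp; positivity) (by positivity)
        filter_upwards [this] with x hx
        apply image_eq_zero_of_notMem_tsupport
        intro hmem
        have h4 : |x⁻¹| ≤ R := by simpa using hR hmem
        have h5 : 1 < |x⁻¹| := h3 hmem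
        have h6 : |x| < (|R| + 1)⁻¹ := abs_lt.2 hx
        rw [abs_inv] at h4 h5
        have h7 : 0 < |x| := by
          by_contra hc
          have : |x| = 0 := le_antisymm (not_lt.1 hc) (abs_nonneg _)
          simp [this] at h5
          linarith
        have h8 : |R| + 1 < |x|⁻¹ := by
          rw [lt_inv_comm₀ (by positivity) h7]; exact h6
        linarith [le_abs_self R]
      exact contDiffAt_const.congr_of_eventuallyEq hev
    · exact h1.contDiffAt.comp x (contDiffAt_inv ℝ hx)
  · refine HasCompactSupport.intro (isCompact_Icc (a := (-1 : ℝ)) (b := 1)) fun x hx => ?_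
    apply image_eq_zero_of_notMem_tsupport
    intro hmem
    have h5 : 1 < |x⁻¹| := h3 hmem
    rw [abs_inv] at h5
    have h6 : |x| < 1 := by
      by_contra hc
      exact absurd h5 (not_lt.2 (inv_le_one_of_one_le₀ (not_lt.1 hc)))
    exact hx (abs_le.1 h6.le)

lemma memLp_inv_weight (F : L2R) :
    MemLp (fun z => (((z ^ 2)⁻¹ : ℝ) : ℂ) * F z⁻¹) 2 surfaceMeasure := by
  have hF := (Lp.stronglyMeasurable F).measurable
  refine memLp_two_iff_lintegral.2 ⟨Measurable.aestronglyMeasurable (by fun_prop), ?_⟩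
  have h1 : ∫⁻ x, ‖F x‖ₑ ^ 2 < ⊤ := by
    rw [← ofReal_norm_sq_eq_lintegral]; exact ENNReal.ofReal_lt_top
  rw [lintegral_eq_add_inv (fun x => ‖F x‖ₑ ^ 2)] at h1
  refine lt_of_le_of_lt ?_ (lt_of_le_of_lt le_add_self h1)
  refine setLIntegral_mono' measurableSet_freeSurface fun z hz => ?_
  have hz1 : 1 ≤ z ^ 2 := ((one_lt_sq_iff_one_lt_abs z).2 hz).le
  rw [enorm_mul, mul_pow]
  gcongr
  rw [enorm_ofReal_complex, Real.enorm_eq_ofReal (by positivity), ← ENNReal.ofReal_pow (by positivity)]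
  apply ENNReal.ofReal_le_ofReal
  have : (z ^ 2)⁻¹ ≤ 1 := inv_le_one_of_one_le₀ hz1
  have h0 : 0 ≤ (z ^ 2)⁻¹ := by positivity
  nlinarith

/-- `|D|` commutes with the inversion, up to the factor `x⁻²`. -/
lemma IsDtN.inv {f f' F F' : L2R} (h : IsDtN f F) (h' : IsDtN f' F')
    (hinv : f' =ᵐ[volume] fun x => f x⁻¹) :
    ∀ᵐ z ∂surfaceMeasure, (((z ^ 2)⁻¹ : ℝ) : ℂ) * F z⁻¹ = F' z := by
  have hW := memLp_inv_weight F
  have hFE : MemLp F' 2 surfaceMeasure := (Lp.memLp F').restrict freeSurface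
  suffices H : ∀ᵐ z ∂surfaceMeasure, conj ((((z ^ 2)⁻¹ : ℝ) : ℂ) * F z⁻¹ - F' z) = 0 by
    filter_upwards [H] with z hz
    rw [map_eq_zero, sub_eq_zero] at hz
    exact hz
  have hsub : MemLp (fun z => conj ((((z ^ 2)⁻¹ : ℝ) : ℂ) * F z⁻¹ - F' z)) 2 surfaceMeasure :=
    (hW.sub hFE).star
  have hloc : LocallyIntegrableOn
      (fun z => conj ((((z ^ 2)⁻¹ : ℝ) : ℂ) * F z⁻¹ - F' z)) freeSurface volume :=
    locallyIntegrableOn_of_locallyIntegrable_restrict (hsub.locallyIntegrable (by norm_num))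
  refine (ae_restrict_iff' measurableSet_freeSurface).2
    (isOpen_freeSurface.ae_eq_zero_of_integral_contDiff_smul_eq_zero hloc fun g h1 h2 h3 => ?_)
  obtain ⟨h1', h2'⟩ := contDiff_inv_test h1 h2 h3
  obtain ⟨Φ, hΦ⟩ := exists_isDtN_schwartz (testSchwartz g h1 h2)
  obtain ⟨Φ', hΦ'⟩ := exists_isDtN_schwartz (testSchwartz _ h1' h2')
  obtain ⟨G, hG⟩ := h.exists_isSqrtDtN
  obtain ⟨G', hG'⟩ := h'.exists_isSqrtDtN
  obtain ⟨T, hT⟩ := hΦ.exists_isSqrtDtN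
  obtain ⟨T', hT'⟩ := hΦ'.exists_isSqrtDtN
  have e1 : ⟪F, (testSchwartz _ h1' h2').toLp 2⟫_ℂ = ⟪F', (testSchwartz g h1 h2).toLp 2⟫_ℂ := by
    rw [h'.inner_comm hΦ, h.inner_comm hΦ', hG'.inner_eq hT hΦ, hG.inner_eq hT' hΦ']
    refine (hG.inner_eq_of_inv hG' hinv hT' hT ?_).symm
    filter_upwards [(testSchwartz g h1 h2).coeFn_toLp 2 volume,
      ae_inv_of_ae ((testSchwartz _ h1' h2').coeFn_toLp 2 volume)] with x k1 k2
    rw [k1, k2]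
    simp
  rw [inner_toLp_right, inner_toLp_right] at e1
  have hz0 : ∀ x, x ∉ freeSurface → g x = 0 := fun x hx =>
    image_eq_zero_of_notMem_tsupport fun hx' => hx (h3 hx')
  have i1 : Integrable (fun x => conj (F x) * testSchwartz _ h1' h2' x) :=
    (Lp.memLp F).star.integrable_mul (p := 2) (q := 2) ((testSchwartz _ h1' h2').memLp 2 volume)
  rw [integral_eq_add_inv i1] at e1
  have e2 : ∫ z in freeSurface, conj (F z) * testSchwartz _ h1' h2' z = 0 := by
    refine (setIntegral_congr_fun measurableSet_freeSurface (g := fun _ => 0)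
      fun z hz => ?_).trans (by simp)
    have : g z⁻¹ = 0 := hz0 _ fun h' => absurd (abs_inv_lt_one hz) (not_lt.2 (le_of_lt h'))
    simp [this]
  have e3 : ∫ x, conj (F' x) * testSchwartz g h1 h2 x
      = ∫ z in freeSurface, conj (F' z) * testSchwartz g h1 h2 z := by
    rw [setIntegral_eq_integral_of_forall_compl_eq_zero]
    intro x hx
    simp [hz0 x hx]
  rw [e2, zero_add, e3] at e1
  have hg : MemLp (fun z => (g z : ℂ)) 2 surfaceMeasure :=
    ((testSchwartz g h1 h2).memLp 2 volume).restrict freeSurface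
  have j1 : Integrable (fun z => conj ((((z ^ 2)⁻¹ : ℝ) : ℂ) * F z⁻¹) * (g z : ℂ)) surfaceMeasure :=
    hW.star.integrable_mul (p := 2) (q := 2) hg
  have j2 : Integrable (fun z => conj (F' z) * (g z : ℂ)) surfaceMeasure :=
    hFE.star.integrable_mul (p := 2) (q := 2) hg
  have e4 : ∫ z in freeSurface, g z • conj ((((z ^ 2)⁻¹ : ℝ) : ℂ) * F z⁻¹ - F' z)
      = (∫ z in freeSurface, conj ((((z ^ 2)⁻¹ : ℝ) : ℂ) * F z⁻¹) * (g z : ℂ))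
        - ∫ z in freeSurface, conj (F' z) * (g z : ℂ) := by
    rw [← integral_sub j1 j2]
    refine integral_congr_ae (Eventually.of_forall fun z => ?_)
    simp only [map_sub, Complex.real_smul]
    ring
  rw [← setIntegral_eq_integral_of_forall_compl_eq_zero (s := freeSurface)
    (fun x hx => by rw [hz0 x hx, zero_smul]), e4, sub_eq_zero]
  rw [← show (∫ z in freeSurface, conj (F' z) * testSchwartz g h1 h2 z)
    = ∫ z in freeSurface, conj (F' z) * (g z : ℂ) from rfl, ← e1]
  refine setIntegral_congr_fun measurableSet_freeSurface fun z hz => ?_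
  simp only [testSchwartz_apply, inv_inv, map_mul, Complex.conj_ofReal]
  ring

end Covariance

section Cutoff

lemma deriv_smoothTransition_of_neg {t : ℝ} (ht : t < 0) : deriv Real.smoothTransition t = 0 := by
  have : Real.smoothTransition =ᶠ[𝓝 t] fun _ => 0 := by
    filter_upwards [Iio_mem_nhds ht] with x hx
    exact Real.smoothTransition.zero_of_nonpos (le_of_lt hx)
  rw [this.deriv_eq, deriv_const]

lemma deriv_smoothTransition_of_one_lt {t : ℝ} (ht : 1 < t) :
    deriv Real.smoothTransition t = 0 := by
  have : Real.smoothTransition =ᶠ[𝓝 t] fun _ => 1 := by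
    filter_upwards [Ioi_mem_nhds ht] with x hx
    exact Real.smoothTransition.one_of_one_le (le_of_lt hx)
  rw [this.deriv_eq, deriv_const]

lemma exists_bound_deriv_smoothTransition :
    ∃ M : ℝ, 0 ≤ M ∧ ∀ t, |deriv Real.smoothTransition t| ≤ M := by
  have hc : Continuous (deriv Real.smoothTransition) :=
    (Real.smoothTransition.contDiff (n := 1)).continuous_deriv le_rfl
  obtain ⟨M, hM⟩ := (isCompact_Icc (a := (0 : ℝ)) (b := 1)).exists_bound_of_continuousOn
    hc.continuousOn
  refine ⟨|M|, abs_nonneg _, fun t => ?_⟩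
  by_cases ht : t ∈ Set.Icc (0 : ℝ) 1
  · exact (hM t ht).trans (le_abs_self M)
  · have : deriv Real.smoothTransition t = 0 := by
      rcases lt_or_ge t 0 with h | h
      · exact deriv_smoothTransition_of_neg h
      · exact deriv_smoothTransition_of_one_lt (not_le.1 fun h' => ht ⟨h, h'⟩)
    rw [this, abs_zero]
    exact abs_nonneg _

lemma hasDerivAt_smoothTransition (t : ℝ) :
    HasDerivAt Real.smoothTransition (deriv Real.smoothTransition t) t :=
  ((Real.smoothTransition.contDiff (n := 1)).differentiable one_ne_zero t).hasDerivAt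

/-- A cut-off vanishing near `[-1, 1]`. -/
def innerCutoff (n : ℕ) (z : ℝ) : ℝ := Real.smoothTransition ((n + 1) * (z ^ 2 - 1) - 1)

/-- A cut-off vanishing near infinity. -/
def outerCutoff (n : ℕ) (z : ℝ) : ℝ := Real.smoothTransition (2 - z ^ 2 / (n + 1))

/-- The derivative of the inner cut-off. -/
def innerCutoffDeriv (n : ℕ) (z : ℝ) : ℝ :=
  deriv Real.smoothTransition ((n + 1) * (z ^ 2 - 1) - 1) * ((n + 1) * (2 * z))

/-- The derivative of the outer cut-off. -/
def outerCutoffDeriv (n : ℕ) (z : ℝ) : ℝ :=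
  deriv Real.smoothTransition (2 - z ^ 2 / (n + 1)) * (-(2 * z / (n + 1)))

lemma hasDerivAt_innerCutoff (n : ℕ) (z : ℝ) :
    HasDerivAt (innerCutoff n) (innerCutoffDeriv n z) z := by
  have h1 : HasDerivAt (fun z : ℝ => ((n : ℝ) + 1) * (z ^ 2 - 1) - 1) ((n + 1) * (2 * z)) z := by
    simpa using (((hasDerivAt_pow 2 z).sub_const 1).const_mul ((n : ℝ) + 1)).sub_const 1
  exact (hasDerivAt_smoothTransition _).comp z h1

lemma hasDerivAt_outerCutoff (n : ℕ) (z : ℝ) :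
    HasDerivAt (outerCutoff n) (outerCutoffDeriv n z) z := by
  have h1 : HasDerivAt (fun z : ℝ => 2 - z ^ 2 / ((n : ℝ) + 1)) (-(2 * z / (n + 1))) z := by
    simpa using ((hasDerivAt_pow 2 z).div_const ((n : ℝ) + 1)).const_sub 2
  exact (hasDerivAt_smoothTransition _).comp z h1

lemma contDiff_innerCutoff (n : ℕ) : ContDiff ℝ ∞ (innerCutoff n) :=
  Real.smoothTransition.contDiff.comp (by fun_prop)

lemma contDiff_outerCutoff (n : ℕ) : ContDiff ℝ ∞ (outerCutoff n) :=
  Real.smoothTransition.contDiff.comp (by fun_prop)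

lemma abs_smoothTransition_le (t : ℝ) : |Real.smoothTransition t| ≤ 1 := by
  rw [abs_of_nonneg (Real.smoothTransition.nonneg t)]; exact Real.smoothTransition.le_one t

lemma continuous_deriv_smoothTransition : Continuous (deriv Real.smoothTransition) :=
  (Real.smoothTransition.contDiff (n := 1)).continuous_deriv le_rfl

lemma measurable_outerCutoffDeriv (n : ℕ) : Measurable (outerCutoffDeriv n) := by
  have := continuous_deriv_smoothTransition
  unfold outerCutoffDeriv
  fun_prop

lemma innerCutoffDeriv_bound {M : ℝ} (hM0 : 0 ≤ M)
    (hM : ∀ t, |deriv Real.smoothTransition t| ≤ M) (n : ℕ) {z : ℝ} (hz : z ∈ freeSurface) :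
    (|z| - 1) * |innerCutoffDeriv n z| ≤ 8 * M / |z| := by
  have hz1 : 1 < |z| := hz
  have hn : (0 : ℝ) < n + 1 := by positivity
  unfold innerCutoffDeriv
  set t := ((n : ℝ) + 1) * (z ^ 2 - 1) - 1 with ht
  by_cases h : t ≤ 1
  · rw [le_div_iff₀ (by linarith), abs_mul, abs_mul, abs_mul, abs_of_pos hn, abs_two]
    have h1 : ((n : ℝ) + 1) * (z ^ 2 - 1) ≤ 2 := by linarith
    have h2 : z ^ 2 = |z| ^ 2 := (sq_abs z).symm
    have h3 : |z| ≤ 2 := by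
      have : z ^ 2 - 1 ≤ ((n : ℝ) + 1) * (z ^ 2 - 1) := by
        have : 0 ≤ z ^ 2 - 1 := by rw [h2]; nlinarith
        have hn0 : (0 : ℝ) ≤ n := by positivity
        nlinarith
      rw [h2] at this h1
      nlinarith
    have h4 : (|z| - 1) * ((n + 1) * (2 * |z|)) ≤ 4 := by
      have h5 : (|z| - 1) * ((n + 1) * (|z| + 1)) ≤ 2 := by rw [h2] at h1; linarith
      have h6 : 0 ≤ (|z| - 1) * (n + 1) := mul_nonneg (by linarith) hn.le
      nlinarith
    have h7 : 0 ≤ (|z| - 1) * ((n + 1) * (2 * |z|)) :=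
      mul_nonneg (by linarith) (by positivity)
    calc _ = |deriv Real.smoothTransition t| * ((|z| - 1) * ((n + 1) * (2 * |z|))) * |z| := by ring
      _ ≤ M * 4 * 2 := by
        apply mul_le_mul _ h3 (by linarith) (by positivity)
        exact mul_le_mul (hM t) h4 h7 hM0
      _ = 8 * M := by ring
  · rw [deriv_smoothTransition_of_one_lt (not_le.1 h)]
    simp only [zero_mul, abs_zero, mul_zero]
    positivity

lemma outerCutoffDeriv_bound {M : ℝ} (hM0 : 0 ≤ M)
    (hM : ∀ t, |deriv Real.smoothTransition t| ≤ M) (n : ℕ) (z : ℝ) :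
    |outerCutoffDeriv n z| * |z| ≤ 4 * M ∧ |outerCutoffDeriv n z| ≤ 4 * M := by
  have hn : (0 : ℝ) < n + 1 := by positivity
  have hn1 : (1 : ℝ) ≤ n + 1 := by simp
  unfold outerCutoffDeriv
  set t := 2 - z ^ 2 / ((n : ℝ) + 1) with ht
  by_cases h : 0 ≤ t
  · have h1 : |z| ^ 2 ≤ 2 * (n + 1) := by
      rw [sq_abs, ← div_le_iff₀ hn]; linarith
    rw [abs_mul, abs_neg, abs_div, abs_mul, abs_of_pos hn, abs_two]
    constructor
    · have h2 : 2 * |z| / (n + 1) * |z| ≤ 4 := by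
        rw [div_mul_eq_mul_div, div_le_iff₀ hn]; nlinarith
      rw [mul_assoc]
      exact (mul_le_mul (hM t) h2 (by positivity) hM0).trans_eq (by ring)
    · have h2 : 2 * |z| / (n + 1) ≤ 4 := by
        rw [div_le_iff₀ hn]
        by_contra hc
        rw [not_le] at hc
        nlinarith
      exact (mul_le_mul (hM t) h2 (by positivity) hM0).trans_eq (by ring)
  · rw [deriv_smoothTransition_of_neg (not_le.1 h)]
    simp only [zero_mul, abs_zero]
    constructor <;> positivity

lemma eventually_innerCutoff {z : ℝ} (hz : z ∈ freeSurface) :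
    ∀ᶠ n : ℕ in atTop, innerCutoff n z = 1 ∧ innerCutoffDeriv n z = 0 := by
  have hz1 : 0 < z ^ 2 - 1 := sub_pos.2 ((one_lt_sq_iff_one_lt_abs z).2 hz)
  obtain ⟨N, hN⟩ := exists_nat_gt (2 / (z ^ 2 - 1))
  filter_upwards [eventually_ge_atTop N] with n hn
  have h1 : 2 < (n : ℝ) * (z ^ 2 - 1) := by
    rw [← div_lt_iff₀ hz1]
    exact hN.trans_le (by exact_mod_cast hn)
  have h2 : 1 < ((n : ℝ) + 1) * (z ^ 2 - 1) - 1 := by nlinarith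
  exact ⟨Real.smoothTransition.one_of_one_le h2.le,
    by rw [innerCutoffDeriv, deriv_smoothTransition_of_one_lt h2, zero_mul]⟩

lemma eventually_outerCutoff (z : ℝ) :
    ∀ᶠ n : ℕ in atTop, outerCutoff n z = 1 ∧ outerCutoffDeriv n z = 0 := by
  obtain ⟨N, hN⟩ := exists_nat_gt (z ^ 2)
  filter_upwards [eventually_ge_atTop N] with n hn
  have h1 : z ^ 2 < (n : ℝ) + 1 := by
    have : (N : ℝ) ≤ n := by exact_mod_cast hn
    linarith
  have h2 : 1 < 2 - z ^ 2 / ((n : ℝ) + 1) := by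
    have : z ^ 2 / ((n : ℝ) + 1) < 1 := (div_lt_one (by positivity)).2 h1
    linarith
  exact ⟨Real.smoothTransition.one_of_one_le h2.le,
    by rw [outerCutoffDeriv, deriv_smoothTransition_of_one_lt h2, zero_mul]⟩

lemma innerCutoff_eq_zero {n : ℕ} {z : ℝ} (h : z ^ 2 ≤ 1 + 1 / (n + 1)) : innerCutoff n z = 0 := by
  apply Real.smoothTransition.zero_of_nonpos
  have hn : (0 : ℝ) < n + 1 := by positivity
  have : ((n : ℝ) + 1) * (z ^ 2 - 1) ≤ (n + 1) * (1 / (n + 1)) := by gcongr; linarith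
  rw [mul_one_div_cancel hn.ne'] at this
  linarith

lemma outerCutoff_eq_zero {n : ℕ} {z : ℝ} (h : 2 * (n + 1) ≤ z ^ 2) : outerCutoff n z = 0 := by
  apply Real.smoothTransition.zero_of_nonpos
  have hn : (0 : ℝ) < n + 1 := by positivity
  have : 2 ≤ z ^ 2 / ((n : ℝ) + 1) := (le_div_iff₀ hn).2 h
  linarith

/-- A cut-off with compact support in `ℰ`. -/
def surfaceCutoff (n : ℕ) (z : ℝ) : ℝ := innerCutoff n z * outerCutoff n z

lemma hasCompactSupport_surfaceCutoff (n : ℕ) : HasCompactSupport (surfaceCutoff n) := by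
  refine HasCompactSupport.intro (isCompact_Icc (a := -(2 * ((n : ℝ) + 1)))
    (b := 2 * ((n : ℝ) + 1))) fun z hz => ?_
  have hn : (1 : ℝ) ≤ n + 1 := by simp
  have h1 : 2 * ((n : ℝ) + 1) < |z| := by
    by_contra hc; exact hz (abs_le.1 (not_lt.1 hc))
  rw [surfaceCutoff, outerCutoff_eq_zero, mul_zero]
  rw [← sq_abs]; nlinarith

lemma tsupport_surfaceCutoff_subset (n : ℕ) : tsupport (surfaceCutoff n) ⊆ freeSurface := by
  have hc : IsClosed {z : ℝ | 1 + 1 / ((n : ℝ) + 1) ≤ z ^ 2} :=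
    isClosed_le continuous_const (by fun_prop)
  refine (closure_minimal (fun z hz => ?_) hc).trans fun z hz => ?_
  · by_contra h
    exact hz (by rw [surfaceCutoff, innerCutoff_eq_zero (le_of_not_ge h), zero_mul])
  · have h1 : 1 + 1 / ((n : ℝ) + 1) ≤ z ^ 2 := hz
    have h2 : 0 < 1 / ((n : ℝ) + 1) := by positivity
    exact (one_lt_sq_iff_one_lt_abs z).1 (by linarith)

end Cutoff

section TestFunctions

lemma contDiff_re_im {φ : ℝ → ℂ} (h : ContDiff ℝ ∞ φ) :
    ContDiff ℝ ∞ (fun x => (φ x).re) ∧ ContDiff ℝ ∞ fun x => (φ x).im :=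
  ⟨Complex.reCLM.contDiff.comp h, Complex.imCLM.contDiff.comp h⟩

/-- Complex valued test functions in the definition of a weak derivative. -/
lemma IsWeakDeriv.complex {v w : L2E} (h : IsWeakDeriv v w) {φ : ℝ → ℂ} (h1 : ContDiff ℝ ∞ φ)
    (h2 : HasCompactSupport φ) (h3 : tsupport φ ⊆ freeSurface) :
    ∫ x in freeSurface, deriv φ x * v x = -∫ x in freeSurface, φ x * w x := by
  obtain ⟨hr, hi⟩ := contDiff_re_im h1
  have cr : HasCompactSupport fun x => (φ x).re := h2.comp_left (g := Complex.re) rfl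
  have ci : HasCompactSupport fun x => (φ x).im := h2.comp_left (g := Complex.im) rfl
  have tr : tsupport (fun x => (φ x).re) ⊆ freeSurface :=
    (closure_mono fun x hx => by
      intro h0; apply hx; simp [h0]).trans h3
  have ti : tsupport (fun x => (φ x).im) ⊆ freeSurface :=
    (closure_mono fun x hx => by
      intro h0; apply hx; simp [h0]).trans h3
  have er := h _ hr cr tr
  have ei := h _ hi ci ti
  have hd : ∀ x, deriv φ x = ((deriv (fun x => (φ x).re) x : ℝ) : ℂ)
      + Complex.I * ((deriv (fun x => (φ x).im) x : ℝ) : ℂ) := by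
    intro x
    have hx : HasDerivAt φ (deriv φ x) x := (h1.differentiable (by simp) x).hasDerivAt
    have a1 : HasDerivAt (fun x => (φ x).re) (deriv φ x).re x :=
      Complex.reCLM.hasFDerivAt.comp_hasDerivAt x hx
    have a2 : HasDerivAt (fun x => (φ x).im) (deriv φ x).im x :=
      Complex.imCLM.hasFDerivAt.comp_hasDerivAt x hx
    rw [a1.deriv, a2.deriv, mul_comm, Complex.re_add_im]
  have split : ∀ (a b : ℝ → ℝ) (u : L2E), Integrable (fun x => a x • u x) surfaceMeasure →
      Integrable (fun x => b x • u x) surfaceMeasure →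
      ∫ x in freeSurface, ((a x : ℂ) + Complex.I * (b x : ℂ)) * u x
        = (∫ x in freeSurface, a x • u x) + Complex.I * ∫ x in freeSurface, b x • u x := by
    intro a b u ha hb
    rw [← integral_const_mul, ← integral_add ha (hb.const_mul _)]
    refine integral_congr_ae (Eventually.of_forall fun x => ?_)
    simp only [Complex.real_smul]
    ring
  simp only [hd]
  rw [split _ _ _ (integrable_smul_of_test (hr.continuous_deriv (by simp)) cr.deriv v)
    (integrable_smul_of_test (hi.continuous_deriv (by simp)) ci.deriv v), er, ei]
  have e : ∫ x in freeSurface, φ x * w x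
      = ∫ x in freeSurface, (((φ x).re : ℂ) + Complex.I * ((φ x).im : ℂ)) * w x := by
    congr 1; ext x; rw [mul_comm Complex.I, Complex.re_add_im]
  rw [e, split _ _ _ (integrable_smul_of_test hr.continuous cr w)
    (integrable_smul_of_test hi.continuous ci w)]
  ring

lemma memLp_inv_abs : MemLp (fun z : ℝ => (((|z|)⁻¹ : ℝ) : ℂ)) 2 surfaceMeasure := by
  refine memLp_two_iff_lintegral.2 ⟨Measurable.aestronglyMeasurable (by fun_prop), ?_⟩
  have h1 := lintegral_eq_add_inv ((Set.Icc (-1) 1).indicator 1)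
  have h2 : ∫⁻ x : ℝ, (Set.Icc (-1 : ℝ) 1).indicator (1 : ℝ → ℝ≥0∞) x < ⊤ := by
    rw [lintegral_indicator_one measurableSet_Icc]
    simp
  rw [h1] at h2
  refine lt_of_le_of_lt ?_ (lt_of_le_of_lt le_add_self h2)
  refine setLIntegral_mono' measurableSet_freeSurface fun z hz => ?_
  have hz1 : z⁻¹ ∈ Set.Icc (-1 : ℝ) 1 := abs_le.1 (abs_inv_lt_one hz).le
  rw [Set.indicator_of_mem hz1, Pi.one_apply, mul_one, enorm_ofReal_complex,
    Real.enorm_eq_ofReal (by positivity), ← ENNReal.ofReal_pow (by positivity), inv_pow, sq_abs]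

lemma integrable_inv_abs_mul (v : L2E) :
    Integrable (fun z => (((|z|)⁻¹ : ℝ) : ℂ) * v z) surfaceMeasure :=
  memLp_inv_abs.integrable_mul (p := 2) (q := 2) (Lp.memLp v)

/-- Integration by parts on `ℰ` against functions vanishing at `±1`. -/
lemma IsWeakDeriv.integral_eq {v w : L2E} (h : IsWeakDeriv v w) {θ θ' : ℝ → ℂ}
    (hsm : ∀ z ∈ freeSurface, ContDiffAt ℝ ∞ θ z)
    (hd : ∀ z ∈ freeSurface, HasDerivAt θ (θ' z) z) {C : ℝ}
    (hC1 : ∀ z ∈ freeSurface, ‖θ z‖ ≤ C * (|z| - 1)) (hC2 : ∀ z ∈ freeSurface, ‖θ z‖ ≤ C)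
    (hi1 : Integrable (fun z => θ' z * v z) surfaceMeasure)
    (hi2 : Integrable (fun z => θ z * w z) surfaceMeasure) :
    ∫ z in freeSurface, θ' z * v z = -∫ z in freeSurface, θ z * w z := by
  obtain ⟨M, hM0, hM⟩ := exists_bound_deriv_smoothTransition
  let κ := fun (n : ℕ) (z : ℝ) => (surfaceCutoff n z : ℂ)
  let κ' := fun (n : ℕ) (z : ℝ) =>
    ((innerCutoffDeriv n z * outerCutoff n z + innerCutoff n z * outerCutoffDeriv n z : ℝ) : ℂ)
  have hκd : ∀ n z, HasDerivAt (κ n) (κ' n z) z := fun n z =>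
    ((hasDerivAt_innerCutoff n z).mul (hasDerivAt_outerCutoff n z)).ofReal_comp
  have hκsm : ∀ n, ContDiff ℝ ∞ (κ n) := fun n =>
    Complex.ofRealCLM.contDiff.comp ((contDiff_innerCutoff n).mul (contDiff_outerCutoff n))
  have hκ1 : ∀ n z, ‖κ n z‖ ≤ 1 := fun n z => by
    simp only [κ, surfaceCutoff, Complex.norm_real, Real.norm_eq_abs, abs_mul]
    exact mul_le_one₀ (abs_smoothTransition_le _) (abs_nonneg _) (abs_smoothTransition_le _)
  have hC0 : 0 ≤ C := (norm_nonneg _).trans (hC2 2 (by simp [freeSurface]))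
  have hsupp : ∀ n, tsupport (fun z => θ z * κ n z) ⊆ tsupport (surfaceCutoff n) := fun n =>
    closure_mono fun z hz h0 => hz (by simp [κ, h0])
  have key : ∀ n, ∫ z in freeSurface, (θ' z * κ n z + θ z * κ' n z) * v z
      = -∫ z in freeSurface, (θ z * κ n z) * w z := by
    intro n
    rw [← h.complex (φ := fun z => θ z * κ n z)]
    · refine setIntegral_congr_fun measurableSet_freeSurface fun z hz => ?_
      rw [show deriv (fun z => θ z * κ n z) z = θ' z * κ n z + θ z * κ' n z from
        ((hd z hz).mul (hκd n z)).deriv]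
    · refine contDiff_iff_contDiffAt.2 fun z => ?_
      by_cases hz : z ∈ freeSurface
      · exact (hsm z hz).mul (hκsm n).contDiffAt
      · have hz' : z ∉ tsupport fun z => θ z * κ n z := fun h' =>
          hz (tsupport_surfaceCutoff_subset n (hsupp n h'))
        exact contDiffAt_const.congr_of_eventuallyEq (notMem_tsupport_iff_eventuallyEq.1 hz')
    · exact (hasCompactSupport_surfaceCutoff n).of_isClosed_subset (isClosed_tsupport _) (hsupp n)
    · exact (hsupp n).trans (tsupport_surfaceCutoff_subset n)
  have hmeas : AEStronglyMeasurable θ surfaceMeasure :=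
    ContinuousOn.aestronglyMeasurable (fun z hz => (hd z hz).continuousAt.continuousWithinAt)
      measurableSet_freeSurface
  have hκm : ∀ n, AEStronglyMeasurable (κ n) surfaceMeasure := fun n =>
    (hκsm n).continuous.aestronglyMeasurable
  have hκm' : ∀ n, AEStronglyMeasurable (κ' n) surfaceMeasure := fun n => by
    have h1 : κ' n = deriv (κ n) := funext fun z => (hκd n z).deriv.symm
    rw [h1]
    exact ((hκsm n).continuous_deriv (by simp)).aestronglyMeasurable
  have hvm := (Lp.memLp v).1
  have lim1 : Tendsto (fun n => ∫ z in freeSurface, (θ' z * κ n z + θ z * κ' n z) * v z) atTop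
      (𝓝 (∫ z in freeSurface, θ' z * v z)) := by
    refine tendsto_integral_of_dominated_convergence
      (fun z => ‖θ' z * v z‖ + 12 * C * M * ‖(((|z|)⁻¹ : ℝ) : ℂ) * v z‖) (fun n => ?_)
      (hi1.norm.add ((integrable_inv_abs_mul v).norm.const_mul _)) (fun n => ?_) ?_
    · refine ((hi1.1.mul (hκm n)).add ((hmeas.mul (hκm' n)).mul hvm)).congr
        (Eventually.of_forall fun z => ?_)
      simp only [Pi.add_apply, Pi.mul_apply]
      ring
    · filter_upwards [ae_mem_freeSurface] with z hz
      have hz1 : 1 < |z| := hz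
      have b1 : ‖θ z * κ' n z‖ ≤ 12 * C * M * (|z|)⁻¹ := by
        rw [norm_mul, Complex.norm_real, Real.norm_eq_abs]
        have c1 := innerCutoffDeriv_bound hM0 hM n hz
        have c2 := (outerCutoffDeriv_bound hM0 hM n z).1
        rw [← le_div_iff₀ (by linarith)] at c2
        have c3 : |innerCutoffDeriv n z * outerCutoff n z + innerCutoff n z * outerCutoffDeriv n z|
            ≤ |innerCutoffDeriv n z| + |outerCutoffDeriv n z| := by
          refine (abs_add_le _ _).trans (add_le_add ?_ ?_)
          · rw [abs_mul]
            exact mul_le_of_le_one_right (abs_nonneg _) (abs_smoothTransition_le _)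
          · rw [abs_mul]
            exact mul_le_of_le_one_left (abs_nonneg _) (abs_smoothTransition_le _)
        calc _ ≤ ‖θ z‖ * (|innerCutoffDeriv n z| + |outerCutoffDeriv n z|) := by gcongr
          _ = ‖θ z‖ * |innerCutoffDeriv n z| + ‖θ z‖ * |outerCutoffDeriv n z| := mul_add _ _ _
          _ ≤ C * (|z| - 1) * |innerCutoffDeriv n z| + C * (4 * M / |z|) := by
              gcongr
              · exact hC1 z hz
              · exact hC2 z hz
          _ ≤ C * (8 * M / |z|) + C * (4 * M / |z|) := by
              rw [mul_assoc]; gcongr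
          _ = _ := by field_simp; ring
      rw [add_mul]
      refine (norm_add_le _ _).trans (add_le_add ?_ ?_)
      · rw [mul_right_comm, norm_mul]
        exact mul_le_of_le_one_right (norm_nonneg _) (hκ1 n z)
      · have e : ‖(((|z|)⁻¹ : ℝ) : ℂ)‖ = (|z|)⁻¹ := by simp
        rw [norm_mul (θ z * κ' n z), norm_mul _ (v z), e, ← mul_assoc]
        gcongr
    · filter_upwards [ae_mem_freeSurface] with z hz
      apply tendsto_const_nhds.congr'
      filter_upwards [eventually_innerCutoff hz, eventually_outerCutoff z] with n c1 c2
      simp only [κ, κ', surfaceCutoff, c1.1, c1.2, c2.1, c2.2]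
      simp
  have lim2 : Tendsto (fun n => -∫ z in freeSurface, (θ z * κ n z) * w z) atTop
      (𝓝 (-∫ z in freeSurface, θ z * w z)) := by
    refine (tendsto_integral_of_dominated_convergence (fun z => ‖θ z * w z‖) (fun n => ?_)
      hi2.norm (fun n => ?_) ?_).neg
    · exact ((hmeas.mul (hκm n)).mul (Lp.memLp w).1)
    · refine Eventually.of_forall fun z => ?_
      rw [mul_right_comm, norm_mul]
      exact mul_le_of_le_one_right (norm_nonneg _) (hκ1 n z)
    · filter_upwards [ae_mem_freeSurface] with z hz
      apply tendsto_const_nhds.congr'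
      filter_upwards [eventually_innerCutoff hz, eventually_outerCutoff z] with n c1 c2
      simp [κ, surfaceCutoff, c1.1, c2.1]
  simp only [key] at lim1
  exact tendsto_nhds_unique lim1 lim2

end TestFunctions

section WeakDerivExtension

lemma integrable_inv_weight {F : ℝ → ℂ} (hF : Integrable F) :
    Integrable (fun z => (((z ^ 2)⁻¹ : ℝ) : ℂ) * F z⁻¹) surfaceMeasure := by
  have h1 := (integrableOn_image_iff_integrableOn_abs_deriv_smul measurableSet_freeSurface
    hasDerivWithinAt_inv_freeSurface inv_injective.injOn F).1 hF.integrableOn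
  simp only [abs_neg, abs_inv, abs_pow, sq_abs, Complex.real_smul] at h1
  exact h1

lemma abs_sub_inv_le {z : ℝ} (hz : z ∈ freeSurface) : |z - z⁻¹| ≤ 2 * (|z| - 1) := by
  have hz1 : 1 < |z| := hz
  have hz0 := ne_zero_of_mem_freeSurface hz
  have e : z - z⁻¹ = (z ^ 2 - 1) / z := by field_simp
  have h2 : |z ^ 2 - 1| = |z| ^ 2 - 1 := by
    rw [← sq_abs z, abs_of_nonneg]; nlinarith
  rw [e, abs_div, h2, div_le_iff₀ (by linarith)]
  nlinarith

lemma norm_sub_inv_le {ψ ψ' : ℝ → ℂ} (hψ : ∀ x, HasDerivAt ψ (ψ' x) x) {B : ℝ}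
    (hB : ∀ x, ‖ψ' x‖ ≤ B) {z : ℝ} (hz : z ∈ freeSurface) :
    ‖ψ z - ψ z⁻¹‖ ≤ 2 * B * (|z| - 1) := by
  have h1 := convex_univ.norm_image_sub_le_of_norm_hasDerivWithin_le
    (fun x _ => (hψ x).hasDerivWithinAt) (fun x _ => hB x) (Set.mem_univ z⁻¹) (Set.mem_univ z)
  have hB0 : 0 ≤ B := (norm_nonneg _).trans (hB 0)
  calc _ ≤ B * ‖z - z⁻¹‖ := h1
    _ ≤ B * (2 * (|z| - 1)) := by
        gcongr; exact abs_sub_inv_le hz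
    _ = _ := by ring

lemma hasDerivAt_comp_inv {ψ : ℝ → ℂ} {d : ℂ} {z : ℝ} (hz : z ≠ 0) (h : HasDerivAt ψ d z⁻¹) :
    HasDerivAt (fun x => ψ x⁻¹) (-(((z ^ 2)⁻¹ : ℝ) : ℂ) * d) z := by
  have h1 := HasDerivAt.scomp z h (hasDerivAt_inv hz)
  simpa [Function.comp_def] using h1

/-- The weak derivative of `ρ η(v)` on the real line. -/
lemma IsWeakDeriv.hasWeakDerivR {v w : L2E} (h : IsWeakDeriv v w) {ρ ρ' : ℝ → ℂ}
    (hρ : ContDiff ℝ ∞ ρ) (hρ' : ∀ x, HasDerivAt ρ (ρ' x) x) {C : ℝ} (hC : ∀ x, ‖ρ x‖ ≤ C)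
    (hC' : ∀ x, ‖ρ' x‖ ≤ C) (hc : IsCoeff ρ) {f' : L2R}
    (h1 : ∀ᵐ z ∂surfaceMeasure, f' z = ρ' z * v z + ρ z * w z)
    (h2 : ∀ᵐ z ∂surfaceMeasure, f' z⁻¹ = ρ' z⁻¹ * v z - (z : ℂ) ^ 2 * ρ z⁻¹ * w z) :
    HasWeakDerivR (extOp ρ hc v) f' := by
  intro φ
  let φ₁ : 𝓢(ℝ, ℂ) := SchwartzMap.derivCLM ℂ ℂ φ
  have hφ₁ : ∀ x, deriv φ x = φ₁ x := fun x => rfl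
  let ψ : ℝ → ℂ := fun x => ρ x * φ x
  let ψ' : ℝ → ℂ := fun x => ρ' x * φ x + ρ x * φ₁ x
  have hψ : ∀ x, HasDerivAt ψ (ψ' x) x := fun x => (hρ' x).mul (φ.hasDerivAt x)
  have hψsm : ContDiff ℝ ∞ ψ := hρ.mul (φ.smooth ⊤)
  have hρm : Measurable ρ' := by
    have : ρ' = deriv ρ := funext fun x => (hρ' x).deriv.symm
    rw [this]; exact measurable_deriv ρ
  have hC0 : 0 ≤ C := (norm_nonneg _).trans (hC 0)
  obtain ⟨B, hB, hB'⟩ : ∃ B, (∀ x, ‖ψ x‖ ≤ B) ∧ ∀ x, ‖ψ' x‖ ≤ B := by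
    have b0 := fun x => φ.toBoundedContinuousFunction.norm_coe_le_norm x
    have b1 := fun x => φ₁.toBoundedContinuousFunction.norm_coe_le_norm x
    refine ⟨C * ‖φ.toBoundedContinuousFunction‖ + C * ‖φ₁.toBoundedContinuousFunction‖,
      fun x => ?_, fun x => ?_⟩
    · rw [norm_mul]
      exact (mul_le_mul (hC x) (b0 x) (norm_nonneg _) hC0).trans
        (le_add_of_nonneg_right (by positivity))
    · refine (norm_add_le _ _).trans (add_le_add ?_ ?_)
      · rw [norm_mul]; exact mul_le_mul (hC' x) (b0 x) (norm_nonneg _) hC0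
      · rw [norm_mul]; exact mul_le_mul (hC x) (b1 x) (norm_nonneg _) hC0
  have hB0 : 0 ≤ B := (norm_nonneg _).trans (hB 0)
  have hbρ : IsBddMeas ρ := ⟨hρ.continuous.measurable, C, hC⟩
  have hbρ' : IsBddMeas ρ' := ⟨hρm, C, hC'⟩
  let η := etaOp v
  have iη : ∀ (b : ℝ → ℂ), IsBddMeas b → ∀ χ : 𝓢(ℝ, ℂ),
      Integrable fun x => b x * (χ x * η x) := fun b hb χ =>
    (integrable_schwartz_mul χ η).bdd_mul hb.1.aestronglyMeasurable
      (Eventually.of_forall hb.2.choose_spec)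
  have iA : Integrable fun x => ψ' x * η x :=
    ((iη ρ' hbρ' φ).add (iη ρ hbρ φ₁)).congr (Eventually.of_forall fun x => by
      simp only [Pi.add_apply, ψ']; ring)
  have iB : Integrable fun x => φ x * f' x - φ x * (ρ' x * η x) :=
    ((integrable_schwartz_mul φ f').sub (iη ρ' hbρ' φ)).congr (Eventually.of_forall fun x => by
      simp only [Pi.sub_apply]; ring)
  have hη1 : ∀ᵐ z ∂surfaceMeasure, η z = v z := by
    filter_upwards [coeFn_extOp_surface isCoeff_one v] with z hz
    exact hz.trans (one_mul _)
  have hη2 : ∀ᵐ z ∂surfaceMeasure, η z⁻¹ = v z := by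
    filter_upwards [coeFn_extOp_inv isCoeff_one v] with z hz
    exact hz.trans (one_mul _)
  have i3 : Integrable fun x => φ x * (ρ' x * η x) :=
    (iη ρ' hbρ' φ).congr (Eventually.of_forall fun x => by ring)
  have jA := iA.restrict (s := freeSurface).add (integrable_inv_weight iA)
  have jB := iB.restrict (s := freeSurface).add (integrable_inv_weight iB)
  let θ : ℝ → ℂ := fun z => ψ z - ψ z⁻¹
  let θ' : ℝ → ℂ := fun z => ψ' z + (((z ^ 2)⁻¹ : ℝ) : ℂ) * ψ' z⁻¹
  have eA : (fun z => θ' z * v z) =ᵐ[surfaceMeasure] fun z => ψ' z * η z +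
      (((z ^ 2)⁻¹ : ℝ) : ℂ) * (ψ' z⁻¹ * η z⁻¹) := by
    filter_upwards [hη1, hη2] with z k1 k2
    rw [k1, k2]; simp only [θ']; ring
  have eB : (fun z => θ z * w z) =ᵐ[surfaceMeasure] fun z =>
      (φ z * f' z - φ z * (ρ' z * η z)) +
      (((z ^ 2)⁻¹ : ℝ) : ℂ) * (φ z⁻¹ * f' z⁻¹ - φ z⁻¹ * (ρ' z⁻¹ * η z⁻¹)) := by
    filter_upwards [hη1, hη2, h1, h2, ae_mem_freeSurface] with z k1 k2 k3 k4 hz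
    rw [k1, k2, k3, k4]
    have hz0 : (z : ℂ) ≠ 0 := by exact_mod_cast ne_zero_of_mem_freeSurface hz
    simp only [θ, ψ]
    push_cast
    field_simp
    ring
  have key := h.integral_eq (θ := θ) (θ' := θ') (C := 2 * B)
    (fun z hz => hψsm.contDiffAt.sub
      (hψsm.contDiffAt.comp z (contDiffAt_inv ℝ (ne_zero_of_mem_freeSurface hz))))
    (fun z hz => by
      refine ((hψ z).sub (hasDerivAt_comp_inv (ne_zero_of_mem_freeSurface hz)
        (hψ z⁻¹))).congr_deriv ?_
      simp only [θ']; ring)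
    (fun z hz => norm_sub_inv_le hψ hB' hz)
    (fun z _ => (norm_sub_le _ _).trans (by linarith [hB z, hB z⁻¹]))
    (jA.congr eA.symm) (jB.congr eB.symm)
  rw [integral_congr_ae eA, integral_congr_ae eB,
    integral_add iA.restrict (integrable_inv_weight iA),
    integral_add iB.restrict (integrable_inv_weight iB), ← integral_eq_add_inv iA,
    ← integral_eq_add_inv iB, integral_sub (integrable_schwartz_mul φ f') i3] at key
  have eA2 : ∫ x, ψ' x * η x = (∫ x, φ x * (ρ' x * η x)) + ∫ x, deriv φ x * extOp ρ hc v x := by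
    simp only [hφ₁]
    rw [← integral_add i3 (integrable_schwartz_mul φ₁ (extOp ρ hc v))]
    refine integral_congr_ae ?_
    filter_upwards [coeFn_extOp hc v, coeFn_etaOp v] with x k1 k2
    simp only [ψ', η, k1, k2]
    ring
  rw [eA2] at key
  linear_combination key

/-- The weak derivative of an element of `W^{1,2}(ℰ)`. -/
def oneDeriv : sobolevOne →L[ℂ] L2E := (WithLp.sndL 2 ℂ L2E L2E).comp sobolevOne.subtypeL

lemma isWeakDeriv_oneDeriv (p : sobolevOne) : IsWeakDeriv (oneToL2 p) (oneDeriv p) := p.2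

lemma one_norm_sq (p : sobolevOne) : ‖p‖ ^ 2 = ‖oneToL2 p‖ ^ 2 + ‖oneDeriv p‖ ^ 2 :=
  WithLp.prod_norm_sq_eq_of_L2 p.1

/-- The derivative of the cut-off `x / (x + i)`. -/
def cutCoeffDeriv (x : ℝ) : ℂ := Complex.I * resCoeff x ^ 2

lemma hasDerivAt_cutCoeff (x : ℝ) : HasDerivAt cutCoeff (cutCoeffDeriv x) x := by
  have h0 := add_I_ne_zero x
  have h1 : HasDerivAt (fun x : ℝ => (x : ℂ)) 1 x := Complex.ofRealCLM.hasDerivAt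
  have h2 := h1.mul ((h1.add_const Complex.I).inv h0)
  refine h2.congr_deriv ?_
  rw [cutCoeffDeriv, resCoeff, Pi.inv_apply]
  field_simp
  ring

lemma contDiff_cutCoeff : ContDiff ℝ ∞ cutCoeff := by
  have h1 : ContDiff ℝ ∞ (fun x : ℝ => (x : ℂ)) := Complex.ofRealCLM.contDiff
  exact h1.mul ((h1.add contDiff_const).inv add_I_ne_zero)

lemma norm_cutCoeffDeriv_le (x : ℝ) : ‖cutCoeffDeriv x‖ ≤ 1 := by
  rw [cutCoeffDeriv, norm_mul, Complex.norm_I, one_mul, norm_pow]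
  exact pow_le_one₀ (norm_nonneg _) (norm_resCoeff_le x)

lemma IsBddMeas.isCoeff {b : ℝ → ℂ} (hb : IsBddMeas b) : IsCoeff b := by
  obtain ⟨hm, C, hC⟩ := hb
  refine ⟨hm, C, fun z hz => ⟨hC z, (hC _).trans ?_⟩⟩
  exact le_mul_of_one_le_right ((norm_nonneg _).trans (hC 0)) (le_of_lt hz)

lemma isCoeff_cutCoeff : IsCoeff cutCoeff := isBddMeas_cutCoeff.isCoeff

lemma isCoeff_cutCoeffDeriv : IsCoeff cutCoeffDeriv :=
  IsBddMeas.isCoeff ⟨by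
    have := continuous_resCoeff
    unfold cutCoeffDeriv; fun_prop, 1, norm_cutCoeffDeriv_le⟩

lemma mulOp_etaOp {b : ℝ → ℂ} (hb : IsBddMeas b) (hc : IsCoeff b) (v : L2E) :
    mulOp b hb (etaOp v) = extOp b hc v := by
  apply Lp.ext
  filter_upwards [coeFn_mulOp hb (etaOp v), coeFn_etaOp v, coeFn_extOp hc v] with x h1 h2 h3
  rw [h1, h2, h3]

/-- The coefficient equal to `ρ` on `ℰ` and to `-ρ / x²` inside. -/
def derivCoeff (ρ : ℝ → ℂ) (x : ℝ) : ℂ :=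
  if 1 < |x| then ρ x else -((((x ^ 2)⁻¹ : ℝ) : ℂ) * ρ x)

lemma derivCoeff_surface (ρ : ℝ → ℂ) {z : ℝ} (hz : z ∈ freeSurface) : derivCoeff ρ z = ρ z :=
  if_pos hz

lemma derivCoeff_inv (ρ : ℝ → ℂ) {z : ℝ} (hz : z ∈ freeSurface) :
    derivCoeff ρ z⁻¹ = -((z : ℂ) ^ 2 * ρ z⁻¹) := by
  rw [derivCoeff, if_neg (abs_inv_lt_one hz).le.not_gt]
  simp

lemma measurable_derivCoeff {ρ : ℝ → ℂ} (h : Measurable ρ) : Measurable (derivCoeff ρ) :=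
  Measurable.ite measurableSet_freeSurface h (by fun_prop)

lemma isCoeff_derivCoeff_cutCoeff : IsCoeff (derivCoeff cutCoeff) := by
  refine ⟨measurable_derivCoeff continuous_cutCoeff.measurable, 1, fun z hz => ⟨?_, ?_⟩⟩
  · rw [derivCoeff_surface _ hz]; exact norm_cutCoeff_le z
  · rw [derivCoeff_inv _ hz, norm_neg, norm_mul, norm_pow, Complex.norm_real, Real.norm_eq_abs,
      one_mul]
    have hz1 : 0 < |z| := lt_trans one_pos hz
    calc |z| ^ 2 * ‖cutCoeff z⁻¹‖ ≤ |z| ^ 2 * |z⁻¹| := by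
          gcongr; exact norm_cutCoeff_le_abs _
      _ = |z| := by rw [abs_inv]; field_simp

/-- The derivative of `x / (x + i) η(w)` for `w ∈ W^{1,2}(ℰ)`. -/
def cutDerivOp : sobolevOne →L[ℂ] L2R :=
  extOp _ isCoeff_cutCoeffDeriv ∘L oneToL2 + extOp _ isCoeff_derivCoeff_cutCoeff ∘L oneDeriv

lemma hasWeakDerivR_cutDerivOp (p : sobolevOne) :
    HasWeakDerivR (extOp _ isCoeff_cutCoeff (oneToL2 p)) (cutDerivOp p) := by
  have h0 : cutDerivOp p =ᵐ[volume] fun x => extOp _ isCoeff_cutCoeffDeriv (oneToL2 p) x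
      + extOp _ isCoeff_derivCoeff_cutCoeff (oneDeriv p) x := Lp.coeFn_add _ _
  refine (isWeakDeriv_oneDeriv p).hasWeakDerivR contDiff_cutCoeff hasDerivAt_cutCoeff
    norm_cutCoeff_le norm_cutCoeffDeriv_le isCoeff_cutCoeff ?_ ?_
  · filter_upwards [ae_surface_of_ae h0, coeFn_extOp_surface isCoeff_cutCoeffDeriv (oneToL2 p),
      coeFn_extOp_surface isCoeff_derivCoeff_cutCoeff (oneDeriv p), ae_mem_freeSurface]
      with z h1 h2 h3 hz
    rw [h1, h2, h3, derivCoeff_surface _ hz]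
  · filter_upwards [ae_surface_inv_of_ae h0, coeFn_extOp_inv isCoeff_cutCoeffDeriv (oneToL2 p),
      coeFn_extOp_inv isCoeff_derivCoeff_cutCoeff (oneDeriv p), ae_mem_freeSurface]
      with z h1 h2 h3 hz
    rw [h1, h2, h3, derivCoeff_inv _ hz]
    ring

/-- The coefficient equal to `1 / x` on `ℰ` and to `-1 / x` inside. -/
def signedInv (x : ℝ) : ℂ := if 1 < |x| then (x : ℂ)⁻¹ else -(x : ℂ)⁻¹

lemma isCoeff_signedInv : IsCoeff signedInv := by
  refine ⟨Measurable.ite measurableSet_freeSurface (by fun_prop) (by fun_prop), 1, fun z hz => ?_⟩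
  have hz1 : 1 < |z| := hz
  rw [signedInv, if_pos hz1, signedInv, if_neg (abs_inv_lt_one hz).le.not_gt]
  refine ⟨?_, by simp⟩
  rw [norm_inv, Complex.norm_real]
  exact inv_le_one_of_one_le₀ hz1.le

/-- If `x w'` is square integrable, then `η(w)` is in `W^{1,2}(ℝ)`. -/
lemma exists_isDtN_etaOp {p : sobolevOne}
    (h : MemLp (fun z : ℝ => (z : ℂ) * oneDeriv p z) 2 surfaceMeasure) :
    ∃ F, IsDtN (etaOp (oneToL2 p)) F := by
  refine ⟨_, HasWeakDerivR.isDtN (f' := extOp _ isCoeff_signedInv (h.toLp _)) ?_⟩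
  refine (isWeakDeriv_oneDeriv p).hasWeakDerivR (ρ := fun _ => 1) (ρ' := fun _ => 0) (C := 1)
    contDiff_const (fun x => hasDerivAt_const x 1) (by simp) (by simp) isCoeff_one ?_ ?_
  · filter_upwards [coeFn_extOp_surface isCoeff_signedInv (h.toLp _), h.coeFn_toLp,
      ae_mem_freeSurface] with z h1 h2 hz
    have hz0 : (z : ℂ) ≠ 0 := by exact_mod_cast ne_zero_of_mem_freeSurface hz
    have hz1 : 1 < |z| := hz
    rw [h1, h2, signedInv, if_pos hz1]
    field_simp
    ring
  · filter_upwards [coeFn_extOp_inv isCoeff_signedInv (h.toLp _), h.coeFn_toLp,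
      ae_mem_freeSurface] with z h1 h2 hz
    rw [h1, h2, signedInv, if_neg (abs_inv_lt_one hz).le.not_gt, Complex.ofReal_inv, inv_inv]
    ring

/-- The weak derivative vanishes where the function vanishes. -/
lemma HasBoundedSupport.memLp {p : sobolevOne} (h : HasBoundedSupport p) :
    MemLp (fun z : ℝ => (z : ℂ) * oneDeriv p z) 2 surfaceMeasure := by
  obtain ⟨R, hR⟩ := h
  let M := max R 1
  have hU : IsOpen {x : ℝ | M < |x|} := isOpen_lt continuous_const continuous_abs
  have hUE : {x : ℝ | M < |x|} ⊆ freeSurface := fun x hx =>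
    lt_of_le_of_lt (le_max_right R 1) hx
  have hloc : LocallyIntegrableOn (oneDeriv p) {x : ℝ | M < |x|} volume :=
    (locallyIntegrableOn_of_locallyIntegrable_restrict
      ((Lp.memLp (oneDeriv p)).locallyIntegrable (by norm_num))).mono_set hUE
  have h0 := hU.ae_eq_zero_of_integral_contDiff_smul_eq_zero hloc (by
    intro g h1 h2 h3
    have h4 := isWeakDeriv_oneDeriv p g h1 h2 (h3.trans hUE)
    have h5 : ∫ x in freeSurface, deriv g x • oneToL2 p x = 0 := by
      refine (integral_congr_ae (g := fun _ => 0) ?_).trans (by simp)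
      filter_upwards [hR] with x hx
      by_cases hxM : M < |x|
      · rw [hx ((le_max_left R 1).trans hxM.le), smul_zero]
      · have : x ∉ tsupport g := fun hx' => hxM (h3 hx')
        have h6 : deriv g x = 0 := by
          rw [(notMem_tsupport_iff_eventuallyEq.1 this).deriv_eq]; simp
        rw [h6, zero_smul]
    rw [h5, zero_eq_neg] at h4
    rw [← h4, setIntegral_eq_integral_of_forall_compl_eq_zero]
    intro x hx
    rw [image_eq_zero_of_notMem_tsupport fun hx' => hx (hUE (h3 hx')), zero_smul])
  refine MemLp.of_le_mul (c := M) (Lp.memLp (oneDeriv p)) ?_ ?_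
  · exact (Complex.measurable_ofReal.aestronglyMeasurable).mul (Lp.memLp _).1
  · filter_upwards [ae_surface_of_ae h0] with z hz
    rw [norm_mul, Complex.norm_real, Real.norm_eq_abs]
    by_cases hzM : M < |z|
    · rw [hz hzM]; simp
    · gcongr
      exact not_lt.1 hzM

end WeakDerivExtension

section Density

lemma tendsto_mulOp {α : Type*} [MeasurableSpace α] {μ : Measure α} {b : ℕ → α → ℂ}
    (hb : ∀ n, IsBddMeas (b n)) {C : ℝ}
    (hC : ∀ n x, ‖b n x‖ ≤ C) {k : ℂ} (hlim : ∀ x, Tendsto (fun n => b n x) atTop (𝓝 k))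
    (f : Lp ℂ 2 μ) : Tendsto (fun n => mulOp (b n) (hb n) f) atTop (𝓝 (k • f)) := by
  rw [tendsto_iff_norm_sub_tendsto_zero]
  have h1 : ∀ n, ENNReal.ofReal (‖mulOp (b n) (hb n) f - k • f‖ ^ 2)
      = ∫⁻ x, ‖(b n x - k) * f x‖ₑ ^ 2 ∂μ := by
    intro n
    rw [ofReal_norm_sq_eq_lintegral]
    refine lintegral_congr_ae ?_
    filter_upwards [coeFn_mulOp (hb n) f, Lp.coeFn_sub (mulOp (b n) (hb n) f) (k • f),
      Lp.coeFn_smul k f] with x k1 k2 k3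
    rw [k2, Pi.sub_apply, k1, k3, Pi.smul_apply, smul_eq_mul, sub_mul]
  have hf : Measurable f := (Lp.stronglyMeasurable f).measurable
  have h2 : Tendsto (fun n => ∫⁻ x, ‖(b n x - k) * f x‖ₑ ^ 2 ∂μ) atTop
      (𝓝 (∫⁻ _, (0 : ℝ≥0∞) ∂μ)) := by
    refine tendsto_lintegral_of_dominated_convergence
      (fun x => ENNReal.ofReal ((C + ‖k‖) ^ 2) * ‖f x‖ₑ ^ 2) (fun n => ?_) (fun n => ?_) ?_ ?_
    · have := (hb n).1
      fun_prop
    · refine Eventually.of_forall fun x => ?_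
      simp only [enorm_mul, mul_pow]
      gcongr
      rw [← ofReal_norm, ← ENNReal.ofReal_pow (norm_nonneg _)]
      apply ENNReal.ofReal_le_ofReal
      gcongr
      exact (norm_sub_le _ _).trans (by gcongr; exact hC n x)
    · rw [lintegral_const_mul _ (by fun_prop), ← ofReal_norm_sq_eq_lintegral]
      exact (ENNReal.mul_lt_top ENNReal.ofReal_lt_top ENNReal.ofReal_lt_top).ne
    · refine Eventually.of_forall fun x => ?_
      have h3 : Tendsto (fun n => ‖(b n x - k) * f x‖) atTop (𝓝 0) := by
        have := (((hlim x).sub_const k).mul_const (f x)).norm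
        simpa using this
      have h4 := ENNReal.tendsto_ofReal (h3.pow 2)
      simpa only [ENNReal.ofReal_pow (norm_nonneg _), ofReal_norm, zero_pow two_ne_zero,
        ENNReal.ofReal_zero] using h4
  simp only [← h1, lintegral_zero] at h2
  have h3 : Tendsto (fun n => ‖mulOp (b n) (hb n) f - k • f‖ ^ 2) atTop (𝓝 0) := by
    have := (ENNReal.tendsto_toReal ENNReal.zero_ne_top).comp h2
    simpa [Function.comp_def, ENNReal.toReal_ofReal] using this
  have h4 := h3.sqrt
  simpa [Real.sqrt_sq (norm_nonneg _)] using h4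

lemma isBddMeas_outerCutoff (n : ℕ) : IsBddMeas fun x => (outerCutoff n x : ℂ) :=
  ⟨Complex.measurable_ofReal.comp (contDiff_outerCutoff n).continuous.measurable, 1, fun x => by
    rw [Complex.norm_real]; exact abs_smoothTransition_le _⟩

lemma isBddMeas_outerCutoffDeriv (n : ℕ) : IsBddMeas fun x => (outerCutoffDeriv n x : ℂ) := by
  obtain ⟨M, hM0, hM⟩ := exists_bound_deriv_smoothTransition
  refine ⟨Complex.measurable_ofReal.comp (measurable_outerCutoffDeriv n), 4 * M, fun x => ?_⟩
  rw [Complex.norm_real]; exact (outerCutoffDeriv_bound hM0 hM n x).2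

lemma isWeakDeriv_outerCutoff {v w : L2E} (h : IsWeakDeriv v w) (n : ℕ) :
    IsWeakDeriv (mulOp _ (isBddMeas_outerCutoff n) v)
      (mulOp _ (isBddMeas_outerCutoff n) w + mulOp _ (isBddMeas_outerCutoffDeriv n) v) := by
  intro φ h1 h2 h3
  have hsm := contDiff_outerCutoff n
  have hdc : ∀ x, outerCutoffDeriv n x = deriv (outerCutoff n) x := fun x =>
    (hasDerivAt_outerCutoff n x).deriv.symm
  have hdcont : Continuous (outerCutoffDeriv n) := by
    rw [funext hdc]; exact hsm.continuous_deriv (by simp)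
  have hsupp : tsupport (fun x => φ x * outerCutoff n x) ⊆ tsupport φ :=
    closure_mono fun x hx h0 => hx (by simp [h0])
  have hc2 : HasCompactSupport fun x => φ x * outerCutoff n x :=
    h2.of_isClosed_subset (isClosed_tsupport _) hsupp
  have key := h (fun x => φ x * outerCutoff n x) (h1.mul hsm) hc2 (hsupp.trans h3)
  have hd : ∀ x, deriv (fun x => φ x * outerCutoff n x) x
      = deriv φ x * outerCutoff n x + φ x * outerCutoffDeriv n x := fun x =>
    (((h1.differentiable (by simp) x).hasDerivAt).mul (hasDerivAt_outerCutoff n x)).deriv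
  have i1 : Integrable (fun x => (deriv φ x * outerCutoff n x) • v x) surfaceMeasure := integrable_smul_of_test ((h1.continuous_deriv (by simp)).mul hsm.continuous)
    h2.deriv.mul_right v
  have i2 : Integrable (fun x => (φ x * outerCutoffDeriv n x) • v x) surfaceMeasure := integrable_smul_of_test (h1.continuous.mul hdcont) h2.mul_right v
  have i3 : Integrable (fun x => (φ x * outerCutoff n x) • w x) surfaceMeasure := integrable_smul_of_test (h1.continuous.mul hsm.continuous) h2.mul_right w
  have e1 : ∫ x in freeSurface, deriv (fun x => φ x * outerCutoff n x) x • v x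
      = (∫ x in freeSurface, (deriv φ x * outerCutoff n x) • v x)
        + ∫ x in freeSurface, (φ x * outerCutoffDeriv n x) • v x := by
    rw [← integral_add i1 i2]
    refine integral_congr_ae (Eventually.of_forall fun x => ?_)
    simp only [hd, add_smul]
  have e2 : ∫ x in freeSurface, deriv φ x • mulOp _ (isBddMeas_outerCutoff n) v x
      = ∫ x in freeSurface, (deriv φ x * outerCutoff n x) • v x := by
    refine integral_congr_ae ?_
    filter_upwards [coeFn_mulOp (isBddMeas_outerCutoff n) v] with x hx
    rw [hx, Complex.real_smul, Complex.real_smul]; push_cast; ring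
  have e3 : ∫ x in freeSurface, φ x • (mulOp _ (isBddMeas_outerCutoff n) w
        + mulOp _ (isBddMeas_outerCutoffDeriv n) v : L2E) x
      = (∫ x in freeSurface, (φ x * outerCutoff n x) • w x)
        + ∫ x in freeSurface, (φ x * outerCutoffDeriv n x) • v x := by
    rw [← integral_add i3 i2]
    refine integral_congr_ae ?_
    filter_upwards [coeFn_mulOp (isBddMeas_outerCutoff n) w,
      coeFn_mulOp (isBddMeas_outerCutoffDeriv n) v,
      Lp.coeFn_add (mulOp _ (isBddMeas_outerCutoff n) w)
        (mulOp _ (isBddMeas_outerCutoffDeriv n) v)] with x k1 k2 k3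
    rw [k3, Pi.add_apply, k1, k2]
    simp only [Complex.real_smul]; push_cast; ring
  rw [e2, e3]
  rw [e1] at key
  linear_combination key

/-- The truncation of an element of `W^{1,2}(ℰ)`. -/
def truncate (n : ℕ) (p : sobolevOne) : sobolevOne :=
  ⟨WithLp.toLp 2 (mulOp _ (isBddMeas_outerCutoff n) (oneToL2 p),
    mulOp _ (isBddMeas_outerCutoff n) (oneDeriv p)
      + mulOp _ (isBddMeas_outerCutoffDeriv n) (oneToL2 p)),
    isWeakDeriv_outerCutoff (isWeakDeriv_oneDeriv p) n⟩

lemma hasBoundedSupport_truncate (n : ℕ) (p : sobolevOne) :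
    HasBoundedSupport (truncate n p) := by
  refine ⟨2 * (n + 1), ?_⟩
  filter_upwards [coeFn_mulOp (isBddMeas_outerCutoff n) (oneToL2 p)] with x hx hR
  refine hx.trans ?_
  have hn : (1 : ℝ) ≤ n + 1 := by simp
  rw [outerCutoff_eq_zero, Complex.ofReal_zero, zero_mul]
  rw [← sq_abs]; nlinarith

lemma tendsto_one_iff {p : ℕ → sobolevOne} {q : sobolevOne}
    (h1 : Tendsto (fun n => oneToL2 (p n)) atTop (𝓝 (oneToL2 q)))
    (h2 : Tendsto (fun n => oneDeriv (p n)) atTop (𝓝 (oneDeriv q))) :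
    Tendsto p atTop (𝓝 q) := by
  rw [tendsto_iff_norm_sub_tendsto_zero] at *
  have h3 : ∀ n, ‖p n - q‖ = Real.sqrt (‖oneToL2 (p n) - oneToL2 q‖ ^ 2
      + ‖oneDeriv (p n) - oneDeriv q‖ ^ 2) := by
    intro n
    rw [← map_sub, ← map_sub, ← one_norm_sq, Real.sqrt_sq (norm_nonneg _)]
  simp only [h3]
  simpa using ((h1.pow 2).add (h2.pow 2)).sqrt

lemma tendsto_truncate (p : sobolevOne) : Tendsto (fun n => truncate n p) atTop (𝓝 p) := by
  have lim1 : ∀ x, Tendsto (fun n => (outerCutoff n x : ℂ)) atTop (𝓝 1) := fun x => by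
    apply tendsto_const_nhds.congr'
    filter_upwards [eventually_outerCutoff x] with n hn
    rw [hn.1, Complex.ofReal_one]
  have lim2 : ∀ x, Tendsto (fun n => (outerCutoffDeriv n x : ℂ)) atTop (𝓝 0) := fun x => by
    apply tendsto_const_nhds.congr'
    filter_upwards [eventually_outerCutoff x] with n hn
    rw [hn.2, Complex.ofReal_zero]
  obtain ⟨M, hM0, hM⟩ := exists_bound_deriv_smoothTransition
  have b1 : ∀ n x, ‖(outerCutoff n x : ℂ)‖ ≤ 1 := fun n x => by
    rw [Complex.norm_real]; exact abs_smoothTransition_le _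
  have b2 : ∀ n x, ‖(outerCutoffDeriv n x : ℂ)‖ ≤ 4 * M := fun n x => by
    rw [Complex.norm_real]; exact (outerCutoffDeriv_bound hM0 hM n x).2
  have t1 := tendsto_mulOp isBddMeas_outerCutoff b1 lim1 (oneToL2 p)
  have t2 := tendsto_mulOp isBddMeas_outerCutoff b1 lim1 (oneDeriv p)
  have t3 := tendsto_mulOp isBddMeas_outerCutoffDeriv b2 lim2 (oneToL2 p)
  refine tendsto_one_iff ?_ ?_
  · rw [one_smul] at t1
    exact t1
  · have t4 := t2.add t3
    rw [one_smul, zero_smul, add_zero] at t4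
    exact t4

lemma dense_hasBoundedSupport : Dense {p : sobolevOne | HasBoundedSupport p} := fun p =>
  mem_closure_of_tendsto (tendsto_truncate p)
    (Eventually.of_forall fun n => hasBoundedSupport_truncate n p)

end Density

section DirichletToNeumann

/-- The inverse of `x / (x + i)` on `ℰ`. -/
def cutInv (x : ℝ) : ℂ := if 1 < |x| then 1 + Complex.I * (x : ℂ)⁻¹ else 0

lemma isBddMeas_cutInv : IsBddMeas cutInv := by
  refine ⟨Measurable.ite measurableSet_freeSurface (by fun_prop) measurable_const, 2, fun x => ?_⟩
  unfold cutInv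
  split_ifs with h
  · refine (norm_add_le _ _).trans ?_
    rw [norm_one, norm_mul, Complex.norm_I, one_mul, norm_inv, Complex.norm_real, Real.norm_eq_abs]
    linarith [inv_le_one_of_one_le₀ h.le]
  · simp

lemma cutInv_mul_cutCoeff {x : ℝ} (hx : x ∈ freeSurface) : cutInv x * cutCoeff x = 1 := by
  have h0 : (x : ℂ) ≠ 0 := by exact_mod_cast ne_zero_of_mem_freeSurface hx
  have h1 := add_I_ne_zero x
  have hx1 : 1 < |x| := hx
  rw [cutInv, if_pos hx1, cutCoeff, resCoeff]
  field_simp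

/-- The Dirichlet-to-Neumann operator of `Ω`. -/
def dtnOp : sobolevOne →L[ℂ] L2E :=
  restrOp ∘L mulOp cutInv isBddMeas_cutInv ∘L
    ((-Complex.I) • (signOp ∘L cutDerivOp) - commOp ∘L etaOp ∘L oneToL2)

lemma dtnOp_eq {p : sobolevOne} {F : L2R} (hF : IsDtN (etaOp (oneToL2 p)) F) :
    dtnOp p = restrOp F := by
  have h1 := hF.cutCoeff
  rw [mulOp_etaOp _ isCoeff_cutCoeff] at h1
  have h2 := (hasWeakDerivR_cutDerivOp p).isDtN.unique h1
  have h3 : dtnOp p = restrOp (mulOp cutInv isBddMeas_cutInv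
      ((-Complex.I) • signOp (cutDerivOp p) - commOp (etaOp (oneToL2 p)))) := rfl
  rw [h3, h2, add_sub_cancel_right]
  apply Lp.ext
  filter_upwards [coeFn_restrOp F,
    coeFn_restrOp (mulOp cutInv isBddMeas_cutInv (mulOp cutCoeff isBddMeas_cutCoeff F)),
    ae_surface_of_ae (coeFn_mulOp isBddMeas_cutInv (mulOp cutCoeff isBddMeas_cutCoeff F)),
    ae_surface_of_ae (coeFn_mulOp isBddMeas_cutCoeff F), ae_mem_freeSurface] with z k1 k2 k3 k4 hz
  rw [k1, k2, k3, k4, ← mul_assoc, cutInv_mul_cutCoeff hz, one_mul]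

lemma memLp_inversionExtension (v : L2E) : MemLp (inversionExtension v) 2 volume :=
  (memLp_congr_ae (coeFn_etaOp v)).1 (Lp.memLp _)

lemma toLp_inversionExtension (v : L2E) (h : MemLp (inversionExtension v) 2 volume) :
    h.toLp _ = etaOp v :=
  Lp.ext (h.coeFn_toLp.trans (coeFn_etaOp v).symm)

lemma isHalfPlaneDtN_iff {v : L2E} {F : L2R} :
    IsHalfPlaneDtN (inversionExtension v) F ↔ IsDtN (etaOp v) F := by
  constructor
  · rintro ⟨h1, h2⟩
    rwa [toLp_inversionExtension] at h2
  · intro h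
    refine ⟨memLp_inversionExtension v, ?_⟩
    rw [toLp_inversionExtension]
    exact h

lemma isDirichletToNeumann_dtnOp : IsDirichletToNeumann dtnOp := by
  intro p hp
  obtain ⟨F, hF⟩ := exists_isDtN_etaOp hp.memLp
  refine ⟨F, isHalfPlaneDtN_iff.2 hF, ?_⟩
  rw [dtnOp_eq hF]
  exact coeFn_restrOp F

lemma IsDirichletToNeumann.eq_dtnOp {Λ : sobolevOne →L[ℂ] L2E} (h : IsDirichletToNeumann Λ) :
    Λ = dtnOp := by
  apply ContinuousLinearMap.coeFn_injective
  refine Continuous.ext_on dense_hasBoundedSupport Λ.continuous dtnOp.continuous fun p hp => ?_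
  obtain ⟨F, hF, hΛ⟩ := h p hp
  rw [dtnOp_eq (isHalfPlaneDtN_iff.1 hF)]
  exact Lp.ext (hΛ.trans (coeFn_restrOp F).symm)

lemma etaOp_surface (v : L2E) : etaOp v =ᵐ[surfaceMeasure] v := by
  filter_upwards [coeFn_extOp_surface isCoeff_one v] with z hz
  exact hz.trans (one_mul _)

lemma etaOp_inv (v : L2E) : ∀ᵐ z ∂surfaceMeasure, etaOp v z⁻¹ = v z := by
  filter_upwards [coeFn_extOp_inv isCoeff_one v] with z hz
  exact hz.trans (one_mul _)

lemma etaOp_invariant (v : L2E) : etaOp v =ᵐ[volume] fun x => etaOp v x⁻¹ := by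
  refine ae_of_ae_surface ?_ ?_
  · filter_upwards [etaOp_surface v, etaOp_inv v] with z h1 h2
    rw [h1, h2]
  · filter_upwards [etaOp_surface v, etaOp_inv v] with z h1 h2
    rw [h2, inv_inv, h1]

lemma inner_extOp_left {c : ℝ → ℂ} (hc : IsCoeff c) (v : L2E) (F : L2R) :
    ⟪extOp c hc v, F⟫_ℂ = (∫ z in freeSurface, conj (c z * v z) * F z)
      + ∫ z in freeSurface, (((z ^ 2)⁻¹ : ℝ) : ℂ) * (conj (c z⁻¹ * v z) * F z⁻¹) := by
  rw [inner_eq_integral, integral_eq_add_inv (integrable_conj_mul _ _)]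
  congr 1
  · refine integral_congr_ae ?_
    filter_upwards [coeFn_extOp_surface hc v] with z hz
    rw [hz]
  · refine integral_congr_ae ?_
    filter_upwards [coeFn_extOp_inv hc v] with z hz
    rw [hz]

lemma inner_etaOp_left (v : L2E) (F : L2R) :
    ⟪etaOp v, F⟫_ℂ = (∫ z in freeSurface, conj (v z) * F z)
      + ∫ z in freeSurface, conj (v z) * ((((z ^ 2)⁻¹ : ℝ) : ℂ) * F z⁻¹) := by
  rw [etaOp, inner_extOp_left]
  simp only [one_mul, mul_left_comm]

lemma inner_restrOp (v : L2E) (F : L2R) :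
    ⟪v, restrOp F⟫_ℂ = ∫ z in freeSurface, conj (v z) * F z := by
  rw [inner_eq_integral]
  refine integral_congr_ae ?_
  filter_upwards [coeFn_restrOp F] with z hz
  rw [hz]

/-- `|D|` commutes with the inversion, in weak form. -/
lemma IsDtN.inner_etaOp_inv {f f' F F' : L2R} (h : IsDtN f F) (h' : IsDtN f' F')
    (hinv : f' =ᵐ[volume] fun x => f x⁻¹) (v : L2E) : ⟪etaOp v, F'⟫_ℂ = ⟪etaOp v, F⟫_ℂ := by
  have hinv' : f =ᵐ[volume] fun x => f' x⁻¹ := by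
    filter_upwards [ae_inv_of_ae hinv] with x hx
    rw [hx, inv_inv]
  rw [inner_etaOp_left, inner_etaOp_left, add_comm]
  congr 1
  · refine integral_congr_ae ?_
    filter_upwards [h'.inv h hinv'] with z hz
    rw [hz]
  · refine integral_congr_ae ?_
    filter_upwards [h.inv h' hinv] with z hz
    rw [hz]

lemma IsDtN.inner_etaOp_eq {w : L2E} {F : L2R} (h : IsDtN (etaOp w) F) (v : L2E) :
    ⟪etaOp v, F⟫_ℂ = 2 * ⟪v, restrOp F⟫_ℂ := by
  rw [inner_etaOp_left, inner_restrOp, two_mul]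
  congr 1
  refine integral_congr_ae ?_
  filter_upwards [h.inv h (etaOp_invariant w)] with z hz
  rw [hz]

lemma inner_etaOp_dtn {p : sobolevOne} {F : L2R} (h : IsDtN (etaOp (oneToL2 p)) F) (v : L2E) :
    ⟪etaOp v, F⟫_ℂ = 2 * ⟪v, dtnOp p⟫_ℂ := by
  rw [dtnOp_eq h, h.inner_etaOp_eq]

lemma HasBoundedSupport.exists_isDtN {p : sobolevOne} (h : HasBoundedSupport p) :
    ∃ F, IsDtN (etaOp (oneToL2 p)) F := exists_isDtN_etaOp h.memLp

/-- The Dirichlet-to-Neumann operator is symmetric. -/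
lemma inner_dtnOp (p q : sobolevOne) : ⟪dtnOp p, oneToL2 q⟫_ℂ = ⟪oneToL2 p, dtnOp q⟫_ℂ := by
  have base : ∀ p q, HasBoundedSupport p → HasBoundedSupport q →
      ⟪dtnOp p, oneToL2 q⟫_ℂ = ⟪oneToL2 p, dtnOp q⟫_ℂ := by
    intro p q hp hq
    obtain ⟨F, hF⟩ := hp.exists_isDtN
    obtain ⟨G, hG⟩ := hq.exists_isDtN
    have h1 := inner_etaOp_dtn hG (oneToL2 p)
    have h2 := inner_etaOp_dtn hF (oneToL2 q)
    rw [← hF.inner_comm hG, ← inner_conj_symm, h2, map_mul, inner_conj_symm, map_ofNat] at h1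
    exact mul_left_cancel₀ two_ne_zero h1
  have step : ∀ p q, HasBoundedSupport p → ⟪dtnOp p, oneToL2 q⟫_ℂ = ⟪oneToL2 p, dtnOp q⟫_ℂ := by
    intro p q hp
    refine congrFun (Continuous.ext_on dense_hasBoundedSupport
      (f := fun q => ⟪dtnOp p, oneToL2 q⟫_ℂ) (g := fun q => ⟪oneToL2 p, dtnOp q⟫_ℂ)
      (by fun_prop) (by fun_prop) fun q hq => base p q hp hq) q
  exact congrFun (Continuous.ext_on dense_hasBoundedSupport
    (f := fun p => ⟪dtnOp p, oneToL2 q⟫_ℂ) (g := fun p => ⟪oneToL2 p, dtnOp q⟫_ℂ)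
    (by fun_prop) (by fun_prop) fun p hp => step p q hp) p

end DirichletToNeumann

section ClassicalDerivative

/-- A classical derivative on `ℰ` is a weak derivative. -/
lemma isWeakDeriv_of_hasDerivAt {v w : L2E} {θ θ' : ℝ → ℂ} (hv : v =ᵐ[surfaceMeasure] θ)
    (hw : w =ᵐ[surfaceMeasure] θ') (hd : ∀ z ∈ freeSurface, HasDerivAt θ (θ' z) z) :
    IsWeakDeriv v w := by
  intro g h1 h2 h3
  have hz : ∀ x, x ∉ freeSurface → g =ᶠ[𝓝 x] 0 := fun x hx =>
    notMem_tsupport_iff_eventuallyEq.1 fun hx' => hx (h3 hx')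
  have hgd : ∀ x, HasDerivAt g (deriv g x) x := fun x =>
    (h1.differentiable (by simp) x).hasDerivAt
  have i1 : Integrable (fun x => deriv g x • θ x) surfaceMeasure :=
    (integrable_smul_of_test (h1.continuous_deriv (by simp)) h2.deriv v).congr (by
      filter_upwards [hv] with x hx
      rw [hx])
  have i2 : Integrable (fun x => g x • θ' x) surfaceMeasure :=
    (integrable_smul_of_test h1.continuous h2 w).congr (by
      filter_upwards [hw] with x hx
      rw [hx])
  have i3 : Integrable (fun x => g x • θ x) surfaceMeasure :=
    (integrable_smul_of_test h1.continuous h2 v).congr (by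
      filter_upwards [hv] with x hx
      rw [hx])
  have z1 : ∀ x, x ∉ freeSurface → g x = 0 := fun x hx => (hz x hx).eq_of_nhds
  have z2 : ∀ x, x ∉ freeSurface → deriv g x = 0 := fun x hx => by
    rw [(hz x hx).deriv_eq]; exact deriv_const x 0
  have hD : ∀ x, HasDerivAt (fun x => g x • θ x) (g x • θ' x + deriv g x • θ x) x := by
    intro x
    by_cases hx : x ∈ freeSurface
    · exact (hgd x).smul (hd x hx)
    · rw [z1 x hx, z2 x hx, zero_smul, zero_smul, add_zero]
      refine (hasDerivAt_const x (0 : ℂ)).congr_of_eventuallyEq ?_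
      filter_upwards [hz x hx] with y hy
      rw [hy]; simp
  have j1 : Integrable fun x => g x • θ' x + deriv g x • θ x :=
    (integrableOn_iff_integrable_of_support_subset fun x hx => by
      by_contra hx'
      exact hx (by simp [z1 x hx', z2 x hx'])).1 (i2.add i1)
  have j2 : Integrable fun x => g x • θ x :=
    (integrableOn_iff_integrable_of_support_subset fun x hx => by
      by_contra hx'
      exact hx (by simp [z1 x hx'])).1 i3
  have key := integral_eq_zero_of_hasDerivAt_of_integrable hD j1 j2
  rw [← setIntegral_eq_integral_of_forall_compl_eq_zero (s := freeSurface)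
    (fun x hx => by simp [z1 x hx, z2 x hx]), integral_add i2 i1] at key
  have e1 : ∫ x in freeSurface, deriv g x • v x = ∫ x in freeSurface, deriv g x • θ x := by
    refine integral_congr_ae ?_
    filter_upwards [hv] with x hx
    rw [hx]
  have e2 : ∫ x in freeSurface, g x • w x = ∫ x in freeSurface, g x • θ' x := by
    refine integral_congr_ae ?_
    filter_upwards [hw] with x hx
    rw [hx]
  rw [e1, e2]
  linear_combination key

lemma exists_one_of_test {g : ℝ → ℝ} (h1 : ContDiff ℝ ∞ g) (h2 : HasCompactSupport g) :
    ∃ p : sobolevOne, oneToL2 p =ᵐ[surfaceMeasure] fun x => (g x : ℂ) := by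
  let φ := testSchwartz g h1 h2
  let φ₁ : 𝓢(ℝ, ℂ) := SchwartzMap.derivCLM ℂ ℂ φ
  have e1 : restrOp (φ.toLp 2 volume) =ᵐ[surfaceMeasure] φ := by
    filter_upwards [coeFn_restrOp (φ.toLp 2 volume), ae_surface_of_ae (φ.coeFn_toLp 2 volume)]
      with x k1 k2
    rw [k1, k2]
  have e2 : restrOp (φ₁.toLp 2 volume) =ᵐ[surfaceMeasure] φ₁ := by
    filter_upwards [coeFn_restrOp (φ₁.toLp 2 volume), ae_surface_of_ae (φ₁.coeFn_toLp 2 volume)]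
      with x k1 k2
    rw [k1, k2]
  have hd : IsWeakDeriv (restrOp (φ.toLp 2 volume)) (restrOp (φ₁.toLp 2 volume)) :=
    isWeakDeriv_of_hasDerivAt e1 e2 fun x _ => φ.hasDerivAt x
  exact ⟨⟨WithLp.toLp 2 (restrOp (φ.toLp 2 volume), restrOp (φ₁.toLp 2 volume)), hd⟩, e1⟩

lemma eq_zero_of_inner_one {u : L2E} (h : ∀ p : sobolevOne, ⟪u, oneToL2 p⟫_ℂ = 0) : u = 0 := by
  rw [Lp.eq_zero_iff_ae_eq_zero]
  have hloc : LocallyIntegrableOn (fun x => conj (u x)) freeSurface volume :=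
    locallyIntegrableOn_of_locallyIntegrable_restrict
      ((Lp.memLp u).star.locallyIntegrable (by norm_num))
  have key := isOpen_freeSurface.ae_eq_zero_of_integral_contDiff_smul_eq_zero hloc (by
    intro g h1 h2 h3
    obtain ⟨p, hp⟩ := exists_one_of_test h1 h2
    have h4 := h p
    rw [inner_eq_integral] at h4
    rw [← setIntegral_eq_integral_of_forall_compl_eq_zero (s := freeSurface) (fun x hx => by
      rw [image_eq_zero_of_notMem_tsupport fun hx' => hx (h3 hx'), zero_smul]), ← h4]
    refine integral_congr_ae ?_
    filter_upwards [hp] with x hx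
    rw [hx, Complex.real_smul, mul_comm])
  filter_upwards [(ae_restrict_iff' measurableSet_freeSurface).2 key] with x hx
  simpa using hx

lemma denseRange_oneToL2 : DenseRange oneToL2 := by
  have h : (LinearMap.range oneToL2.toLinearMap).topologicalClosure = ⊤ := by
    rw [Submodule.topologicalClosure_eq_top_iff, Submodule.eq_bot_iff]
    intro u hu
    refine eq_zero_of_inner_one fun p => ?_
    rw [Submodule.mem_orthogonal'] at hu
    exact hu _ ⟨p, rfl⟩
  have h2 := Submodule.dense_iff_topologicalClosure_eq_top.2 h
  exact h2

end ClassicalDerivative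

section SelfAdjoint

lemma memLp_inv_schwartz (χ : 𝓢(ℝ, ℂ)) :
    MemLp (fun x : ℝ => (x : ℂ)⁻¹ * χ x⁻¹) 2 volume := by
  have hχ : Measurable χ := χ.continuous.measurable
  refine memLp_two_iff_lintegral.2 ⟨Measurable.aestronglyMeasurable (by fun_prop), ?_⟩
  have h1 := (memLp_two_iff_lintegral.1 (χ.memLp 2 volume)).2
  rw [lintegral_inv_subst] at h1
  refine lt_of_eq_of_lt (lintegral_congr fun x => ?_) h1
  rw [ofReal_mul_enorm_sq, div_eq_inv_mul]

/-- The symmetrization of `x χ(x)` under the inversion, with its Dirichlet-to-Neumann image. -/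
lemma exists_symmetrization (χ : 𝓢(ℝ, ℂ)) {Ψ : L2R} (hΨ : IsDtN ((mulX χ).toLp 2 volume) Ψ) :
    ∃ p : sobolevOne, (oneToL2 p =ᵐ[surfaceMeasure] fun z => z * χ z + (z : ℂ)⁻¹ * χ z⁻¹) ∧
      ∀ v : L2E, ⟪v, dtnOp p⟫_ℂ = ⟪etaOp v, Ψ⟫_ℂ := by
  let ψ := mulX χ
  let ψ₁ : 𝓢(ℝ, ℂ) := SchwartzMap.derivCLM ℂ ℂ ψ
  let f' : L2R := (memLp_inv_schwartz χ).toLp _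
  have hf' : f' =ᵐ[volume] fun x : ℝ => (x : ℂ)⁻¹ * χ x⁻¹ := (memLp_inv_schwartz χ).coeFn_toLp
  have hf : ψ.toLp 2 volume =ᵐ[volume] ψ := ψ.coeFn_toLp 2 volume
  have hf₁ : ψ₁.toLp 2 volume =ᵐ[volume] ψ₁ := ψ₁.coeFn_toLp 2 volume
  have hsum : (ψ.toLp 2 volume + f' : L2R) =ᵐ[volume] fun x : ℝ => x * χ x + (x : ℂ)⁻¹ * χ x⁻¹ := by
    filter_upwards [Lp.coeFn_add (ψ.toLp 2 volume) f', hf, hf'] with x k1 k2 k3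
    rw [k1, Pi.add_apply, k2, k3, mulX_apply]
  let v : L2E := restrOp (ψ.toLp 2 volume + f')
  have hv : v =ᵐ[surfaceMeasure] fun z => z * χ z + (z : ℂ)⁻¹ * χ z⁻¹ :=
    (coeFn_restrOp _).trans (ae_surface_of_ae hsum)
  let w : L2E := restrOp (ψ₁.toLp 2 volume) - (memLp_inv_weight (ψ₁.toLp 2 volume)).toLp _
  have hw : w =ᵐ[surfaceMeasure] fun z => ψ₁ z - (((z ^ 2)⁻¹ : ℝ) : ℂ) * ψ₁ z⁻¹ := by
    filter_upwards [Lp.coeFn_sub (restrOp (ψ₁.toLp 2 volume)) ((memLp_inv_weight (ψ₁.toLp 2 volume)).toLp _),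
      coeFn_restrOp (ψ₁.toLp 2 volume), (memLp_inv_weight (ψ₁.toLp 2 volume)).coeFn_toLp,
      ae_surface_of_ae hf₁, ae_surface_inv_of_ae hf₁] with z k1 k2 k3 k4 k5
    rw [k1, Pi.sub_apply, k2, k3, k4, k5]
  have hwd : IsWeakDeriv v w := by
    refine isWeakDeriv_of_hasDerivAt hv hw fun z hz => ?_
    have h1 := (ψ.hasDerivAt z).add
      (hasDerivAt_comp_inv (ne_zero_of_mem_freeSurface hz) (ψ.hasDerivAt z⁻¹))
    have h2 : (⇑ψ + fun x => ψ x⁻¹) = fun z : ℝ => z * χ z + (z : ℂ)⁻¹ * χ z⁻¹ := by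
      ext x
      simp [ψ]
    rw [h2] at h1
    refine h1.congr_deriv ?_
    have h3 : ∀ x, deriv ψ x = ψ₁ x := fun x => rfl
    rw [h3, h3]
    ring
  let p : sobolevOne := ⟨WithLp.toLp 2 (v, w), hwd⟩
  have hmem : MemLp (fun z : ℝ => (z : ℂ) * oneDeriv p z) 2 surfaceMeasure := by
    have m1 : MemLp (mulX ψ₁) 2 surfaceMeasure := ((mulX ψ₁).memLp 2 volume).restrict _
    have m2 : MemLp (fun x : ℝ => (x : ℂ)⁻¹ * ψ₁ x⁻¹) 2 surfaceMeasure :=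
      (memLp_inv_schwartz ψ₁).restrict _
    refine (memLp_congr_ae ?_).2 (m1.sub m2)
    filter_upwards [hw, ae_mem_freeSurface] with z k1 hz
    have hz0 : (z : ℂ) ≠ 0 := by exact_mod_cast ne_zero_of_mem_freeSurface hz
    have k2 : oneDeriv p z = w z := rfl
    rw [k2, k1, Pi.sub_apply, mulX_apply]
    push_cast
    field_simp
  obtain ⟨F, hF⟩ := exists_isDtN_etaOp hmem
  have hη : etaOp v = ψ.toLp 2 volume + f' := by
    apply Lp.ext
    refine ae_of_ae_surface ?_ ?_
    · filter_upwards [etaOp_surface v, coeFn_restrOp (ψ.toLp 2 volume + f')] with z k1 k2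
      exact k1.trans k2
    · filter_upwards [etaOp_inv v, hv, ae_surface_inv_of_ae hsum] with z k1 k2 k3
      rw [k1, k2, k3]
      push_cast
      rw [inv_inv, inv_inv, add_comm]
  have hF2 : IsDtN (ψ.toLp 2 volume + f') F := hη ▸ hF
  have hF' : IsDtN f' (F - Ψ) := by
    have := hF2.sub hΨ
    rwa [show mulX χ = ψ from rfl, add_sub_cancel_left] at this
  refine ⟨p, hv, fun u => ?_⟩
  have h1 := inner_etaOp_dtn hF u
  have h2 := hΨ.inner_etaOp_inv hF' (by
    filter_upwards [hf', ae_inv_of_ae hf] with x k1 k2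
    rw [k1]
    refine Eq.trans ?_ k2.symm
    simp [ψ]) u
  rw [inner_sub_right] at h2
  have h3 : 2 * ⟪u, dtnOp p⟫_ℂ = 2 * ⟪etaOp u, Ψ⟫_ℂ := by
    rw [← h1]; linear_combination h2
  exact mul_left_cancel₀ two_ne_zero h3

/-- The coefficient equal to `ρ` on `ℰ` and to `ρ / x²` inside. -/
def evenCoeff (ρ : ℝ → ℂ) (x : ℝ) : ℂ :=
  if 1 < |x| then ρ x else (((x ^ 2)⁻¹ : ℝ) : ℂ) * ρ x

lemma isCoeff_evenCoeff_cutCoeff : IsCoeff (evenCoeff cutCoeff) := by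
  have hm : Measurable cutCoeff := continuous_cutCoeff.measurable
  refine ⟨Measurable.ite measurableSet_freeSurface hm (by fun_prop), 1, fun z hz => ?_⟩
  have hz1 : 1 < |z| := hz
  rw [evenCoeff, if_pos hz1, evenCoeff, if_neg (abs_inv_lt_one hz).le.not_gt]
  refine ⟨norm_cutCoeff_le z, ?_⟩
  rw [norm_mul, Complex.norm_real, Real.norm_eq_abs, one_mul, inv_pow, inv_inv, abs_pow]
  calc |z| ^ 2 * ‖cutCoeff z⁻¹‖ ≤ |z| ^ 2 * |z⁻¹| := by
        gcongr; exact norm_cutCoeff_le_abs _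
    _ = |z| := by rw [abs_inv]; field_simp

/-- The derivative of the inverse cut-off on `ℰ`. -/
def cutInvDeriv (x : ℝ) : ℂ := if 1 < |x| then -(Complex.I * ((x : ℂ)⁻¹) ^ 2) else 0

lemma isBddMeas_cutInvDeriv : IsBddMeas cutInvDeriv := by
  refine ⟨Measurable.ite measurableSet_freeSurface (by fun_prop) measurable_const, 1, fun x => ?_⟩
  unfold cutInvDeriv
  split_ifs with h
  · rw [norm_neg, norm_mul, Complex.norm_I, one_mul, norm_pow, norm_inv, Complex.norm_real,
      Real.norm_eq_abs]
    exact pow_le_one₀ (by positivity) (inv_le_one_of_one_le₀ h.le)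
  · simp

lemma exists_one_of_hasWeakDerivR {v : L2E} {f' : L2R}
    (h : HasWeakDerivR (extOp _ isCoeff_cutCoeff v) f') : ∃ p : sobolevOne, oneToL2 p = v := by
  let V : L2R := extOp _ isCoeff_cutCoeff v
  let w1 : L2E := restrOp (mulOp _ isBddMeas_cutInv f')
  let w2 : L2E := restrOp (mulOp _ isBddMeas_cutInvDeriv V)
  have hw1 : w1 =ᵐ[surfaceMeasure] fun x => cutInv x * f' x := by
    filter_upwards [coeFn_restrOp (mulOp _ isBddMeas_cutInv f'),
      ae_surface_of_ae (coeFn_mulOp isBddMeas_cutInv f')] with x k1 k2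
    exact k1.trans k2
  have hw2 : w2 =ᵐ[surfaceMeasure] fun x => cutInvDeriv x * V x := by
    filter_upwards [coeFn_restrOp (mulOp _ isBddMeas_cutInvDeriv V),
      ae_surface_of_ae (coeFn_mulOp isBddMeas_cutInvDeriv V)] with x k1 k2
    exact k1.trans k2
  suffices hwd : IsWeakDeriv v (w1 + w2) from ⟨⟨WithLp.toLp 2 (v, w1 + w2), hwd⟩, rfl⟩
  intro g h1 h2 h3
  have hz : ∀ x, x ∉ freeSurface → g =ᶠ[𝓝 x] 0 := fun x hx =>
    notMem_tsupport_iff_eventuallyEq.1 fun hx' => hx (h3 hx')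
  have z1 : ∀ x, x ∉ freeSurface → g x = 0 := fun x hx => (hz x hx).eq_of_nhds
  have hsm : ContDiff ℝ ∞ fun x : ℝ => (g x : ℂ) * (1 + Complex.I * (x : ℂ)⁻¹) := by
    refine contDiff_iff_contDiffAt.2 fun x => ?_
    by_cases hx : x ∈ freeSurface
    · have hx0 : (x : ℂ) ≠ 0 := by exact_mod_cast ne_zero_of_mem_freeSurface hx
      have hid : ContDiff ℝ ∞ (fun x : ℝ => (x : ℂ)) := Complex.ofRealCLM.contDiff
      exact (Complex.ofRealCLM.contDiff.comp h1).contDiffAt.mul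
        (contDiffAt_const.add (contDiffAt_const.mul (hid.contDiffAt.inv hx0)))
    · refine (contDiffAt_const (c := (0 : ℂ))).congr_of_eventuallyEq ?_
      filter_upwards [hz x hx] with y hy
      rw [hy]; simp
  let φ : 𝓢(ℝ, ℂ) := HasCompactSupport.toSchwartzMap
    (f := fun x : ℝ => (g x : ℂ) * (1 + Complex.I * (x : ℂ)⁻¹))
    (h2.comp_left (g := Complex.ofReal) Complex.ofReal_zero).mul_right hsm
  have hφ : ∀ x, φ x = (g x : ℂ) * (1 + Complex.I * (x : ℂ)⁻¹) := fun x => rfl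
  have hφd : ∀ x ∈ freeSurface, deriv φ x = ((deriv g x : ℝ) : ℂ) * cutInv x + g x * cutInvDeriv x := by
    intro x hx
    have hx1 : 1 < |x| := hx
    have hx0 : (x : ℂ) ≠ 0 := by exact_mod_cast ne_zero_of_mem_freeSurface hx
    have d1 : HasDerivAt (fun x => (g x : ℂ)) ((deriv g x : ℝ) : ℂ) x :=
      ((h1.differentiable (by simp) x).hasDerivAt).ofReal_comp
    have d2 : HasDerivAt (fun x : ℝ => (x : ℂ)) 1 x := Complex.ofRealCLM.hasDerivAt
    have d3 := d1.mul (((d2.inv hx0).const_mul Complex.I).const_add 1)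
    have d4 := d3.deriv
    rw [show deriv φ x = _ from d4, cutInv, if_pos hx1, cutInvDeriv, if_pos hx1]
    simp only [Pi.inv_apply]
    field_simp
  have hφ0 : ∀ x, x ∉ freeSurface → φ =ᶠ[𝓝 x] 0 := fun x hx => by
    filter_upwards [hz x hx] with y hy
    rw [hφ, hy]; simp
  have key := h φ
  have r1 : ∫ x in freeSurface, deriv φ x * V x = ∫ x, deriv φ x * V x :=
    setIntegral_eq_integral_of_forall_compl_eq_zero fun x hx => by
      have h0 : deriv φ x = 0 := (hφ0 x hx).deriv_eq.trans (deriv_const x 0)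
      rw [h0, zero_mul]
  have r2 : ∫ x in freeSurface, φ x * f' x = ∫ x, φ x * f' x :=
    setIntegral_eq_integral_of_forall_compl_eq_zero fun x hx => by
      rw [(hφ0 x hx).eq_of_nhds, Pi.zero_apply, zero_mul]
  have e1 : ∫ x in freeSurface, deriv φ x * V x
      = (∫ x in freeSurface, deriv g x • v x) + ∫ x in freeSurface, g x • w2 x := by
    rw [← integral_add (integrable_smul_of_test (h1.continuous_deriv (by simp)) h2.deriv v)
      (integrable_smul_of_test h1.continuous h2 w2)]
    refine integral_congr_ae ?_
    filter_upwards [hw2, coeFn_extOp_surface isCoeff_cutCoeff v, ae_mem_freeSurface]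
      with x k2 k3 hx
    have k4 : V x = cutCoeff x * v x := k3
    rw [k2, hφd x hx, add_mul, Complex.real_smul, Complex.real_smul]
    congr 1
    · rw [k4, mul_assoc, ← mul_assoc (cutInv x), cutInv_mul_cutCoeff hx, one_mul]
    · ring
  have e2 : ∫ x in freeSurface, φ x * f' x = ∫ x in freeSurface, g x • w1 x := by
    refine integral_congr_ae ?_
    filter_upwards [hw1, ae_mem_freeSurface] with x k2 hx
    have hx1 : 1 < |x| := hx
    rw [k2, hφ, cutInv, if_pos hx1, Complex.real_smul]
    ring
  rw [show extOp _ isCoeff_cutCoeff v = V from rfl, ← r1, ← r2, e1, e2] at key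
  rw [integral_add_test h1.continuous h2]
  linear_combination key

/-- The Dirichlet-to-Neumann operator is self-adjoint. -/
lemma exists_one_of_inner_dtnOp {v f : L2E}
    (h : ∀ p : sobolevOne, ⟪v, dtnOp p⟫_ℂ = ⟪f, oneToL2 p⟫_ℂ) :
    ∃ p : sobolevOne, oneToL2 p = v ∧ dtnOp p = f := by
  have h1 : IsDtN (mulOp _ isBddMeas_cutCoeff (etaOp v))
      (extOp _ isCoeff_evenCoeff_cutCoeff f + commOp (etaOp v)) := by
    refine isDtN_cutCoeff_of_inner fun φ Ψ hΨ => ?_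
    obtain ⟨p, hp, hΛ⟩ := exists_symmetrization (mulRes φ) hΨ
    rw [← hΛ, h, inner_extOp_left, inner_eq_integral]
    have hφ : φ.toLp 2 volume =ᵐ[volume] φ := φ.coeFn_toLp 2 volume
    have i0 := integrable_conj_mul (extOp _ isCoeff_evenCoeff_cutCoeff f) (φ.toLp 2 volume)
    have a1 : (fun z => conj (extOp _ isCoeff_evenCoeff_cutCoeff f z) * φ.toLp 2 volume z)
        =ᵐ[surfaceMeasure] fun z => conj (evenCoeff cutCoeff z * f z) * φ.toLp 2 volume z := by
      filter_upwards [coeFn_extOp_surface isCoeff_evenCoeff_cutCoeff f] with z hz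
      rw [hz]
    have a2 : (fun z => (((z ^ 2)⁻¹ : ℝ) : ℂ) *
          (conj (extOp _ isCoeff_evenCoeff_cutCoeff f z⁻¹) * φ.toLp 2 volume z⁻¹))
        =ᵐ[surfaceMeasure] fun z => (((z ^ 2)⁻¹ : ℝ) : ℂ) *
          (conj (evenCoeff cutCoeff z⁻¹ * f z) * φ.toLp 2 volume z⁻¹) := by
      filter_upwards [coeFn_extOp_inv isCoeff_evenCoeff_cutCoeff f] with z hz
      rw [hz]
    rw [← integral_add (i0.restrict.congr a1) ((integrable_inv_weight i0).congr a2)]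
    refine integral_congr_ae ?_
    filter_upwards [hp, ae_surface_of_ae hφ, ae_surface_inv_of_ae hφ, ae_mem_freeSurface]
      with z k1 k2 k3 hz
    have hz1 : 1 < |z| := hz
    have hz0 : (z : ℂ) ≠ 0 := by exact_mod_cast ne_zero_of_mem_freeSurface hz
    rw [k1, k2, k3, evenCoeff, if_pos hz1, evenCoeff, if_neg (abs_inv_lt_one hz).le.not_gt,
      mulRes_apply, mulRes_apply]
    simp only [cutCoeff, map_mul, Complex.conj_ofReal]
    push_cast
    field_simp
  rw [mulOp_etaOp _ isCoeff_cutCoeff] at h1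
  obtain ⟨p, hp⟩ := exists_one_of_hasWeakDerivR h1.hasWeakDerivR
  refine ⟨p, hp, ?_⟩
  rw [← sub_eq_zero]
  refine eq_zero_of_inner_one fun q => ?_
  rw [inner_sub_left, inner_dtnOp, hp, h, sub_self]

/-- The Dirichlet-to-Neumann operator is nonnegative. -/
lemma re_inner_dtnOp_nonneg (p : sobolevOne) : 0 ≤ (⟪oneToL2 p, dtnOp p⟫_ℂ).re := by
  have hcl : IsClosed {p : sobolevOne | 0 ≤ (⟪oneToL2 p, dtnOp p⟫_ℂ).re} :=
    isClosed_le continuous_const (Complex.continuous_re.comp (by fun_prop))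
  have hsub : {p : sobolevOne | HasBoundedSupport p}
      ⊆ {p : sobolevOne | 0 ≤ (⟪oneToL2 p, dtnOp p⟫_ℂ).re} := by
    intro p hp
    obtain ⟨F, hF⟩ := HasBoundedSupport.exists_isDtN hp
    obtain ⟨G, hG⟩ := hF.exists_isSqrtDtN
    have h1 := inner_etaOp_dtn hF (oneToL2 p)
    rw [hG.inner_eq hG hF, inner_self_eq_norm_sq_to_K] at h1
    have h2 := congrArg Complex.re h1
    have h3 : ((‖G‖ : ℂ) ^ 2).re = ‖G‖ ^ 2 := by
      rw [← Complex.ofReal_pow, Complex.ofReal_re]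
    simp only [Complex.mul_re, Complex.re_ofNat, Complex.im_ofNat, zero_mul, sub_zero] at h2
    have h4 : ‖G‖ ^ 2 = 2 * (⟪oneToL2 p, dtnOp p⟫_ℂ).re := h3.symm.trans h2
    change 0 ≤ (⟪oneToL2 p, dtnOp p⟫_ℂ).re
    nlinarith [sq_nonneg ‖G‖]
  exact (hcl.closure_subset_iff.2 hsub) (dense_hasBoundedSupport p)

lemma norm_le_resolvent {μ g : ℝ} (hg : 0 < g) (p : sobolevOne) :
    μ * ‖oneToL2 p‖ ≤ ‖(μ : ℂ) • oneToL2 p + (g : ℂ) • dtnOp p‖ := by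
  have h1 : (⟪oneToL2 p, (μ : ℂ) • oneToL2 p + (g : ℂ) • dtnOp p⟫_ℂ).re
      = μ * ‖oneToL2 p‖ ^ 2 + g * (⟪oneToL2 p, dtnOp p⟫_ℂ).re := by
    rw [inner_add_right, inner_smul_right, inner_smul_right, Complex.add_re, Complex.re_ofReal_mul,
      Complex.re_ofReal_mul]
    congr 2
    exact inner_self_eq_norm_sq (𝕜 := ℂ) (oneToL2 p)
  have h2 := mul_nonneg hg.le (re_inner_dtnOp_nonneg p)
  have h3 := (Complex.re_le_norm _).trans
    (norm_inner_le_norm (𝕜 := ℂ) (oneToL2 p) ((μ : ℂ) • oneToL2 p + (g : ℂ) • dtnOp p))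
  rw [h1] at h3
  rcases (norm_nonneg (oneToL2 p)).eq_or_lt with h0 | h0
  · rw [← h0, mul_zero]; exact norm_nonneg _
  · by_contra hc
    rw [not_le] at hc
    nlinarith

/-- `μ + gΛ` is onto for `μ, g > 0`. -/
lemma exists_resolvent {μ g : ℝ} (hμ : 0 < μ) (hg : 0 < g) (f : L2E) :
    ∃ p : sobolevOne, (μ : ℂ) • oneToL2 p + (g : ℂ) • dtnOp p = f := by
  let T : sobolevOne →L[ℂ] L2E := (μ : ℂ) • oneToL2 + (g : ℂ) • dtnOp
  have hT : ∀ p, T p = (μ : ℂ) • oneToL2 p + (g : ℂ) • dtnOp p := fun p => rfl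
  have hgC : (g : ℂ) ≠ 0 := by exact_mod_cast hg.ne'
  have hsa : ∀ p q, ⟪T p, oneToL2 q⟫_ℂ = ⟪oneToL2 p, T q⟫_ℂ := by
    intro p q
    rw [hT, hT, inner_add_left, inner_add_right, inner_smul_left, inner_smul_left,
      inner_smul_right, inner_smul_right, inner_dtnOp, Complex.conj_ofReal, Complex.conj_ofReal]
  have hgraph : ∀ v f : L2E, (∀ q, ⟪v, T q⟫_ℂ = ⟪f, oneToL2 q⟫_ℂ) →
      ∃ p, oneToL2 p = v ∧ T p = f := by
    intro v f h
    obtain ⟨p, hp1, hp2⟩ := exists_one_of_inner_dtnOp (v := v)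
      (f := (g : ℂ)⁻¹ • (f - (μ : ℂ) • v)) (fun q => by
        have h1 := h q
        rw [hT, inner_add_right, inner_smul_right, inner_smul_right] at h1
        rw [inner_smul_left, inner_sub_left, inner_smul_left, map_inv₀, Complex.conj_ofReal,
          Complex.conj_ofReal, eq_inv_mul_iff_mul_eq₀ hgC]
        linear_combination h1)
    refine ⟨p, hp1, ?_⟩
    rw [hT, hp1, hp2, smul_smul, mul_inv_cancel₀ hgC, one_smul, add_sub_cancel]
  have hclosed : IsClosed (Set.range T) := by
    rw [← isSeqClosed_iff_isClosed]
    intro y f hy hlim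
    choose p hp using hy
    have hcauchy : CauchySeq fun n => oneToL2 (p n) := by
      have h1 := hlim.cauchySeq
      rw [Metric.cauchySeq_iff'] at h1 ⊢
      intro ε hε
      obtain ⟨N, hN⟩ := h1 (μ * ε) (by positivity)
      refine ⟨N, fun n hn => ?_⟩
      have h2 := hN n hn
      rw [dist_eq_norm, ← hp n, ← hp N, ← map_sub] at h2
      have h3 := (norm_le_resolvent (μ := μ) hg (p n - p N)).trans_lt h2
      rw [dist_eq_norm, ← map_sub]
      exact lt_of_mul_lt_mul_left h3 hμ.le
    obtain ⟨v, hv⟩ := cauchySeq_tendsto_of_complete hcauchy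
    obtain ⟨q, -, hq⟩ := hgraph v f fun q => by
      refine tendsto_nhds_unique (hv.inner tendsto_const_nhds) ?_
      simp only [← hsa, hp]
      exact hlim.inner tendsto_const_nhds
    exact ⟨q, hq⟩
  have hdense : Dense (Set.range T) := by
    have h : (LinearMap.range T.toLinearMap).topologicalClosure = ⊤ := by
      rw [Submodule.topologicalClosure_eq_top_iff, Submodule.eq_bot_iff]
      intro u hu
      rw [Submodule.mem_orthogonal'] at hu
      obtain ⟨p, hp1, hp2⟩ := hgraph u 0 fun q => by
        rw [inner_zero_left]; exact hu _ ⟨q, rfl⟩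
      have h1 := norm_le_resolvent (μ := μ) hg p
      rw [← hT, hp2, norm_zero, hp1] at h1
      have h2 : ‖u‖ ≤ 0 := by
        by_contra hc
        rw [not_le] at hc
        have := mul_pos hμ hc
        linarith
      exact norm_le_zero_iff.1 h2
    exact Submodule.dense_iff_topologicalClosure_eq_top.2 h
  have := hclosed.closure_eq ▸ hdense.closure_eq
  obtain ⟨p, hp⟩ := this.symm ▸ Set.mem_univ f
  exact ⟨p, hp⟩

end SelfAdjoint

section Half

lemma isClosed_sobolevHalf : IsClosed (sobolevHalf : Set (WithLp 2 (L2E × L2EE))) := by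
  rw [← isSeqClosed_iff_isClosed]
  intro p q hp hlim
  have h1 : Tendsto (fun n => (p n).fst) atTop (𝓝 q.fst) :=
    ((WithLp.fstL 2 ℂ L2E L2EE).continuous.tendsto q).comp hlim
  have h2 : Tendsto (fun n => (p n).snd) atTop (𝓝 q.snd) :=
    ((WithLp.sndL 2 ℂ L2E L2EE).continuous.tendsto q).comp hlim
  obtain ⟨a, ha, hae⟩ := (tendstoInMeasure_of_tendsto_Lp h1).exists_seq_tendsto_ae
  obtain ⟨b, hb, hbe⟩ :=
    (tendstoInMeasure_of_tendsto_Lp (h2.comp ha.tendsto_atTop)).exists_seq_tendsto_ae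
  have hall : ∀ᵐ z ∂(surfaceMeasure.prod surfaceMeasure), ∀ n,
      (p n).snd z = ((p n).fst z.1 - (p n).fst z.2) / ((z.1 - z.2 : ℝ) : ℂ) :=
    ae_all_iff.2 fun n => hp n
  change IsDiffQuotient q.fst q.snd
  filter_upwards [hall, hbe, Measure.quasiMeasurePreserving_fst.ae hae,
    Measure.quasiMeasurePreserving_snd.ae hae] with z k1 k2 k3 k4
  refine tendsto_nhds_unique k2 ?_
  simp only [Function.comp_apply, k1]
  exact (((k3.comp hb.tendsto_atTop).sub (k4.comp hb.tendsto_atTop))).div_const _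

instance completeSpace_sobolevHalf : CompleteSpace sobolevHalf :=
  isClosed_sobolevHalf.completeSpace_coe

lemma gagliardo_half_le (p : sobolevHalf) :
    gagliardo (etaOp (halfToL2 p)) ≤ ENNReal.ofReal (4 * ‖p.1.snd‖ ^ 2) := by
  rw [gagliardo_congr (coeFn_etaOp _), ENNReal.ofReal_mul (by norm_num), halfNorm_snd]
  refine (gagliardo_le_surfaceGagliardo (Lp.stronglyMeasurable _).measurable).trans (le_of_eq ?_)
  norm_num

lemma le_gagliardo_half (p : sobolevHalf) :
    ENNReal.ofReal (‖p.1.snd‖ ^ 2) ≤ gagliardo (etaOp (halfToL2 p)) := by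
  rw [gagliardo_congr (coeFn_etaOp _), halfNorm_snd]
  exact surfaceGagliardo_le _

lemma gagliardo_half_lt_top (p : sobolevHalf) : gagliardo (etaOp (halfToL2 p)) < ⊤ :=
  (gagliardo_half_le p).trans_lt ENNReal.ofReal_lt_top

lemma IsSqrtDtN.unique {f F G : L2R} (h1 : IsSqrtDtN f F) (h2 : IsSqrtDtN f G) : F = G :=
  Lp.ext (h1.trans h2.symm)

lemma IsSqrtDtN.norm_bounds {p : sobolevHalf} {G : L2R}
    (h : IsSqrtDtN (etaOp (halfToL2 p)) G) :
    ‖p.1.snd‖ ^ 2 ≤ gagConst * ‖G‖ ^ 2 ∧ gagConst * ‖G‖ ^ 2 ≤ 4 * ‖p.1.snd‖ ^ 2 := by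
  have h1 := le_gagliardo_half p
  have h2 := gagliardo_half_le p
  have h3 : 0 ≤ gagConst * ‖G‖ ^ 2 := mul_nonneg gagConst_pos.le (sq_nonneg _)
  rw [h.gagliardo_eq] at h1 h2
  exact ⟨(ENNReal.ofReal_le_ofReal_iff h3).1 h1,
    (ENNReal.ofReal_le_ofReal_iff (by positivity)).1 h2⟩

lemma isSqrtDtN_toLp (p : sobolevHalf) : IsSqrtDtN (etaOp (halfToL2 p))
    ((memLp_sqrt_of_gagliardo (gagliardo_half_lt_top p)).toLp _) :=
  (memLp_sqrt_of_gagliardo (gagliardo_half_lt_top p)).coeFn_toLp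

/-- The Fourier transform of `|D|^{1/2} η(v)` for `v ∈ W^{1/2,2}(ℰ)`. -/
def sqrtOp : sobolevHalf →L[ℂ] L2R :=
  LinearMap.mkContinuousOfExistsBound
    { toFun := fun p => (memLp_sqrt_of_gagliardo (gagliardo_half_lt_top p)).toLp _
      map_add' := fun p q => (isSqrtDtN_toLp (p + q)).unique (by
        rw [map_add, map_add]
        exact (isSqrtDtN_toLp p).add (isSqrtDtN_toLp q))
      map_smul' := fun c p => (isSqrtDtN_toLp (c • p)).unique (by
        rw [map_smul, map_smul]
        exact (isSqrtDtN_toLp p).smul c) }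
    ⟨Real.sqrt (4 / gagConst), fun p => by
      have h0 := gagConst_pos
      refine abs_le_of_sq_le_sq' ?_ (by positivity) |>.2
      rw [mul_pow, Real.sq_sqrt (by positivity), div_mul_eq_mul_div, le_div_iff₀ h0, mul_comm]
      refine (isSqrtDtN_toLp p).norm_bounds.2.trans ?_
      rw [half_norm_sq]
      nlinarith [sq_nonneg ‖halfToL2 p‖]⟩

lemma isSqrtDtN_sqrtOp (p : sobolevHalf) : IsSqrtDtN (etaOp (halfToL2 p)) (sqrtOp p) :=
  isSqrtDtN_toLp p

lemma half_norm_sq_le (p : sobolevHalf) :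
    ‖p‖ ^ 2 ≤ ‖halfToL2 p‖ ^ 2 + gagConst * ‖sqrtOp p‖ ^ 2 := by
  rw [half_norm_sq]
  have := (isSqrtDtN_sqrtOp p).norm_bounds.1
  linarith

lemma IsDtN.exists_half {v : L2E} {F : L2R} (h : IsDtN (etaOp v) F) :
    ∃ p : sobolevHalf, halfToL2 p = v := by
  obtain ⟨G, hG⟩ := h.exists_isSqrtDtN
  refine exists_half_of_surfaceGagliardo ((surfaceGagliardo_le v).trans_lt ?_)
  rw [← gagliardo_congr (coeFn_etaOp v), hG.gagliardo_eq]
  exact ENNReal.ofReal_lt_top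

lemma inner_sqrtOp_of_isDtN {p : sobolevOne} {F : L2R} (h : IsDtN (etaOp (oneToL2 p)) F)
    {q : sobolevHalf} (hq : halfToL2 q = oneToL2 p) (v : sobolevHalf) :
    ⟪sqrtOp v, sqrtOp q⟫_ℂ = 2 * ⟪halfToL2 v, dtnOp p⟫_ℂ := by
  have h1 := isSqrtDtN_sqrtOp q
  rw [hq] at h1
  rw [← (isSqrtDtN_sqrtOp v).inner_eq h1 h, inner_etaOp_dtn h]

/-- `W^{1,2}(ℰ)` is contained in `W^{1/2,2}(ℰ)`. -/
lemma exists_half (p : sobolevOne) : ∃ q : sobolevHalf, halfToL2 q = oneToL2 p ∧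
    ∀ v : sobolevHalf, ⟪sqrtOp v, sqrtOp q⟫_ℂ = 2 * ⟪halfToL2 v, dtnOp p⟫_ℂ := by
  choose F hF using fun n => (hasBoundedSupport_truncate n p).exists_isDtN
  choose q hq using fun n => (hF n).exists_half
  have hdiff : ∀ n m, ‖q n - q m‖ ^ 2
      ≤ (1 + 2 * gagConst * ‖dtnOp‖) * ‖truncate n p - truncate m p‖ ^ 2 := by
    intro n m
    have e1 : halfToL2 (q n - q m) = oneToL2 (truncate n p - truncate m p) := by
      rw [map_sub, map_sub, hq, hq]
    have e2 : IsDtN (etaOp (oneToL2 (truncate n p - truncate m p))) (F n - F m) := by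
      rw [map_sub, map_sub]; exact (hF n).sub (hF m)
    have e3 := inner_sqrtOp_of_isDtN e2 e1 (q n - q m)
    set d := truncate n p - truncate m p
    rw [inner_self_eq_norm_sq_to_K, e1] at e3
    have e4 : ‖sqrtOp (q n - q m)‖ ^ 2 ≤ 2 * (‖oneToL2 d‖ * (‖dtnOp‖ * ‖d‖)) := by
      calc ‖sqrtOp (q n - q m)‖ ^ 2 = ‖(‖sqrtOp (q n - q m)‖ : ℂ) ^ 2‖ := by simp
        _ = ‖2 * ⟪oneToL2 d, dtnOp d⟫_ℂ‖ := congrArg norm e3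
        _ = 2 * ‖⟪oneToL2 d, dtnOp d⟫_ℂ‖ := by simp
        _ ≤ _ := by
            gcongr
            exact (norm_inner_le_norm _ _).trans (by gcongr; exact dtnOp.le_opNorm d)
    have e5 := one_norm_sq d
    have e6 : ‖oneToL2 d‖ ^ 2 ≤ ‖d‖ ^ 2 := by nlinarith [sq_nonneg ‖oneDeriv d‖]
    have e7 : ‖oneToL2 d‖ ≤ ‖d‖ := abs_le_of_sq_le_sq' e6 (norm_nonneg _) |>.2
    have e8 := half_norm_sq_le (q n - q m)
    rw [e1] at e8
    have e9 : ‖oneToL2 d‖ * (‖dtnOp‖ * ‖d‖) ≤ ‖d‖ * (‖dtnOp‖ * ‖d‖) := by gcongr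
    calc _ ≤ ‖oneToL2 d‖ ^ 2 + gagConst * ‖sqrtOp (q n - q m)‖ ^ 2 := e8
      _ ≤ ‖d‖ ^ 2 + gagConst * (2 * (‖d‖ * (‖dtnOp‖ * ‖d‖))) := by
          have := gagConst_pos
          gcongr
          exact e4.trans (by linarith)
      _ = _ := by ring
  have hC : 0 ≤ 1 + 2 * gagConst * ‖dtnOp‖ := by have := gagConst_pos; positivity
  have hcauchy : CauchySeq q := by
    have h1 := (tendsto_truncate p).cauchySeq
    rw [Metric.cauchySeq_iff'] at h1 ⊢
    intro ε hε
    set D := Real.sqrt (1 + 2 * gagConst * ‖dtnOp‖) with hD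
    obtain ⟨N, hN⟩ := h1 (ε / (D + 1)) (by positivity)
    refine ⟨N, fun n hn => ?_⟩
    have h2 := hN n hn
    rw [dist_eq_norm] at h2 ⊢
    have h3 : ‖q n - q N‖ ≤ D * ‖truncate n p - truncate N p‖ := by
      refine abs_le_of_sq_le_sq' ?_ (by positivity) |>.2
      rw [mul_pow, hD, Real.sq_sqrt hC]
      exact hdiff n N
    calc _ ≤ D * ‖truncate n p - truncate N p‖ := h3
      _ ≤ (D + 1) * ‖truncate n p - truncate N p‖ := by gcongr; linarith
      _ < (D + 1) * (ε / (D + 1)) := by gcongr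
      _ = ε := mul_div_cancel₀ ε (by positivity)
  obtain ⟨r, hr⟩ := cauchySeq_tendsto_of_complete hcauchy
  have hp := tendsto_truncate p
  refine ⟨r, ?_, fun v => ?_⟩
  · refine tendsto_nhds_unique ((halfToL2.continuous.tendsto r).comp hr) ?_
    simp only [Function.comp_def, hq]
    exact (oneToL2.continuous.tendsto p).comp hp
  · refine tendsto_nhds_unique
      ((tendsto_const_nhds (x := sqrtOp v)).inner (𝕜 := ℂ) ((sqrtOp.continuous.tendsto r).comp hr)) ?_
    simp only [Function.comp_def, inner_sqrtOp_of_isDtN (hF _) (hq _)]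
    exact ((tendsto_const_nhds).inner (𝕜 := ℂ) ((dtnOp.continuous.tendsto p).comp hp)).const_mul 2

lemma inner_sqrtOp {p : sobolevOne} {q : sobolevHalf} (hq : halfToL2 q = oneToL2 p)
    (v : sobolevHalf) : ⟪sqrtOp v, sqrtOp q⟫_ℂ = 2 * ⟪halfToL2 v, dtnOp p⟫_ℂ := by
  obtain ⟨r, hr, h⟩ := exists_half p
  rw [halfToL2_injective (hq.trans hr.symm), h]

lemma energySq_eq (g : ℝ) {p : sobolevOne} {q : sobolevHalf} (hq : halfToL2 q = oneToL2 p) :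
    energySq g dtnOp p = ‖halfToL2 q‖ ^ 2 + g / 2 * ‖sqrtOp q‖ ^ 2 := by
  have h1 := inner_sqrtOp hq q
  have h2 : (⟪sqrtOp q, sqrtOp q⟫_ℂ).re = ‖sqrtOp q‖ ^ 2 := inner_self_eq_norm_sq (𝕜 := ℂ) _
  have h3 : (⟪oneToL2 p, oneToL2 p⟫_ℂ).re = ‖oneToL2 p‖ ^ 2 := inner_self_eq_norm_sq (𝕜 := ℂ) _
  rw [h1, hq] at h2
  simp only [Complex.mul_re, Complex.re_ofNat, Complex.im_ofNat, zero_mul, sub_zero] at h2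
  rw [energySq, inner_add_right, inner_smul_right, Complex.add_re, Complex.re_ofReal_mul, h3, hq,
    ← h2]
  ring

lemma energySq_bounds {g : ℝ} (hg : 0 < g) : ∃ c C : ℝ, 0 < c ∧ 0 < C ∧ ∀ w : sobolevOne,
    ∃ v : sobolevHalf, halfToL2 v = oneToL2 w ∧ c * ‖v‖ ^ 2 ≤ energySq g dtnOp w ∧
      energySq g dtnOp w ≤ C * ‖v‖ ^ 2 := by
  have hc := gagConst_pos
  refine ⟨min 1 (g / (2 * gagConst)), max 1 (2 * g / gagConst), by positivity, by positivity,
    fun w => ?_⟩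
  obtain ⟨v, hv, -⟩ := exists_half w
  refine ⟨v, hv, ?_, ?_⟩
  · rw [energySq_eq g hv, half_norm_sq, mul_add]
    refine add_le_add (mul_le_of_le_one_left (sq_nonneg _) (min_le_left _ _)) ?_
    calc _ ≤ g / (2 * gagConst) * ‖v.1.snd‖ ^ 2 := by gcongr; exact min_le_right _ _
      _ ≤ g / (2 * gagConst) * (gagConst * ‖sqrtOp v‖ ^ 2) := by
          gcongr; exact (isSqrtDtN_sqrtOp v).norm_bounds.1
      _ = _ := by field_simp
  · rw [energySq_eq g hv, half_norm_sq, mul_add]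
    refine add_le_add (le_mul_of_one_le_left (sq_nonneg _) (le_max_left _ _)) ?_
    calc g / 2 * ‖sqrtOp v‖ ^ 2 = g / (2 * gagConst) * (gagConst * ‖sqrtOp v‖ ^ 2) := by
          field_simp
      _ ≤ g / (2 * gagConst) * (4 * ‖v.1.snd‖ ^ 2) := by
          exact mul_le_mul_of_nonneg_left (isSqrtDtN_sqrtOp v).norm_bounds.2 (by positivity)
      _ = 2 * g / gagConst * ‖v.1.snd‖ ^ 2 := by field_simp; ring
      _ ≤ _ := by gcongr; exact le_max_right _ _

end Half

section Wave

/-- The pair `x ↦ (f x, g x)` with values in a Hilbert sum. -/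
def hilbertPair {X E F : Type*} [NormedAddCommGroup X] [NormedSpace ℂ X] [NormedAddCommGroup E]
    [InnerProductSpace ℂ E] [NormedAddCommGroup F] [InnerProductSpace ℂ F]
    (f : X →L[ℂ] E) (g : X →L[ℂ] F) : X →L[ℂ] WithLp 2 (E × F) :=
  (WithLp.prodContinuousLinearEquiv 2 ℂ E F).symm.toContinuousLinearMap ∘L f.prod g

section HilbertPair

variable {X E F : Type*} [NormedAddCommGroup X] [NormedSpace ℂ X] [NormedAddCommGroup E]
  [InnerProductSpace ℂ E] [NormedAddCommGroup F] [InnerProductSpace ℂ F]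
  (f : X →L[ℂ] E) (g : X →L[ℂ] F)

lemma inner_hilbertPair (x y : X) :
    ⟪hilbertPair f g x, hilbertPair f g y⟫_ℂ = ⟪f x, f y⟫_ℂ + ⟪g x, g y⟫_ℂ :=
  WithLp.prod_inner_apply _ _

lemma norm_sq_hilbertPair (x : X) : ‖hilbertPair f g x‖ ^ 2 = ‖f x‖ ^ 2 + ‖g x‖ ^ 2 :=
  WithLp.prod_norm_sq_eq_of_L2 _

end HilbertPair

/-- `W^{1,2}(ℰ)` is dense in `W^{1/2,2}(ℰ)`. -/
lemma dense_one_half :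
    Dense {v : sobolevHalf | halfToL2 v ∈ Set.range oneToL2} := by
  let S : Submodule ℂ sobolevHalf :=
    (LinearMap.range oneToL2.toLinearMap).comap halfToL2.toLinearMap
  let M := S.topologicalClosure
  have hM : IsClosed (M : Set sobolevHalf) := S.isClosed_topologicalClosure
  have : CompleteSpace M := hM.completeSpace_coe
  let J := hilbertPair halfToL2 sqrtOp
  have hJ : ∀ v, ‖v‖ ≤ (1 + gagConst) * ‖J v‖ := by
    intro v
    have hc := gagConst_pos
    refine abs_le_of_sq_le_sq' ?_ (by positivity) |>.2
    have h1 := half_norm_sq_le v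
    rw [mul_pow, norm_sq_hilbertPair]
    nlinarith [sq_nonneg ‖halfToL2 v‖, sq_nonneg ‖sqrtOp v‖, mul_nonneg hc.le
      (sq_nonneg ‖halfToL2 v‖), mul_nonneg (sq_nonneg gagConst) (sq_nonneg ‖halfToL2 v‖),
      mul_nonneg (sq_nonneg gagConst) (sq_nonneg ‖sqrtOp v‖), mul_nonneg hc.le
      (sq_nonneg ‖sqrtOp v‖)]
  let JM := J ∘L M.subtypeL
  have hanti : AntilipschitzWith (Real.toNNReal (1 + gagConst)) JM :=
    JM.antilipschitz_of_bound fun v => by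
      rw [Real.coe_toNNReal _ (by have := gagConst_pos; positivity)]
      exact hJ v
  let K : Submodule ℂ (WithLp 2 (L2E × L2R)) := LinearMap.range JM.toLinearMap
  have hK : IsClosed (K : Set (WithLp 2 (L2E × L2R))) := by
    have := hanti.isClosed_range JM.uniformContinuous
    exact this
  have : CompleteSpace K := hK.completeSpace_coe
  suffices H : ∀ v : sobolevHalf, v ∈ M from fun v => H v
  intro v
  obtain ⟨k, ⟨m, rfl⟩, r, hr, hsum⟩ := K.exists_add_mem_mem_orthogonal (J v)
  have hr' : r = J (v - m) := by
    rw [map_sub, hsum]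
    exact (add_sub_cancel_left _ _).symm
  have h0 : v - m = 0 := by
    have h1 : halfToL2 (v - m) = 0 := by
      obtain ⟨p, hp⟩ := exists_resolvent one_pos two_pos (halfToL2 (v - m))
      obtain ⟨q, hq, hQ⟩ := exists_half p
      have hqS : q ∈ M := S.le_topologicalClosure ⟨p, hq.symm⟩
      have h2 : ⟪J (v - m), J q⟫_ℂ = 0 := by
        rw [← hr']
        exact Submodule.inner_left_of_mem_orthogonal (K := K) ⟨⟨q, hqS⟩, rfl⟩ hr
      rw [inner_hilbertPair, hQ, hq] at h2
      have h3 : ⟪halfToL2 (v - m), ((1 : ℝ) : ℂ) • oneToL2 p + ((2 : ℝ) : ℂ) • dtnOp p⟫_ℂ = 0 := by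
        rw [inner_add_right, inner_smul_right, inner_smul_right]
        push_cast
        linear_combination h2
      rw [hp] at h3
      exact inner_self_eq_zero.1 h3
    exact halfToL2_injective (h1.trans (map_zero _).symm)
  rw [sub_eq_zero] at h0
  exact h0 ▸ m.2

lemma denseRange_halfToL2 : DenseRange halfToL2 := by
  refine denseRange_oneToL2.mono ?_
  rintro _ ⟨p, rfl⟩
  obtain ⟨q, hq, -⟩ := exists_half p
  exact ⟨q, hq⟩

lemma dense_waveDomain : Dense (waveDomain : Set State) := by
  have h := dense_one_half.prod (dense_univ.prod (denseRange_halfToL2.prod dense_univ)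
    : Dense ((Set.univ : Set ℂ) ×ˢ (Set.range halfToL2 ×ˢ (Set.univ : Set ℂ))))
  refine h.mono ?_
  rintro ⟨v, h, u, l⟩ ⟨h1, -, h2, -⟩
  exact ⟨h1, h2⟩

/-- The energy operator of the floating cylinder. -/
def energyMap (g : ℝ) : State →L[ℂ]
    WithLp 2 (L2E × WithLp 2 (L2R × WithLp 2 (ℂ × WithLp 2 (L2E × ℂ)))) :=
  hilbertPair (halfToL2 ∘L ContinuousLinearMap.fst ℂ _ _) <|
  hilbertPair ((Real.sqrt (g / 2) : ℂ) • (sqrtOp ∘L ContinuousLinearMap.fst ℂ _ _)) <|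
  hilbertPair ((Real.sqrt (2 * g / Real.pi) : ℂ) •
    (ContinuousLinearMap.fst ℂ _ _ ∘L ContinuousLinearMap.snd ℂ _ _)) <|
  hilbertPair (ContinuousLinearMap.fst ℂ _ _ ∘L ContinuousLinearMap.snd ℂ _ _ ∘L
      ContinuousLinearMap.snd ℂ _ _)
    (ContinuousLinearMap.snd ℂ _ _ ∘L ContinuousLinearMap.snd ℂ _ _ ∘L
      ContinuousLinearMap.snd ℂ _ _)

lemma inner_sqrt_smul {E : Type*} [NormedAddCommGroup E] [InnerProductSpace ℂ E] {a : ℝ}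
    (ha : 0 ≤ a) (x y : E) :
    ⟪(Real.sqrt a : ℂ) • x, (Real.sqrt a : ℂ) • y⟫_ℂ = a * ⟪x, y⟫_ℂ := by
  rw [inner_smul_left, inner_smul_right, Complex.conj_ofReal, ← mul_assoc, ← Complex.ofReal_mul,
    Real.mul_self_sqrt ha]

lemma norm_sq_sqrt_smul {E : Type*} [NormedAddCommGroup E] [InnerProductSpace ℂ E] {a : ℝ}
    (ha : 0 ≤ a) (x : E) : ‖(Real.sqrt a : ℂ) • x‖ ^ 2 = a * ‖x‖ ^ 2 := by
  rw [norm_smul, mul_pow, Complex.norm_real, Real.norm_eq_abs, sq_abs, Real.sq_sqrt ha]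

lemma inner_energyMap {g : ℝ} (hg : 0 ≤ g) (z y : State) :
    ⟪energyMap g z, energyMap g y⟫_ℂ = ⟪halfToL2 z.1, halfToL2 y.1⟫_ℂ
      + ((((g / 2 : ℝ) : ℂ) * ⟪sqrtOp z.1, sqrtOp y.1⟫_ℂ)
      + ((((2 * g / Real.pi : ℝ) : ℂ) * ⟪z.2.1, y.2.1⟫_ℂ)
      + (⟪z.2.2.1, y.2.2.1⟫_ℂ + ⟪z.2.2.2, y.2.2.2⟫_ℂ))) := by
  have h1 := inner_sqrt_smul (a := g / 2) (by positivity) (sqrtOp z.1) (sqrtOp y.1)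
  have h2 := inner_sqrt_smul (a := 2 * g / Real.pi) (by have := Real.pi_pos; positivity)
    z.2.1 y.2.1
  rw [← h1, ← h2]
  simp only [energyMap, inner_hilbertPair]
  rfl

lemma norm_sq_energyMap {g : ℝ} (hg : 0 ≤ g) (z : State) :
    ‖energyMap g z‖ ^ 2 = ‖halfToL2 z.1‖ ^ 2 + (g / 2 * ‖sqrtOp z.1‖ ^ 2
      + (2 * g / Real.pi * ‖z.2.1‖ ^ 2 + (‖z.2.2.1‖ ^ 2 + ‖z.2.2.2‖ ^ 2))) := by
  have h1 := norm_sq_sqrt_smul (a := g / 2) (by positivity) (sqrtOp z.1)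
  have h2 := norm_sq_sqrt_smul (a := 2 * g / Real.pi) (by have := Real.pi_pos; positivity) z.2.1
  rw [← h1, ← h2]
  simp only [energyMap, norm_sq_hilbertPair]
  rfl

lemma norm_le_energyMap {g : ℝ} (hg : 0 < g) :
    ∃ K : ℝ, ∀ z : State, ‖z‖ ≤ K * ‖energyMap g z‖ := by
  have hc := gagConst_pos
  have hpi := Real.pi_pos
  let K : ℝ := 1 + 2 * gagConst / g + Real.pi / (2 * g)
  have hK1 : 1 ≤ K := by
    have h1 : 0 ≤ 2 * gagConst / g := by positivity
    have h2 : 0 ≤ Real.pi / (2 * g) := by positivity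
    simp only [K]; linarith
  have hKa : 2 * gagConst / g ≤ K := by
    have h2 : 0 ≤ Real.pi / (2 * g) := by positivity
    simp only [K]; linarith
  have hKb : Real.pi / (2 * g) ≤ K := by
    have h2 : 0 ≤ 2 * gagConst / g := by positivity
    simp only [K]; linarith
  refine ⟨K, fun z => ?_⟩
  have key : ∀ r : ℝ, r ^ 2 ≤ K * ‖energyMap g z‖ ^ 2 → r ≤ K * ‖energyMap g z‖ := by
    intro r hr
    refine abs_le_of_sq_le_sq' ?_ (by positivity) |>.2
    refine hr.trans ?_
    rw [mul_pow]
    gcongr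
    nlinarith
  have hE := norm_sq_energyMap hg.le z
  have p1 := sq_nonneg ‖halfToL2 z.1‖
  have p2 : 0 ≤ g / 2 * ‖sqrtOp z.1‖ ^ 2 := by positivity
  have p3 : 0 ≤ 2 * g / Real.pi * ‖z.2.1‖ ^ 2 := by positivity
  have p4 := sq_nonneg ‖z.2.2.1‖
  have p5 := sq_nonneg ‖z.2.2.2‖
  have hle : ∀ s : ℝ, 0 ≤ s → s ≤ K * s := fun s hs => le_mul_of_one_le_left hs hK1
  have hK0 : 0 ≤ K := by linarith
  refine norm_prod_le_iff.2 ⟨key _ ?_, norm_prod_le_iff.2 ⟨key _ ?_, norm_prod_le_iff.2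
    ⟨key _ ?_, key _ ?_⟩⟩⟩
  · have h1 := half_norm_sq_le z.1
    have h2 : gagConst * ‖sqrtOp z.1‖ ^ 2 ≤ K * (g / 2 * ‖sqrtOp z.1‖ ^ 2) := by
      calc _ = 2 * gagConst / g * (g / 2 * ‖sqrtOp z.1‖ ^ 2) := by field_simp
        _ ≤ _ := by gcongr
    calc _ ≤ K * ‖halfToL2 z.1‖ ^ 2 + K * (g / 2 * ‖sqrtOp z.1‖ ^ 2) := by
          linarith [hle _ p1]
      _ ≤ _ := by rw [← mul_add, hE]; gcongr; linarith
  · calc ‖z.2.1‖ ^ 2 = Real.pi / (2 * g) * (2 * g / Real.pi * ‖z.2.1‖ ^ 2) := by field_simp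
      _ ≤ K * ‖energyMap g z‖ ^ 2 := by
          rw [hE]; gcongr; linarith
  · exact (hle _ p4).trans (by rw [hE]; gcongr; linarith)
  · exact (hle _ p5).trans (by rw [hE]; gcongr; linarith)

lemma skew_waveOperator {g : ℝ} (hg : 0 < g) (d : waveDomain) :
    |(⟪energyMap g d, energyMap g (waveOperator g dtnOp d)⟫_ℂ).re|
      ≤ 1 / 2 * ‖energyMap g d‖ ^ 2 := by
  obtain ⟨⟨v, h, u, l⟩, hd⟩ := d
  set d : waveDomain := ⟨(v, h, u, l), hd⟩
  have hA : waveOperator g dtnOp d = (waveDomainVelocity d, l,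
      -((g : ℂ) • dtnOp (waveDomainPosition d)), -(((2 * g / Real.pi : ℝ) : ℂ) * h)) := rfl
  have hv : halfToL2 v = oneToL2 (waveDomainPosition d) := (oneToL2_waveDomainPosition d).symm
  have hu : halfToL2 (waveDomainVelocity d) = u := halfToL2_waveDomainVelocity d
  have hQ := inner_sqrtOp hv (waveDomainVelocity d)
  rw [hu] at hQ
  have hQ' : ⟪sqrtOp v, sqrtOp (waveDomainVelocity d)⟫_ℂ
      = conj (2 * ⟪u, dtnOp (waveDomainPosition d)⟫_ℂ) := by
    rw [← hQ, inner_conj_symm]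
  have key : (⟪energyMap g d, energyMap g (waveOperator g dtnOp d)⟫_ℂ).re
      = (⟪halfToL2 v, u⟫_ℂ).re := by
    rw [inner_energyMap hg.le, hA]
    simp only [hu]
    rw [hQ']
    simp only [inner_neg_right, inner_smul_right, d]
    have e1 : ⟪l, ((2 * g / Real.pi : ℝ) : ℂ) * h⟫_ℂ
        = ((2 * g / Real.pi : ℝ) : ℂ) * conj ⟪h, l⟫_ℂ := by
      rw [inner_conj_symm, ← smul_eq_mul, inner_smul_right]
    rw [e1]
    simp only [Complex.add_re, Complex.neg_re, Complex.conj_re, Complex.ofReal_re,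
      Complex.ofReal_im, map_mul,
      Complex.mul_re, Complex.conj_im, map_ofNat, Complex.re_ofNat, Complex.im_ofNat]
    ring
  rw [key]
  have h1 : |(⟪halfToL2 v, u⟫_ℂ).re| ≤ ‖halfToL2 v‖ * ‖u‖ :=
    (Complex.abs_re_le_norm _).trans (norm_inner_le_norm _ _)
  have h2 := norm_sq_energyMap hg.le (d : State)
  have hpi := Real.pi_pos
  have p2 : 0 ≤ g / 2 * ‖sqrtOp v‖ ^ 2 := by positivity
  have p3 : 0 ≤ 2 * g / Real.pi * ‖h‖ ^ 2 := by positivity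
  have p5 := sq_nonneg ‖l‖
  have h3 : ‖halfToL2 v‖ ^ 2 + ‖u‖ ^ 2 ≤ ‖energyMap g (d : State)‖ ^ 2 := by
    rw [h2]; change _ ≤ ‖halfToL2 v‖ ^ 2 + (g / 2 * ‖sqrtOp v‖ ^ 2
      + (2 * g / Real.pi * ‖h‖ ^ 2 + (‖u‖ ^ 2 + ‖l‖ ^ 2)))
    linarith
  nlinarith [sq_nonneg (‖halfToL2 v‖ - ‖u‖)]

lemma surjective_waveOperator {g : ℝ} (hg : 0 < g) {c : ℝ} (hc : c ≠ 0) (f : State) :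
    ∃ d : waveDomain, (c : ℂ) • (d : State) - waveOperator g dtnOp d = f := by
  obtain ⟨a, q, b, p⟩ := f
  obtain ⟨w, hw⟩ := exists_resolvent (by positivity : 0 < c ^ 2) hg (b + (c : ℂ) • halfToL2 a)
  obtain ⟨v, hv, -⟩ := exists_half w
  let u := (c : ℂ) • v - a
  set κ : ℝ := 2 * g / Real.pi with hκ
  have hκ0 : 0 < κ := by have := Real.pi_pos; positivity
  have hden : (c : ℂ) ^ 2 + κ ≠ 0 := by
    have : c ^ 2 + κ ≠ 0 := by positivity
    exact_mod_cast this
  let h : ℂ := (p + c * q) / ((c : ℂ) ^ 2 + κ)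
  let l : ℂ := c * h - q
  let d : waveDomain := ⟨(v, h, halfToL2 u, l), ⟨w, hv.symm⟩, ⟨u, rfl⟩⟩
  have hA : waveOperator g dtnOp d = (waveDomainVelocity d, l,
      -((g : ℂ) • dtnOp (waveDomainPosition d)), -((κ : ℂ) * h)) := rfl
  have h1 : waveDomainVelocity d = u := halfToL2_injective (halfToL2_waveDomainVelocity d)
  have h2 : waveDomainPosition d = w :=
    oneToL2_injective ((oneToL2_waveDomainPosition d).trans hv)
  refine ⟨d, ?_⟩
  rw [hA, h1, h2]
  refine Prod.ext ?_ (Prod.ext ?_ (Prod.ext ?_ ?_))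
  · change (c : ℂ) • v - u = a
    simp only [u, sub_sub_cancel]
  · change (c : ℂ) * h - l = q
    simp only [l, sub_sub_cancel]
  · change (c : ℂ) • halfToL2 u - -((g : ℂ) • dtnOp w) = b
    have e : halfToL2 u = (c : ℂ) • oneToL2 w - halfToL2 a := by
      simp only [u, map_sub, map_smul, hv]
    rw [e, sub_neg_eq_add, smul_sub, smul_smul, sub_add_eq_add_sub, sub_eq_iff_eq_add, ← hw]
    congr 2
    push_cast; ring
  · change (c : ℂ) * l - -((κ : ℂ) * h) = p
    simp only [l, h]
    field_simp
    ring

lemma generatesC0Group_waveOperator {g : ℝ} (hg : 0 < g) :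
    GeneratesC0Group (waveOperator g dtnOp) := by
  obtain ⟨K, hK⟩ := norm_le_energyMap hg
  have H : QuasiSkew (energyMap g) (waveOperator g dtnOp) K (1 / 2) :=
    { bound := hK
      nonneg := by norm_num
      dense := dense_waveDomain
      skew := skew_waveOperator hg
      surj := fun c hc f => surjective_waveOperator hg (by
        rintro rfl
        norm_num at hc) f }
  exact H.generatesC0Group

end Wave

end FloatingCylinder

end

theorem mainTheorem7 (g : ℝ) (hg : 0 < g) :
    ∃ Λ : FloatingCylinder.sobolevOne →L[ℂ] FloatingCylinder.L2E,
      -- `Λ` is the Dirichlet-to-Neumann map of `Ω`, and it is the only one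
      FloatingCylinder.IsDirichletToNeumann Λ ∧
      (∀ Λ' : FloatingCylinder.sobolevOne →L[ℂ] FloatingCylinder.L2E,
        FloatingCylinder.IsDirichletToNeumann Λ' → Λ' = Λ) ∧
      -- `W^{1/2,2}(ℰ)` is the completion of `W^{1,2}(ℰ)` for the norm `‖(I + gΛ)^{1/2} v‖`:
      -- the norms are equivalent on `W^{1,2}(ℰ)`, which is a dense subspace of `W^{1/2,2}(ℰ)`
      (∃ c C : ℝ, 0 < c ∧ 0 < C ∧ ∀ w : FloatingCylinder.sobolevOne,
        ∃ v : FloatingCylinder.sobolevHalf,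
          FloatingCylinder.halfToL2 v = FloatingCylinder.oneToL2 w ∧
          c * ‖v‖ ^ 2 ≤ FloatingCylinder.energySq g Λ w ∧
          FloatingCylinder.energySq g Λ w ≤ C * ‖v‖ ^ 2) ∧
      Dense {v : FloatingCylinder.sobolevHalf |
        FloatingCylinder.halfToL2 v ∈ Set.range FloatingCylinder.oneToL2} ∧
      -- the operator `A` generates a `C⁰` group on `X`
      FloatingCylinder.GeneratesC0Group (FloatingCylinder.waveOperator g Λ) := by
  exact ⟨FloatingCylinder.dtnOp, FloatingCylinder.isDirichletToNeumann_dtnOp,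
    fun _ h => h.eq_dtnOp, FloatingCylinder.energySq_bounds hg, FloatingCylinder.dense_one_half,
    FloatingCylinder.generatesC0Group_waveOperator hg⟩
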